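/- Let $\Omega\subset\mathbb R^2$ be a bounded, simply connected polygonal domain (taken open), and let $\Delta$ be a polygonal partition of $\Omega$ with finitely many interior edges. Let $0\le\mu\le d$ be integers, let $\Pi_d$ be the space of bivariate polynomials of total degree at most $d$, and for a partition $\Delta'$ of $\Omega$ let $$S_d^\mu(\Delta')=\{s\in C^\mu(\Omega): s|_\phi\in\Pi_d \text{ for every cell } \phi \text{ of } \Delta'\}.$$ Let $\Delta_c=\mathrm{ext}_s(\Delta)$ be the extended cross-cut partition of $\Delta$: every interior edge of $\Delta$ is extended in both directions along its line until it meets $\partial\Omega$; the resulting segments are the cross-cuts, and the cells of $\Delta_c$ are the connected components of the complement in $\Omega$ of their union. Let $L$ be the number of distinct cross-cuts, let $A_1,\dots,A_V\in\Omega$ be the interior vertices of $\Delta_c$ (the points where at least two cross-cuts meet), and let $N_i$ be the number of cross-cuts through $A_i$. An extended edge is an edge of $\Delta_c$ that is not covered by edges of $\Delta$. Then $S_d^\mu(\Delta)$ and $S_d^\mu(\Delta_c)$ are finite-dimensional, and each extended edge $l$ has two adjacent cells $\phi_1^l,\phi_2^l$ of $\Delta_c$, one on each side. Let $B_1,\dots,B_n$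 be any basis of $S_d^\mu(\Delta_c)$, and let $M$ be the coefficient matrix of the extended edge elimination (EEE) conditions, i.e. of the homogeneous linear system in $c=(c_1,\dots,c_n)$ $$\sum_{i=1}^n c_i\,\frac{\partial^r}{\partial \boldsymbol n_l^r}\bigl(B_i|_{\phi_1^l}-B_i|_{\phi_2^l}\bigr)\Big|_l\equiv 0,\qquad l \text{ an extended edge},\ r=\mu+1,\dots,d,$$ where $\boldsymbol n_l$ is a unit normal of $l$ and where each identity is written out by equating to zero all coefficients of the restriction to $l$, a polynomial in an affine arc-length parameter of the line of $l$. Then, for every choice of the basis, the parametrizations and the normals, $$\dim S_d^\mu(\Delta)=\binom{d+2}{2}+L\binom{d-\mu+1}{2}+\sum_{i=1}^V k_d^\mu(N_i)-\operatorname{rank}(M),$$ where $k_d^\mu(N)=\sum_{j=1}^{d-\mu}\bigl(N(d-\mu-j+1)-(d-j+2)\bigr)_+$ and $x_+=\max(x,0)$. -/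

import Mathlib

open scoped Topology

noncomputable section

namespace SplineDim

/-- The Euclidean plane. -/
abbrev Plane := EuclideanSpace ℝ (Fin 2)

/-- A (simply connected) polygonal domain, taken as an open set: bounded, simply connected,
equal to the interior of its closure, and with boundary made of finitely many segments. -/
structure IsPolygonalDomain (Ω : Set Plane) : Prop where
  isOpen : IsOpen Ω
  bounded : Bornology.IsBounded Ω
  simplyConnected : IsSimplyConnected Ω
  regular : interior (closure Ω) = Ω
  polygonal : ∃ B : Finset (Plane × Plane), frontier Ω ⊆ ⋃ e ∈ B, segment ℝ e.1 e.2

/-- The cells cut out of `Ω` by the grid `Γ`: the connected components of `Ω \ Γ`. -/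
def cells (Ω Γ : Set Plane) : Set (Set Plane) :=
  {φ | ∃ x ∈ Ω \ Γ, φ = connectedComponentIn (Ω \ Γ) x}

/-- Evaluation of a bivariate polynomial at a point of the plane. -/
def evalAt (p : MvPolynomial (Fin 2) ℝ) (x : Plane) : ℝ :=
  MvPolynomial.eval (fun i => x i) p

/-- The space `S_d^μ` of splines on `Ω` with respect to the cells cut out by the grid `Γ`:
functions that are `C^μ` on `Ω` and agree on each cell with a polynomial of total degree at most
`d`. A function on `Ω` is represented by its extension by zero to the plane. -/
def splineSpace (Ω Γ : Set Plane) (d μ : ℕ) : Submodule ℝ (Plane → ℝ) where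
  carrier := {s | (∀ x, x ∉ Ω → s x = 0) ∧ ContDiffOn ℝ μ s Ω ∧
    ∀ φ ∈ cells Ω Γ, ∃ p ∈ MvPolynomial.restrictTotalDegree (Fin 2) ℝ d,
      ∀ x ∈ φ, s x = evalAt p x}
  zero_mem' := ⟨fun _ _ => rfl, contDiffOn_const,
    fun _ _ => ⟨0, Submodule.zero_mem _, fun _ _ => by simp [evalAt]⟩⟩
  add_mem' := by
    rintro s t ⟨hs0, hs1, hs2⟩ ⟨ht0, ht1, ht2⟩
    refine ⟨fun x hx => by simp [hs0 x hx, ht0 x hx], hs1.add ht1, fun φ hφ => ?_⟩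
    obtain ⟨p, hp, hp'⟩ := hs2 φ hφ
    obtain ⟨q, hq, hq'⟩ := ht2 φ hφ
    exact ⟨p + q, Submodule.add_mem _ hp hq,
      fun x hx => by simp [evalAt, hp' x hx, hq' x hx]⟩
  smul_mem' := by
    rintro c s ⟨hs0, hs1, hs2⟩
    refine ⟨fun x hx => by simp [hs0 x hx], contDiffOn_const.smul hs1, fun φ hφ => ?_⟩
    obtain ⟨p, hp, hp'⟩ := hs2 φ hφ
    exact ⟨c • p, Submodule.smul_mem _ c hp, fun x hx => by simp [evalAt, hp' x hx]⟩

/-- A polygonal partition of `Ω`, given by its finitely many interior edges: nondegenerate segments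
whose relative interiors lie in `Ω`, and which separate cells (every point of an edge lying in `Ω`
is a common boundary point of two different cells). Edges may end on the boundary of `Ω`, and
T-junctions are allowed. -/
structure PolygonalPartition (Ω : Set Plane) where
  edges : Finset (Plane × Plane)
  nondegenerate : ∀ e ∈ edges, e.1 ≠ e.2
  inside : ∀ e ∈ edges, openSegment ℝ e.1 e.2 ⊆ Ω
  separates : ∀ e ∈ edges, ∀ x ∈ segment ℝ e.1 e.2 ∩ Ω,
    ∃ φ ∈ cells Ω (⋃ e ∈ edges, segment ℝ e.1 e.2),
    ∃ ψ ∈ cells Ω (⋃ e ∈ edges, segment ℝ e.1 e.2),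
      φ ≠ ψ ∧ x ∈ closure φ ∧ x ∈ closure ψ

/-- The cross-cut through the edge `[a, b]`: the edge extended in both directions along its line
until the boundary of `Ω` is met, i.e. the connected component of `line ∩ Ω` that contains the open
edge (the end points on the boundary are left out). -/
def crossCut (Ω : Set Plane) (e : Plane × Plane) : Set Plane :=
  connectedComponentIn ((line[ℝ, e.1, e.2] : Set Plane) ∩ Ω) (midpoint ℝ e.1 e.2)

namespace PolygonalPartition

variable {Ω : Set Plane} (Δ : PolygonalPartition Ω)

/-- The union of the edges. -/
def grid : Set Plane := ⋃ e ∈ Δ.edges, segment ℝ e.1 e.2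

/-- The cross-cuts of the extended cross-cut partition. -/
def crossCuts : Set (Set Plane) := crossCut Ω '' (Δ.edges : Set (Plane × Plane))

/-- The grid of the extended cross-cut partition. -/
def extGrid : Set Plane := ⋃₀ Δ.crossCuts

/-- The spline space `S_d^μ(Δ)`. -/
abbrev splines (d μ : ℕ) : Submodule ℝ (Plane → ℝ) := splineSpace Ω Δ.grid d μ

/-- The spline space `S_d^μ` over the extended cross-cut partition of `Δ`. -/
abbrev extSplines (d μ : ℕ) : Submodule ℝ (Plane → ℝ) := splineSpace Ω Δ.extGrid d μ

/-- The interior vertices of the extended cross-cut partition: the points of `Ω` at which at least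
two cross-cuts meet. -/
def vertices : Set Plane :=
  {A | ∃ C ∈ Δ.crossCuts, ∃ C' ∈ Δ.crossCuts, C ≠ C' ∧ A ∈ C ∧ A ∈ C'}

/-- The number `N(A)` of cross-cuts through the point `A`. -/
def cutsThrough (A : Plane) : ℕ := {C ∈ Δ.crossCuts | A ∈ C}.ncard

theorem vertices_finite : Δ.vertices.Finite := by
  have key : ∀ e ∈ Δ.edges, ∀ e' ∈ Δ.edges, crossCut Ω e ≠ crossCut Ω e' →
      (crossCut Ω e ∩ crossCut Ω e').Subsingleton := by
    rintro e he e' he' hne x ⟨hx, hx'⟩ y ⟨hy, hy'⟩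
    by_contra hxy
    apply hne
    have h1 := connectedComponentIn_subset _ _ hx
    have h2 := connectedComponentIn_subset _ _ hy
    have h3 := connectedComponentIn_subset _ _ hx'
    have h4 := connectedComponentIn_subset _ _ hy'
    have hl : line[ℝ, e.1, e.2] = line[ℝ, e'.1, e'.2] :=
      (affineSpan_pair_eq_of_mem_of_mem_of_ne h1.1 h2.1 hxy).symm.trans
        (affineSpan_pair_eq_of_mem_of_mem_of_ne h3.1 h4.1 hxy)
    unfold crossCut at *
    rw [hl] at hx ⊢
    exact (connectedComponentIn_eq hx).trans (connectedComponentIn_eq hx').symm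
  classical
  have hfin : (⋃ q ∈ (Δ.edges ×ˢ Δ.edges).filter (fun q => crossCut Ω q.1 ≠ crossCut Ω q.2),
      crossCut Ω q.1 ∩ crossCut Ω q.2).Finite := by
    refine Set.Finite.biUnion (Finset.finite_toSet _) (fun q hq => ?_)
    simp only [Finset.coe_filter, Finset.mem_product, Set.mem_ofPred_eq] at hq
    exact (key _ hq.1.1 _ hq.1.2 hq.2).finite
  refine hfin.subset ?_
  rintro A ⟨_, ⟨e, he, rfl⟩, _, ⟨e', he', rfl⟩, hne, hA, hA'⟩
  simp only [Set.mem_iUnion]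
  exact ⟨(e, e'), by simpa using ⟨⟨he, he'⟩, hne⟩, hA, hA'⟩

/-- The extended edges: the edges of the extended cross-cut partition that are not covered by edges
of `Δ`, i.e. the pieces (without end points) into which the other cross-cuts and the edges of `Δ`
divide each cross-cut, leaving out the edges of `Δ`. -/
def extendedEdges : Set (Set Plane) :=
  {l | ∃ C ∈ Δ.crossCuts, ∃ x ∈ C \ (Δ.grid ∪ ⋃₀ (Δ.crossCuts \ {C})),
    l = connectedComponentIn (C \ (Δ.grid ∪ ⋃₀ (Δ.crossCuts \ {C}))) x}

/-- The data used to write down the condition at an extended edge `l`: a parametrization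
`t ↦ base + t • dir` of its line, a unit normal, and the two cells of the extended cross-cut
partition adjacent to `l`, on the side the normal points to and on the opposite side. -/
structure EdgeFrame (l : Set Plane) where
  base : Plane
  dir : Plane
  normal : Plane
  pos : Set Plane
  neg : Set Plane
  base_mem : base ∈ l
  norm_dir : ‖dir‖ = 1
  on_line : ∀ x ∈ l, ∃ t : ℝ, x = base + t • dir
  norm_normal : ‖normal‖ = 1
  orthogonal : inner ℝ dir normal = 0
  pos_mem : pos ∈ cells Ω Δ.extGrid
  neg_mem : neg ∈ cells Ω Δ.extGrid
  pos_side : ∀ x ∈ l, ∀ᶠ t in 𝓝[>] (0 : ℝ), x + t • normal ∈ pos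
  neg_side : ∀ x ∈ l, ∀ᶠ t in 𝓝[>] (0 : ℝ), x - t • normal ∈ neg

end PolygonalPartition

open Classical in
/-- The polynomial of degree at most `d` that agrees with `s` on the cell `φ` (it is unique, a cell
being open and nonempty). -/
def cellPoly (d : ℕ) (s : Plane → ℝ) (φ : Set Plane) : MvPolynomial (Fin 2) ℝ :=
  if h : ∃ p ∈ MvPolynomial.restrictTotalDegree (Fin 2) ℝ d, ∀ x ∈ φ, s x = evalAt p x
  then h.choose else 0

/-- The derivative of a polynomial in the direction `v`. -/
def dirDeriv (v : Plane) (p : MvPolynomial (Fin 2) ℝ) : MvPolynomial (Fin 2) ℝ :=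
  ∑ i, MvPolynomial.C (v i) * MvPolynomial.pderiv i p

/-- The restriction of a polynomial to a line, as a polynomial in the parameter `t` of
`t ↦ a + t • u`. -/
def restrictLine (a u : Plane) (p : MvPolynomial (Fin 2) ℝ) : Polynomial ℝ :=
  MvPolynomial.aeval (fun i => Polynomial.C (a i) + Polynomial.X * Polynomial.C (u i)) p

/-- The coefficient matrix `M` of the extended edge elimination conditions
`∑ i, c i * ∂^r/∂n^r (N i|φ₁ - N i|φ₂)|_l ≡ 0`, for all extended edges `l` and `r = μ+1, …, d`.
The restriction to `l` is a polynomial of degree at most `d` in one variable `t`, and each of its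
coefficients (of `t^j`, `j = 0, …, d`) gives one row. -/
def eeeMatrix {Ω : Set Plane} (Δ : PolygonalPartition Ω) (d μ : ℕ) {n : ℕ}
    (N : Fin n → Δ.extSplines d μ) (F : ∀ l : Δ.extendedEdges, Δ.EdgeFrame l) :
    Matrix (Δ.extendedEdges × Fin (d - μ) × Fin (d + 1)) (Fin n) ℝ :=
  Matrix.of fun q i =>
    (restrictLine (F q.1).base (F q.1).dir
      ((dirDeriv (F q.1).normal)^[μ + 1 + q.2.1]
        (cellPoly d (N i) (F q.1).pos - cellPoly d (N i) (F q.1).neg))).coeff q.2.2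

/-- `k_d^μ(N) = ∑_{j=1}^{d-μ} (N (d-μ-j+1) - (d-j+2))₊`. -/
def vertexDim (d μ N : ℕ) : ℤ :=
  ∑ j ∈ Finset.Icc 1 (d - μ),
    max 0 ((N : ℤ) * ((d : ℤ) - μ - j + 1) - ((d : ℤ) - j + 2))

end SplineDim

end

/-! A spline over Δ is a spline over Δ_c that stays polynomial across every extended edge. The EEE
conditions express exactly this, so S(Δ) is the kernel of a linear map on S(Δ_c) whose matrix is M.
By rank-nullity dim S(Δ) = dim S(Δ_c) - rank M, and the main work is dim S(Δ_c).

Let ℓ be the linear form of a line. Near a point of a cross-cut that is not a vertex, a C^μ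
piecewise polynomial equals a polynomial plus a truncated power ℓ₊^(μ+1) q with deg q < d - μ,
because the difference of its two pieces vanishes to order μ on the line (`exists_jump`). The
coefficient q is unique, hence constant along the cross-cut between vertices. At a vertex it may
change from Lᵢ to Rᵢ on the i-th cross-cut, and comparing the pieces above and below the vertex
gives the single relation ∑ ℓᵢ^(μ+1) (Rᵢ - Lᵢ) = 0 (`exists_coneModel`). A spline over Δ_c therefore
yields one initial coefficient per cross-cut and one syzygy per vertex.

Conversely, every such family comes from a spline. The prescribed local models agree up to
polynomials of degree at most d, so the obstruction to gluing them is a Čech 1-cocycle with constant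
coefficients, which is a coboundary since Ω is simply connected (`exists_glued`). Splines without
jumps are global polynomials. The exact sequence polynomials → splines → jump data gives
`finrank_extSplines`.

The syzygies at a vertex split into homogeneous parts. With N slopes aᵢ, the part of degree j is the
kernel of (δᵢ) ↦ ∑ (X - aᵢ)^(μ+1) δᵢ on polynomials of degree at most j. This map has the largest
rank possible (`finrank_range_powerSum`, by a zero-counting duality), which produces the positive
parts in k_d^μ(N).

For the kernel, the jump across an extended edge is ±ℓ^(μ+1) q, so its normal derivatives up to
order μ vanish on the line anyway, and those of order μ+1, …, d vanish exactly when q = 0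
(`eeeRow_eq_zero_iff`). Polynomiality near all extended edges also gives it at the vertices of Δ_c
off the edges of Δ (`mem_splines_iff`). -/

noncomputable section

namespace SplineDim

/-! ### Ranks of spaces spanned by powers of linear forms -/

open Polynomial in
/-- Duality for powers of linear forms: if `W` contains `(X - aᵢ)^(n - k)` for `k < νᵢ` and
`∑ νᵢ > n`, then it contains all polynomials of degree at most `n`. -/
theorem X_pow_mem_of_sub_pow_mem {ι : Type*} [Fintype ι] {a : ι → ℝ} (ha : Function.Injective a)
    (ν : ι → ℕ) {n : ℕ} (hν : n < ∑ i, ν i) (W : Submodule ℝ ℝ[X])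
    (hW : ∀ i, ∀ k < ν i, k ≤ n → (X - C (a i)) ^ (n - k) ∈ W) {k : ℕ} (hk : k ≤ n) :
    (X : ℝ[X]) ^ k ∈ W := by
  by_contra hX
  obtain ⟨φ, hφ, hφW⟩ := Submodule.exists_le_ker_of_notMem hX
  -- `G X` is the polynomial y ↦ φ((X - y)^n). Its Taylor coefficients at aᵢ are, up to nonzero
  -- factors, the values of φ on the powers of X - aᵢ, so it vanishes to order νᵢ there. That is
  -- more than n zeros for degree at most n, while its own coefficients are the φ(X^l) up to nonzero
  -- factors.
  let G : ℝ[X] → ℝ[X] := fun A =>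
    ∑ l ∈ Finset.range (n + 1), monomial (n - l) ((-1) ^ (n - l) * n.choose l * φ (A ^ l))
  have hGeval : ∀ A y, (G A).eval y = φ ((A - C y) ^ n) := by
    intro A y
    rw [sub_eq_add_neg, ← C_neg, add_pow, map_sum, eval_finsetSum]
    refine Finset.sum_congr rfl fun l _ => ?_
    rw [eval_monomial, ← C_pow, ← C_eq_natCast, mul_assoc (A ^ l), ← C_mul, mul_comm (A ^ l),
      ← smul_eq_C_mul, map_smul, smul_eq_mul, neg_pow y]
    ring
  have hGcoeff : ∀ A, ∀ k ≤ n, (G A).coeff k = (-1) ^ k * n.choose (n - k) * φ (A ^ (n - k)) := by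
    intro A k hk
    simp only [G, finsetSum_coeff, coeff_monomial]
    rw [Finset.sum_eq_single (n - k)]
    · rw [if_pos (by omega), Nat.sub_sub_self hk]
    · intro l hl hlk
      rw [Finset.mem_range] at hl
      exact if_neg (by omega)
    · intro h
      exact absurd (Finset.mem_range.2 (by omega)) h
  have hGdeg : ∀ A, (G A).natDegree ≤ n := by
    intro A
    refine natDegree_sum_le_of_forall_le _ _ fun l _ => (natDegree_monomial_le _).trans (by omega)
  have hcomp : ∀ c, (G X).comp (X + C c) = G (X - C c) := by
    intro c
    refine Polynomial.funext fun y => ?_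
    rw [eval_comp, hGeval, hGeval]
    congr 2
    simp
    ring
  have hdvd : ∀ i, (X - C (a i)) ^ ν i ∣ G X := by
    intro i
    have h1 : X ^ ν i ∣ G (X - C (a i)) := by
      rw [X_pow_dvd_iff]
      intro k hk
      rcases le_or_gt k n with hkn | hkn
      · rw [hGcoeff _ k hkn, hφW (hW i k hk hkn), mul_zero]
      · exact coeff_eq_zero_of_natDegree_lt ((hGdeg _).trans_lt hkn)
    rw [← hcomp] at h1
    have h2 := (compRingHom (X - C (a i))).map_dvd h1
    rw [map_pow] at h2
    simpa [comp_assoc] using h2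
  have hprod : (∏ i, (X - C (a i)) ^ ν i) ∣ G X :=
    Finset.prod_dvd_of_coprime
      (fun i _ j _ hij => (pairwise_coprime_X_sub_C ha hij).pow) fun i _ => hdvd i
  have hzero : G X = 0 := by
    by_contra hne
    have h3 := natDegree_le_of_dvd hprod hne
    rw [natDegree_prod _ _ fun i _ => pow_ne_zero _ (X_sub_C_ne_zero _)] at h3
    simp only [natDegree_pow, natDegree_X_sub_C, mul_one] at h3
    have := hGdeg X
    omega
  have h4 := hGcoeff X (n - k) (by omega)
  rw [hzero, coeff_zero, Nat.sub_sub_self hk] at h4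
  have h5 : (n.choose k : ℝ) ≠ 0 := by exact_mod_cast (Nat.choose_pos hk).ne'
  exact hφ (by simpa [h5] using h4.symm)

open Polynomial in
/-- The map `(δᵢ) ↦ ∑ᵢ δᵢ (X - aᵢ)^ν` on polynomials of degree at most `j`. -/
def powerSum {ι : Type*} [Fintype ι] (a : ι → ℝ) (ν j : ℕ) :
    (ι → degreeLT ℝ (j + 1)) →ₗ[ℝ] ℝ[X] :=
  ∑ i, LinearMap.mulLeft ℝ ((X - C (a i)) ^ ν) ∘ₗ (degreeLT ℝ (j + 1)).subtype ∘ₗ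
    LinearMap.proj i

open Polynomial in
theorem powerSum_apply {ι : Type*} [Fintype ι] (a : ι → ℝ) (ν j : ℕ)
    (δ : ι → degreeLT ℝ (j + 1)) :
    powerSum a ν j δ = ∑ i, (X - C (a i)) ^ ν * (δ i : ℝ[X]) := by
  simp [powerSum]

open Polynomial in
instance finite_degreeLT (n : ℕ) : FiniteDimensional ℝ (degreeLT ℝ n) :=
  Module.Finite.equiv (degreeLTEquiv ℝ n).symm

open Polynomial in
theorem finrank_degreeLT_eq (n : ℕ) : Module.finrank ℝ (degreeLT ℝ n) = n := by
  rw [(degreeLTEquiv ℝ n).finrank_eq]; simp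

-- The two terms of the minimum are the dimensions of the source and of the space of polynomials of
-- degree at most j + μ + 1 containing the range. That the larger rank possible is attained comes
-- from `X_pow_mem_of_sub_pow_mem`.
open Polynomial in
theorem finrank_range_powerSum {ι : Type*} [Fintype ι] {a : ι → ℝ} (ha : Function.Injective a)
    (μ j : ℕ) : Module.finrank ℝ (LinearMap.range (powerSum a (μ + 1) j)) =
      min (Fintype.card ι * (j + 1)) (j + μ + 2) := by
  classical
  set n := j + μ + 1 with hn
  set R := LinearMap.range (powerSum a (μ + 1) j)
  have hR : R ≤ degreeLT ℝ (n + 1) := by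
    rintro _ ⟨δ, rfl⟩
    rw [powerSum_apply]
    refine Submodule.sum_mem _ fun i _ => ?_
    rw [mem_degreeLT, degree_mul, degree_pow, degree_X_sub_C]
    have h := mem_degreeLT.1 (δ i).2
    rcases eq_or_ne (δ i : ℝ[X]) 0 with h0 | h0
    · simp [h0]
    · rw [degree_eq_natDegree h0] at h ⊢
      rw [nsmul_eq_mul, mul_one]
      norm_cast at h ⊢
      omega
  have hcard : Module.finrank ℝ (ι → degreeLT ℝ (j + 1)) = Fintype.card ι * (j + 1) := by
    rw [Module.finrank_pi_fintype]
    simp [finrank_degreeLT_eq]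
  refine le_antisymm (le_min ?_ ?_) ?_
  · exact hcard ▸ LinearMap.finrank_range_le _
  · have := Submodule.finrank_mono hR
    rw [finrank_degreeLT_eq] at this
    omega
  -- An auxiliary node c outside the aᵢ supplies just the missing multiplicity n + 1 - N(j + 1),
  -- truncated at 0, with N the number of nodes. Duality then says that the range and these few
  -- powers of X - c span everything, so the range misses at most that many dimensions.
  · obtain ⟨c, hc⟩ := (Set.finite_range a).infinite_compl.nonempty
    let S : Set ℝ[X] :=
      ↑((Finset.range (n + 1 - Fintype.card ι * (j + 1))).image fun k => (X - C c) ^ (n - k))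
    let W : Submodule ℝ ℝ[X] := R ⊔ Submodule.span ℝ S
    have : FiniteDimensional ℝ (Submodule.span ℝ S) :=
      FiniteDimensional.span_finset ℝ _
    have hW : degreeLT ℝ (n + 1) ≤ W := by
      rw [degreeLT_eq_span_X_pow, Submodule.span_le]
      intro p hp
      simp only [Finset.coe_image, Set.mem_image, Finset.coe_range, Set.mem_Iio] at hp
      obtain ⟨k, hk, rfl⟩ := hp
      refine X_pow_mem_of_sub_pow_mem (ι := Option ι) (a := fun o => o.elim c a) ?_
        (fun o => o.elim (n + 1 - Fintype.card ι * (j + 1)) fun _ => j + 1) (n := n) ?_ W ?_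
        (by omega)
      · rintro (_ | x) (_ | y) h
        · rfl
        · exact absurd ⟨y, h.symm⟩ hc
        · exact absurd ⟨x, h⟩ hc
        · exact congrArg some (ha h)
      · rw [Fintype.sum_option]
        simp only [Option.elim_none, Option.elim_some, Finset.sum_const, Finset.card_univ,
          smul_eq_mul]
        omega
      · rintro (_ | i) k hk hkn
        · refine Submodule.mem_sup_right (Submodule.subset_span ?_)
          exact Finset.mem_coe.2 (Finset.mem_image.2 ⟨k, Finset.mem_range.2 hk, rfl⟩)
        · refine Submodule.mem_sup_left ?_
          simp only [Option.elim_some] at hk ⊢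
          have hmem : (X - C (a i)) ^ (j - k) ∈ degreeLT ℝ (j + 1) := by
            rw [mem_degreeLT, degree_pow, degree_X_sub_C]
            rw [nsmul_eq_mul, mul_one]
            exact_mod_cast (by omega : j - k < j + 1)
          refine ⟨Pi.single i ⟨_, hmem⟩, ?_⟩
          rw [powerSum_apply, Finset.sum_eq_single i]
          · rw [Pi.single_eq_same, ← pow_add]
            rw [show μ + 1 + (j - k) = n - k by omega]
          · intro l _ hl
            simp [Pi.single_eq_of_ne hl]
          · simp
    have h1 := Submodule.finrank_mono hW
    have h2 := Submodule.finrank_add_le_finrank_add_finrank R (Submodule.span ℝ S)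
    have h3 : Module.finrank ℝ (Submodule.span ℝ S) ≤ n + 1 - Fintype.card ι * (j + 1) :=
      (finrank_span_finset_le_card _).trans (Finset.card_image_le.trans (by simp))
    rw [finrank_degreeLT_eq] at h1
    change n + 1 ≤ Module.finrank ℝ ↥(R ⊔ Submodule.span ℝ S) at h1
    omega

theorem finrank_ker_powerSum {ι : Type*} [Fintype ι] {a : ι → ℝ} (ha : Function.Injective a)
    (μ j : ℕ) : (Module.finrank ℝ (LinearMap.ker (powerSum a (μ + 1) j)) : ℤ) =
      max 0 ((Fintype.card ι : ℤ) * (j + 1) - (j + μ + 2)) := by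
  have h1 := LinearMap.finrank_range_add_finrank_ker (powerSum a (μ + 1) j)
  rw [finrank_range_powerSum ha, Module.finrank_pi_fintype] at h1
  simp only [finrank_degreeLT_eq, Finset.sum_const, Finset.card_univ, smul_eq_mul] at h1
  have : (Fintype.card ι : ℤ) * (j + 1) = ((Fintype.card ι * (j + 1) : ℕ) : ℤ) := by push_cast; rfl
  rw [this]
  omega

open MvPolynomial

/-! ### Polynomials of bounded degree and their evaluation -/

/-- Bivariate polynomials of total degree less than `k`. -/
def polyLT (k : ℕ) : Submodule ℝ (MvPolynomial (Fin 2) ℝ) :=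
  restrictSupport ℝ {n | (n.sum fun _ e => e) < k}

/-- The strict bound is used so that `polyLT (d - μ)`, the space of coefficients of truncated
powers, is zero when μ = d. -/
theorem restrictTotalDegree_eq_polyLT (d : ℕ) :
    restrictTotalDegree (Fin 2) ℝ d = polyLT (d + 1) := by
  simp only [restrictTotalDegree, polyLT, Nat.lt_succ_iff]

theorem mem_polyLT {k : ℕ} {p : MvPolynomial (Fin 2) ℝ} :
    p ∈ polyLT k ↔ p = 0 ∨ p.totalDegree < k := by
  rcases k with _ | k
  · simp only [polyLT, mem_restrictSupport_iff, not_lt_zero, Set.ofPred_false,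
      Set.subset_empty_iff, Finset.coe_eq_empty, or_false]
    exact support_eq_empty
  · rw [← restrictTotalDegree_eq_polyLT, mem_restrictTotalDegree, Nat.lt_succ_iff]
    constructor
    · exact Or.inr
    · rintro (rfl | h)
      · simp
      · exact h

/-- Exponents are grouped by total degree, so that the dimension appears as ∑ (j + 1), the form
needed for the homogeneous decomposition in `homogeneousEquiv`. -/
def degreeLTEquivSigma (k : ℕ) :
    {n : Fin 2 →₀ ℕ | (n.sum fun _ e => e) < k} ≃ (Σ j : Fin k, Fin (j + 1)) where
  toFun n := ⟨⟨n.1 0 + n.1 1, by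
    have := n.2; simpa [Finsupp.sum_fintype] using this⟩, ⟨n.1 1, by simp⟩⟩
  invFun p := ⟨Finsupp.equivFunOnFinite.symm ![p.1 - p.2, p.2], by
    have := p.1.2; have := p.2.2
    simp [Finsupp.sum_fintype]; omega⟩
  left_inv n := by
    apply Subtype.ext; ext i; fin_cases i <;> simp
  right_inv p := by
    have ext : ∀ a b : (Σ j : Fin k, Fin (j + 1)),
        (a.1 : ℕ) = b.1 → (a.2 : ℕ) = b.2 → a = b := by
      rintro ⟨⟨a, _⟩, ⟨b, _⟩⟩ ⟨⟨a', _⟩, ⟨b', _⟩⟩ h h'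
      obtain rfl : a = a' := h
      obtain rfl : b = b' := h'
      rfl
    apply ext
    · have := p.2.2
      simp
      omega
    · simp

instance polyLT_finite (k : ℕ) : FiniteDimensional ℝ (polyLT k) :=
  Module.Finite.of_basis ((basisRestrictSupport ℝ _).reindex (degreeLTEquivSigma k))

theorem finrank_polyLT_eq_sum (k : ℕ) :
    Module.finrank ℝ (polyLT k) = ∑ j : Fin k, ((j : ℕ) + 1) := by
  exact (Module.finrank_eq_card_basis
    ((basisRestrictSupport ℝ _).reindex (degreeLTEquivSigma k))).trans (by simp)

theorem finrank_polyLT (k : ℕ) : Module.finrank ℝ (polyLT k) = (k + 1).choose 2 := by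
  rw [finrank_polyLT_eq_sum, Finset.sum_fin_eq_sum_range]
  induction k with
  | zero => simp
  | succ k ih =>
    rw [Finset.sum_range_succ, Nat.choose_succ_succ' (k + 1) 1, ← ih]
    simp only [Nat.lt_succ_self, dite_true, Nat.choose_one_right]
    rw [add_comm]
    congr 1
    refine Finset.sum_congr rfl fun i hi => ?_
    have := Finset.mem_range.1 hi
    simp [this, this.trans (Nat.lt_succ_self k)]

@[simp] theorem evalAt_add (p q : MvPolynomial (Fin 2) ℝ) (x : Plane) :
    evalAt (p + q) x = evalAt p x + evalAt q x := by simp [evalAt]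

@[simp] theorem evalAt_sub (p q : MvPolynomial (Fin 2) ℝ) (x : Plane) :
    evalAt (p - q) x = evalAt p x - evalAt q x := by simp [evalAt]

@[simp] theorem evalAt_mul (p q : MvPolynomial (Fin 2) ℝ) (x : Plane) :
    evalAt (p * q) x = evalAt p x * evalAt q x := by simp [evalAt]

@[simp] theorem evalAt_pow (p : MvPolynomial (Fin 2) ℝ) (n : ℕ) (x : Plane) :
    evalAt (p ^ n) x = evalAt p x ^ n := by simp [evalAt]

@[simp] theorem evalAt_zero (x : Plane) : evalAt 0 x = 0 := by simp [evalAt]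

@[simp] theorem evalAt_smul (c : ℝ) (p : MvPolynomial (Fin 2) ℝ) (x : Plane) :
    evalAt (c • p) x = c * evalAt p x := by simp [evalAt]

@[simp] theorem evalAt_C (c : ℝ) (x : Plane) : evalAt (C c) x = c := by simp [evalAt]

@[simp] theorem evalAt_X (i : Fin 2) (x : Plane) : evalAt (X i) x = x i := by simp [evalAt]

theorem evalAt_sum {ι : Type*} (s : Finset ι) (p : ι → MvPolynomial (Fin 2) ℝ) (x : Plane) :
    evalAt (∑ i ∈ s, p i) x = ∑ i ∈ s, evalAt (p i) x := by simp [evalAt]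

theorem contDiff_evalAt (p : MvPolynomial (Fin 2) ℝ) {n : WithTop ℕ∞} :
    ContDiff ℝ n (evalAt p) := by
  induction p using MvPolynomial.induction_on with
  | C a => exact (funext (evalAt_C a) : evalAt (C a) = fun _ => a) ▸ contDiff_const
  | add p q hp hq =>
    exact (funext (evalAt_add p q) : evalAt (p + q) = fun x => _) ▸ hp.add hq
  | mul_X p i hp =>
    have : ContDiff ℝ n fun x : Plane => x i := by fun_prop
    have h : evalAt (p * X i) = fun x => evalAt p x * x i := by ext x; simp
    exact h ▸ hp.mul this

theorem continuous_evalAt (p : MvPolynomial (Fin 2) ℝ) : Continuous (evalAt p) :=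
  (contDiff_evalAt p (n := 0)).continuous

theorem eval_restrictLine (a u : Plane) (p : MvPolynomial (Fin 2) ℝ) (t : ℝ) :
    (restrictLine a u p).eval t = evalAt p (a + t • u) := by
  induction p using MvPolynomial.induction_on with
  | C c => simp [restrictLine]
  | add p q hp hq => simp [restrictLine, ← hp, ← hq]
  | mul_X p i hp =>
    rw [restrictLine, map_mul, Polynomial.eval_mul, evalAt_mul, ← hp]
    rw [restrictLine, aeval_X]
    simp only [Polynomial.eval_add, Polynomial.eval_C, Polynomial.eval_mul, Polynomial.eval_X,
      evalAt_X, PiLp.add_apply, PiLp.smul_apply, smul_eq_mul]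

/-- A polynomial vanishing near a point is zero. -/
theorem eq_zero_of_eventually {p : MvPolynomial (Fin 2) ℝ} {z : Plane}
    (h : ∀ᶠ y in 𝓝 z, evalAt p y = 0) : p = 0 := by
  have key : ∀ x : Plane, evalAt p x = 0 := by
    intro x
    set P : Polynomial ℝ := restrictLine z (x - z) p
    have hP : ∀ t : ℝ, P.eval t = evalAt p (z + t • (x - z)) := eval_restrictLine _ _ _
    have hev : ∀ᶠ t in 𝓝 (0 : ℝ), P.eval t = 0 := by
      have hc : Filter.Tendsto (fun t : ℝ => z + t • (x - z)) (𝓝 0) (𝓝 z) := by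
        have : Continuous fun t : ℝ => z + t • (x - z) := by fun_prop
        simpa using this.tendsto 0
      filter_upwards [hc.eventually h] with t ht
      rw [hP, ht]
    have hz : P = 0 := by
      apply Polynomial.eq_zero_of_infinite_isRoot
      exact infinite_of_mem_nhds 0 hev
    have := hP 1
    rw [hz] at this
    simpa using this.symm
  apply MvPolynomial.funext
  intro x
  simpa [evalAt] using key (WithLp.toLp 2 x)

theorem eq_of_eventuallyEq {p q : MvPolynomial (Fin 2) ℝ} {z : Plane}
    (h : evalAt p =ᶠ[𝓝 z] evalAt q) : p = q := by
  rw [← sub_eq_zero]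
  apply eq_zero_of_eventually (z := z)
  filter_upwards [h] with y hy
  simp [hy]

theorem eq_of_eqOn_open {p q : MvPolynomial (Fin 2) ℝ} {U : Set Plane} (hU : IsOpen U)
    (hne : U.Nonempty) (h : ∀ y ∈ U, evalAt p y = evalAt q y) : p = q := by
  obtain ⟨z, hz⟩ := hne
  exact eq_of_eventuallyEq (z := z) (Filter.eventually_of_mem (hU.mem_nhds hz) h)

/-! ### Functions that are polynomial near a point -/

/-- The functions that agree near `z` with a polynomial of degree at most `d`. -/
def polyGerm (d : ℕ) (z : Plane) : Submodule ℝ (Plane → ℝ) where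
  carrier := {f | ∃ p ∈ polyLT (d + 1), f =ᶠ[𝓝 z] evalAt p}
  zero_mem' := ⟨0, Submodule.zero_mem _, Filter.Eventually.of_forall fun _ => by simp⟩
  add_mem' := by
    rintro f g ⟨p, hp, hp'⟩ ⟨q, hq, hq'⟩
    refine ⟨p + q, Submodule.add_mem _ hp hq, ?_⟩
    filter_upwards [hp', hq'] with y h1 h2
    simp [h1, h2]
  smul_mem' := by
    rintro c f ⟨p, hp, hp'⟩
    refine ⟨c • p, Submodule.smul_mem _ c hp, ?_⟩
    filter_upwards [hp'] with y h1
    simp [h1]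

theorem polyGerm_congr {d : ℕ} {z : Plane} {f g : Plane → ℝ} (h : f =ᶠ[𝓝 z] g) :
    f ∈ polyGerm d z ↔ g ∈ polyGerm d z :=
  ⟨fun ⟨p, hp, h'⟩ => ⟨p, hp, h.symm.trans h'⟩, fun ⟨p, hp, h'⟩ => ⟨p, hp, h.trans h'⟩⟩

theorem eventually_mem_polyGerm {d : ℕ} {z : Plane} {f : Plane → ℝ} (h : f ∈ polyGerm d z) :
    ∀ᶠ y in 𝓝 z, f ∈ polyGerm d y := by
  obtain ⟨p, hp, h⟩ := h
  filter_upwards [h.eventually_nhds] with y hy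
  exact ⟨p, hp, hy⟩

/-- A function that is polynomial near every point of a preconnected open set is polynomial on
this set. -/
theorem exists_poly_of_isPreconnected {d : ℕ} {f : Plane → ℝ} {U : Set Plane} (hU : IsOpen U)
    (hc : IsPreconnected U) (h : ∀ z ∈ U, f ∈ polyGerm d z) :
    ∃ p ∈ polyLT (d + 1), ∀ y ∈ U, f y = evalAt p y := by
  rcases U.eq_empty_or_nonempty with rfl | ⟨z₀, hz₀⟩
  · exact ⟨0, Submodule.zero_mem _, by simp⟩
  choose! p hp hpf using h
  have hloc : ∀ z ∈ U, ∀ᶠ y in 𝓝[U] z, p y = p z := by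
    intro z hz
    rw [hU.nhdsWithin_eq hz]
    filter_upwards [(hpf z hz).eventually_nhds, hU.mem_nhds hz] with y hy hyU
    exact eq_of_eventuallyEq ((hpf y hyU).symm.trans hy)
  have hconst : ∀ y ∈ U, p y = p z₀ := by
    intro y hy
    refine hc.induction₂' (fun a b => p a = p b) ?_ ?_ hy hz₀
    · intro x hx
      filter_upwards [hloc x hx] with y hy
      exact ⟨hy.symm, hy⟩
    · intro a b c _ _ _ hab hbc
      exact hab.trans hbc
  refine ⟨p z₀, hp _ hz₀, fun y hy => ?_⟩
  rw [← hconst y hy]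
  exact (hpf y hy).eq_of_nhds

/-! ### Gluing on simply connected domains -/

/-- On a simply connected space, a Čech 1-cocycle with constant coefficients is a coboundary. -/
theorem exists_coboundary {X V : Type*} [TopologicalSpace X] [SimplyConnectedSpace X]
    [LocallyPathConnectedSpace X] [AddCommGroup V] (U : X → Set X) (hU : ∀ x, IsOpen (U x))
    (hx : ∀ x, x ∈ U x) (g : X → X → V)
    (hg : ∀ x y z, ∀ t ∈ U x ∩ U y ∩ U z, g x y + g y z = g x z) :
    ∃ c : X → V, ∀ x, ∀ᶠ y in 𝓝 x, c y + g y x = c x := by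
  let _ : TopologicalSpace V := ⊥
  have : DiscreteTopology V := ⟨rfl⟩
  have hself : ∀ x, g x x = 0 := fun x => by
    simpa using hg x x x x ⟨⟨hx x, hx x⟩, hx x⟩
  -- The cocycle glues the sets `U x × V`, with V discrete, to a bundle that is a covering of X. A
  -- global section of it is the desired coboundary, read in the chart belonging to each point.
  let Z : FiberBundleCore X X V :=
    { baseSet := U
      isOpen_baseSet := hU
      indexAt := id
      mem_baseSet_at := hx
      coordChange := fun i j _ v => v + g i j
      coordChange_self := fun i x _ v => by simp [hself]
      continuousOn_coordChange := fun i j =>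
        ((continuous_of_discreteTopology (f := fun v : V => v + g i j)).comp
          continuous_snd).continuousOn
      coordChange_comp := fun i j k x hx v => by
        rw [add_assoc, hg i j k x hx] }
  have hcov : IsCoveringMap Z.proj := by
    have : ∀ x, DiscreteTopology (Z.Fiber x) := fun _ => ⟨rfl⟩
    exact FiberBundle.isCoveringMap
  obtain ⟨a₀⟩ : Nonempty X := inferInstance
  -- Simple connectivity enters here: the identity of X lifts to the covering, and the lift is a
  -- section.
  obtain ⟨F, ⟨-, hF⟩, -⟩ := hcov.existsUnique_continuousMap_lifts (ContinuousMap.id X) a₀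
    (⟨a₀, (0 : V)⟩ : Z.TotalSpace) rfl
  have hF' : ∀ y, (F y).1 = y := fun y => congrFun hF y
  let c : X → V := fun y => (F y).2
  have e1 : ∀ x y, (Z.localTriv x (F y)).2 = c y + g y x := fun x y => by
    rw [← congrArg (g · x) (hF' y)]
    rfl
  refine ⟨c, fun x => ?_⟩
  have hcont : ContinuousAt (fun y => (Z.localTriv x (F y)).2) x := by
    refine continuous_snd.continuousAt.comp (ContinuousAt.comp ?_ F.continuous.continuousAt)
    refine (Z.localTriv x).continuousAt ?_
    rw [(Z.localTriv x).mem_source]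
    change (F x).1 ∈ U x
    rw [hF' x]
    exact hx x
  have hev : ∀ᶠ y in 𝓝 x, (Z.localTriv x (F y)).2 ∈ ({(Z.localTriv x (F x)).2} : Set V) :=
    hcont.eventually_mem (IsOpen.mem_nhds (isOpen_discrete _) rfl)
  filter_upwards [hev] with y hy
  rw [Set.mem_singleton_iff, e1, e1, hself, add_zero] at hy
  exact hy

/-- Local functions on a simply connected domain that agree up to polynomials glue to a global
function, up to polynomials. -/
theorem exists_glued {d : ℕ} {Ω : Set Plane} (hΩ : IsOpen Ω) (hs : IsSimplyConnected Ω)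
    (f : Plane → Plane → ℝ)
    (hf : ∀ x ∈ Ω, ∀ᶠ z in 𝓝 x, f x - f z ∈ polyGerm d z) :
    ∃ s : Plane → ℝ, (∀ x, x ∉ Ω → s x = 0) ∧ ∀ x ∈ Ω, s - f x ∈ polyGerm d x := by
  have := hs.simplyConnectedSpace
  have : LocallyPathConnectedSpace Ω := hΩ.locallyPathConnectedSpace
  have hr : ∀ x : Ω, ∃ r > 0, Metric.ball (x : Plane) r ⊆ Ω ∧
      ∀ z ∈ Metric.ball (x : Plane) r, f x - f z ∈ polyGerm d z := by
    intro x
    obtain ⟨r, hr, h⟩ := Metric.eventually_nhds_iff_ball.1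
      ((hf x x.2).and (hΩ.mem_nhds x.2))
    exact ⟨r, hr, fun z hz => (h z hz).2, fun z hz => (h z hz).1⟩
  choose r hr hrΩ hrf using hr
  let B : Ω → Set Plane := fun x => Metric.ball x (r x)
  have hp : ∀ x y : Ω, ∃ p ∈ polyLT (d + 1), ∀ t ∈ B x ∩ B y, f x t - f y t = evalAt p t := by
    intro x y
    have hopen : IsOpen (B x ∩ B y) := Metric.isOpen_ball.inter Metric.isOpen_ball
    refine exists_poly_of_isPreconnected (f := f x - f y) hopen
      ((convex_ball _ _).inter (convex_ball _ _)).isPreconnected fun z hz => ?_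
    have := Submodule.sub_mem _ (hrf x z hz.1) (hrf y z hz.2)
    simpa using this
  choose g hgd hg using hp
  -- The transition polynomials satisfy the cocycle identity on triple intersections, hence as
  -- polynomials. They are constant elements of `polyLT (d + 1)`, so the coefficients are locally
  -- constant.
  obtain ⟨c, hc⟩ := exists_coboundary (X := Ω) (V := polyLT (d + 1))
    (fun x => Subtype.val ⁻¹' B x)
    (fun x => Metric.isOpen_ball.preimage continuous_subtype_val)
    (fun x => Metric.mem_ball_self (hr x)) (fun x y => ⟨g x y, hgd x y⟩) (by
      rintro x y z t ⟨⟨htx, hty⟩, htz⟩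
      apply Subtype.ext
      change g x y + g y z = g x z
      refine eq_of_eqOn_open (U := B x ∩ B y ∩ B z)
        ((Metric.isOpen_ball.inter Metric.isOpen_ball).inter Metric.isOpen_ball)
        ⟨t, ⟨htx, hty⟩, htz⟩ ?_
      rintro u ⟨⟨hux, huy⟩, huz⟩
      rw [evalAt_add, ← hg x y u ⟨hux, huy⟩, ← hg y z u ⟨huy, huz⟩, ← hg x z u ⟨hux, huz⟩]
      ring)
  classical
  -- Each local function is corrected by its own polynomial and evaluated at its own centre. Near x,
  -- the sum f y y + c_y(y) equals f x y + g_yx(y) + c_y(y) = f x y + c_x(y).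
  refine ⟨fun y => if hy : y ∈ Ω then f y y + evalAt (c ⟨y, hy⟩).1 y else 0,
    fun x hx => dif_neg hx, fun x hx => ⟨(c ⟨x, hx⟩).1, (c ⟨x, hx⟩).2, ?_⟩⟩
  have h1 := hc ⟨x, hx⟩
  rw [nhds_subtype_eq_comap, Filter.eventually_comap] at h1
  filter_upwards [h1, hΩ.mem_nhds hx, Metric.ball_mem_nhds x (hr ⟨x, hx⟩)] with y hy hyΩ hyB
  have h2 := hy ⟨y, hyΩ⟩ rfl
  have h3 := hg ⟨y, hyΩ⟩ ⟨x, hx⟩ y ⟨Metric.mem_ball_self (hr _), hyB⟩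
  rw [← h2]
  simp only [Pi.sub_apply, dif_pos hyΩ, Submodule.coe_add, evalAt_add]
  simp only at h3
  linarith

/-! ### Affine coordinates -/

/-- A polynomial in the coordinates `(t, u)` of `a + t • v + u • n`, as a polynomial in `u` over
the polynomials in `t`. -/
def affineHom (a v n : Plane) : MvPolynomial (Fin 2) ℝ →ₐ[ℝ] Polynomial (Polynomial ℝ) :=
  aeval fun i => Polynomial.C (Polynomial.C (a i) + Polynomial.X * Polynomial.C (v i)) +
    Polynomial.X * Polynomial.C (Polynomial.C (n i))

theorem eval_affineHom (a v n : Plane) (p : MvPolynomial (Fin 2) ℝ) (t u : ℝ) :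
    ((affineHom a v n p).map (Polynomial.evalRingHom t)).eval u =
      evalAt p (a + t • v + u • n) := by
  induction p using MvPolynomial.induction_on with
  | C c => simp [affineHom, Polynomial.algebraMap_eq]
  | add p q hp hq => rw [map_add, Polynomial.map_add, Polynomial.eval_add, hp, hq, evalAt_add]
  | mul_X p i hp =>
    rw [map_mul, Polynomial.map_mul, Polynomial.eval_mul, hp, evalAt_mul]
    congr 1
    rw [affineHom, aeval_X]
    simp only [Polynomial.map_add, Polynomial.map_mul, Polynomial.map_X, Polynomial.map_C,
      Polynomial.coe_evalRingHom, Polynomial.eval_add, Polynomial.eval_C, Polynomial.eval_mul,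
      Polynomial.eval_X, evalAt_X, PiLp.add_apply, PiLp.smul_apply, smul_eq_mul]

theorem affineHom_coeff_zero (a v n : Plane) (p : MvPolynomial (Fin 2) ℝ) :
    (affineHom a v n p).coeff 0 = restrictLine a v p := by
  induction p using MvPolynomial.induction_on with
  | C c => simp [affineHom, restrictLine, Polynomial.algebraMap_eq]
  | add p q hp hq =>
    rw [map_add, Polynomial.coeff_add, hp, hq]
    simp only [restrictLine, map_add]
  | mul_X p i hp =>
    rw [map_mul, Polynomial.mul_coeff_zero, hp, restrictLine, restrictLine, map_mul, affineHom,
      aeval_X, aeval_X]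
    simp

theorem dirDeriv_add (n : Plane) (p q : MvPolynomial (Fin 2) ℝ) :
    dirDeriv n (p + q) = dirDeriv n p + dirDeriv n q := by
  simp only [dirDeriv, map_add, mul_add, Finset.sum_add_distrib]

theorem dirDeriv_smul (n : Plane) (c : ℝ) (p : MvPolynomial (Fin 2) ℝ) :
    dirDeriv n (c • p) = c • dirDeriv n p := by
  simp only [dirDeriv, Finset.smul_sum]
  exact Finset.sum_congr rfl fun i _ => by rw [(pderiv i).map_smul, mul_smul_comm]

theorem dirDeriv_mul (n : Plane) (p q : MvPolynomial (Fin 2) ℝ) :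
    dirDeriv n (p * q) = p * dirDeriv n q + dirDeriv n p * q := by
  simp only [dirDeriv, Derivation.leibniz, smul_eq_mul, Fin.sum_univ_two]
  ring

theorem dirDeriv_X (n : Plane) (i : Fin 2) : dirDeriv n (X i) = C (n i) := by
  simp only [dirDeriv, Fin.sum_univ_two, pderiv_X]
  fin_cases i <;> simp

theorem affineHom_dirDeriv (a v n : Plane) (p : MvPolynomial (Fin 2) ℝ) :
    affineHom a v n (dirDeriv n p) = Polynomial.derivative (affineHom a v n p) := by
  have hC : ∀ c : ℝ, affineHom a v n (C c) = Polynomial.C (Polynomial.C c) := fun c => by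
    simp [affineHom, Polynomial.algebraMap_eq]
  induction p using MvPolynomial.induction_on with
  | C c => simp [dirDeriv, hC]
  | add p q hp hq => rw [map_add, Polynomial.derivative_add, ← hp, ← hq, ← map_add, dirDeriv_add]
  | mul_X p i hp =>
    have hX : Polynomial.derivative (affineHom a v n (X i)) = affineHom a v n (C (n i)) := by
      rw [hC, affineHom, aeval_X]
      simp
    rw [map_mul, Polynomial.derivative_mul, ← hp, hX, dirDeriv_mul, dirDeriv_X, map_add, map_mul,
      map_mul, add_comm]

theorem restrictLine_dirDeriv_iterate (a v n : Plane) (p : MvPolynomial (Fin 2) ℝ) (r : ℕ) :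
    restrictLine a v ((dirDeriv n)^[r] p) = r.factorial • (affineHom a v n p).coeff r := by
  have h : affineHom a v n ((dirDeriv n)^[r] p) =
      Polynomial.derivative^[r] (affineHom a v n p) := by
    induction r with
    | zero => rfl
    | succ r ih => rw [Function.iterate_succ_apply', affineHom_dirDeriv, ih,
        Function.iterate_succ_apply']
  rw [← affineHom_coeff_zero a v n, h, Polynomial.coeff_iterate_derivative]
  simp [Nat.descFactorial_self]

/-- The abscissa in the sheared coordinates `(y₀ + m y₁, y₁)`. -/
def abscissa (m : ℝ) (y : Plane) : ℝ := y 0 + m * y 1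

/-- The polynomial of degree one vanishing on the line `y₁ = a (y₀ + m y₁) + b`. -/
def linePoly (m a b : ℝ) : MvPolynomial (Fin 2) ℝ := X 1 - C a * (X 0 + C m * X 1) - C b

theorem evalAt_linePoly (m a b : ℝ) (y : Plane) :
    evalAt (linePoly m a b) y = y 1 - a * abscissa m y - b := by
  simp [linePoly, abscissa]

theorem continuous_abscissa (m : ℝ) : Continuous (abscissa m) := by
  unfold abscissa; fun_prop

/-- The point with sheared coordinates `(t, h)`. -/
def shearPoint (m t h : ℝ) : Plane := !₂[t - m * h, h]

@[simp] theorem abscissa_shearPoint (m t h : ℝ) : abscissa m (shearPoint m t h) = t := by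
  simp [abscissa, shearPoint]

@[simp] theorem shearPoint_one (m t h : ℝ) : shearPoint m t h 1 = h := by
  simp [shearPoint]

theorem shearPoint_eta (m : ℝ) (y : Plane) : shearPoint m (abscissa m y) (y 1) = y := by
  ext i; fin_cases i <;> simp [shearPoint, abscissa]

theorem continuous_shearPoint (m : ℝ) : Continuous fun q : ℝ × ℝ => shearPoint m q.1 q.2 := by
  unfold shearPoint; fun_prop

theorem shearPoint_decomp (m a b t u : ℝ) : shearPoint m t (a * t + b + u) =
    shearPoint m 0 b + t • shearPoint m 1 a + u • shearPoint m 0 1 := by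
  ext i; fin_cases i <;> simp [shearPoint] <;> ring

theorem linePoly_ne_zero (m a b : ℝ) : linePoly m a b ≠ 0 := by
  intro h
  have := evalAt_linePoly m a b (shearPoint m 0 (b + 1))
  rw [h] at this
  simp at this

theorem totalDegree_linePoly_le (m a b : ℝ) : (linePoly m a b).totalDegree ≤ 1 := by
  unfold linePoly
  refine (totalDegree_sub_C_le _ _).trans ((totalDegree_sub _ _).trans (max_le (by simp) ?_))
  refine (totalDegree_mul _ _).trans ?_
  rw [totalDegree_C, zero_add]
  refine (totalDegree_add _ _).trans (max_le (by simp) ?_)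
  refine (totalDegree_mul _ _).trans (by simp)

theorem totalDegree_linePoly (m a b : ℝ) : (linePoly m a b).totalDegree = 1 := by
  refine le_antisymm (totalDegree_linePoly_le m a b) ?_
  by_contra! h
  rw [Nat.lt_one_iff, totalDegree_eq_zero_iff_eq_C] at h
  have h1 := evalAt_linePoly m a b (shearPoint m 0 1)
  have h2 := evalAt_linePoly m a b (shearPoint m 0 0)
  rw [h] at h1 h2
  simp at h1 h2
  linarith

theorem linePoly_pow_mul_mem {d μ : ℕ} (hμ : μ ≤ d) (m a b : ℝ) {q : MvPolynomial (Fin 2) ℝ} :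
    linePoly m a b ^ (μ + 1) * q ∈ polyLT (d + 1) ↔ q ∈ polyLT (d - μ) := by
  by_cases hq : q = 0
  · simp [hq]
  · rw [mem_polyLT, mem_polyLT, totalDegree_mul_of_isDomain (pow_ne_zero _ (linePoly_ne_zero _ _ _))
      hq]
    have : (linePoly m a b ^ (μ + 1)).totalDegree = μ + 1 := by
      induction μ with
      | zero => simp [totalDegree_linePoly]
      | succ μ ih =>
        rw [pow_succ, totalDegree_mul_of_isDomain (pow_ne_zero _ (linePoly_ne_zero _ _ _))
          (linePoly_ne_zero _ _ _), ih (by omega), totalDegree_linePoly]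
    rw [this]
    simp [hq, linePoly_ne_zero]
    omega

/-- The substitution `affineHom` has the left inverse `back`, which sends the abscissa variable to
X₀ + m X₁ and the transversal variable to the linear form itself. Divisibility by a power of the
latter variable is carried over. -/
theorem linePoly_pow_dvd {m a b : ℝ} {k : ℕ} {p : MvPolynomial (Fin 2) ℝ}
    (h : Polynomial.X ^ k ∣
      affineHom (shearPoint m 0 b) (shearPoint m 1 a) (shearPoint m 0 1) p) :
    linePoly m a b ^ k ∣ p := by
  let back : Polynomial (Polynomial ℝ) →+* MvPolynomial (Fin 2) ℝ :=
    Polynomial.eval₂RingHom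
      (Polynomial.aeval (X 0 + C m * X 1 : MvPolynomial (Fin 2) ℝ)).toRingHom (linePoly m a b)
  have hback : ∀ p, back (affineHom (shearPoint m 0 b) (shearPoint m 1 a) (shearPoint m 0 1) p)
      = p := by
    intro p
    induction p using MvPolynomial.induction_on with
    | C c => simp [back, affineHom, Polynomial.algebraMap_eq]
    | add p q hp hq => rw [map_add, map_add, hp, hq]
    | mul_X p i hp =>
      rw [map_mul, map_mul, hp]
      congr 1
      rw [affineHom, aeval_X]
      fin_cases i <;>
        simp [back, shearPoint, linePoly] <;> ring
  have := map_dvd back h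
  rwa [hback, map_pow, show back Polynomial.X = linePoly m a b by simp [back]] at this

/-! ### Smoothness across a line -/

/-- On the left of 0 the function vanishes, so its value and derivative at 0 are those of the zero
function. The derivative is again a polynomial cut off at 0, one order less smooth, which allows
induction on μ. -/
theorem coeff_eq_zero_of_contDiffAt {μ : ℕ} {P : Polynomial ℝ}
    (h : ContDiffAt ℝ μ (fun u : ℝ => if 0 < u then P.eval u else 0) 0) :
    ∀ r ≤ μ, P.coeff r = 0 := by
  have h0 : ∀ P : Polynomial ℝ, ContinuousAt (fun u : ℝ => if 0 < u then P.eval u else 0) 0 →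
      P.coeff 0 = 0 := by
    intro P hP
    have h1 : Filter.Tendsto (fun u : ℝ => if 0 < u then P.eval u else 0) (𝓝[>] 0) (𝓝 0) := by
      have := hP.tendsto.mono_left (nhdsWithin_le_nhds (s := Set.Ioi 0))
      simpa using this
    have h2 : Filter.Tendsto (fun u : ℝ => if 0 < u then P.eval u else 0) (𝓝[>] 0)
        (𝓝 (P.eval 0)) := by
      refine (P.continuous.continuousAt.tendsto.mono_left nhdsWithin_le_nhds).congr' ?_
      filter_upwards [self_mem_nhdsWithin] with u hu
      exact (if_pos hu).symm
    rw [Polynomial.coeff_zero_eq_eval_zero]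
    exact tendsto_nhds_unique h2 h1
  induction μ generalizing P with
  | zero =>
    intro r hr
    rw [Nat.le_zero.1 hr]
    exact h0 P h.continuousAt
  | succ μ ih =>
    rintro (_ | r) hr
    · exact h0 P h.continuousAt
    · have hd : ContDiffAt ℝ μ (deriv fun u : ℝ => if 0 < u then P.eval u else 0) 0 :=
        h.derivWithin (by simp)
      have hdiff : DifferentiableAt ℝ (fun u : ℝ => if 0 < u then P.eval u else 0) 0 :=
        h.differentiableAt (by simp)
      have hd0 : deriv (fun u : ℝ => if 0 < u then P.eval u else 0) 0 = 0 := by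
        have h1 : HasDerivWithinAt (fun u : ℝ => if 0 < u then P.eval u else 0) 0
            (Set.Iic 0) 0 :=
          (hasDerivWithinAt_const (0 : ℝ) (Set.Iic 0) (0 : ℝ)).congr_of_mem
            (fun u hu => if_neg (not_lt.2 (Set.mem_Iic.1 hu))) Set.self_mem_Iic
        have h2 := uniqueDiffOn_Iic (0 : ℝ) 0 Set.self_mem_Iic
        rw [← hdiff.derivWithin h2, h1.derivWithin h2]
      have hd' : ContDiffAt ℝ μ (fun u : ℝ => if 0 < u then P.derivative.eval u else 0) 0 := by
        refine hd.congr_of_eventuallyEq (Filter.Eventually.of_forall fun u => ?_)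
        rcases lt_trichotomy u 0 with hu | rfl | hu
        · simp only [if_neg hu.not_gt]
          refine ((hasDerivAt_const u (0 : ℝ)).congr_of_eventuallyEq ?_).deriv.symm
          filter_upwards [Iio_mem_nhds hu] with y hy
          exact if_neg (not_lt.2 (le_of_lt hy))
        · simp only [hd0, lt_irrefl, if_false]
        · simp only [if_pos hu]
          refine ((P.hasDerivAt u).congr_of_eventuallyEq ?_).deriv.symm
          filter_upwards [Ioi_mem_nhds hu] with y hy
          exact if_pos hy
      have := ih hd' r (by omega)
      rw [Polynomial.coeff_derivative] at this
      have h3 : ((r : ℝ) + 1) ≠ 0 := by positivity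
      exact (mul_eq_zero.1 this).resolve_right h3

/-- If a polynomial, cut off along a line, is `C^μ` near a point of the line, then it is divisible
by the `(μ + 1)`-st power of the linear form. -/
theorem linePoly_pow_dvd_of_contDiffAt {μ : ℕ} {m a b : ℝ} {p : MvPolynomial (Fin 2) ℝ}
    {z : Plane} (hz : evalAt (linePoly m a b) z = 0)
    (h : ContDiffAt ℝ μ (fun y => if 0 < evalAt (linePoly m a b) y then evalAt p y else 0) z) :
    linePoly m a b ^ (μ + 1) ∣ p := by
  apply linePoly_pow_dvd
  rw [Polynomial.X_pow_dvd_iff]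
  intro r hr
  set P := affineHom (shearPoint m 0 b) (shearPoint m 1 a) (shearPoint m 0 1) p with hP
  -- Smoothness of finite order at z persists nearby, so the one-variable lemma applies on the
  -- transversal through each point of the line close to z. Each coefficient of order at most μ thus
  -- has infinitely many roots t.
  have hev : ∀ᶠ t in 𝓝 (abscissa m z), (P.coeff r).eval t = 0 := by
    have hc : Filter.Tendsto (fun t => shearPoint m t (a * t + b)) (𝓝 (abscissa m z)) (𝓝 z) := by
      have h1 : Continuous fun t => shearPoint m t (a * t + b) :=
        (continuous_shearPoint m).comp (by fun_prop : Continuous fun t : ℝ => (t, a * t + b))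
      have h2 : shearPoint m (abscissa m z) (a * abscissa m z + b) = z := by
        rw [evalAt_linePoly] at hz
        rw [show a * abscissa m z + b = z 1 by linarith, shearPoint_eta]
      have := h1.tendsto (abscissa m z)
      rwa [h2] at this
    filter_upwards [hc.eventually (h.eventually (by simp))] with t ht
    have h3 : ContDiffAt ℝ μ (fun u : ℝ => shearPoint m t (a * t + b + u)) 0 := by
      simp only [shearPoint_decomp]
      fun_prop
    have h4 := ContDiffAt.comp (0 : ℝ) (by simpa using ht) h3
    have h5 := coeff_eq_zero_of_contDiffAt (P := P.map (Polynomial.evalRingHom t)) (μ := μ) (by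
      refine h4.congr_of_eventuallyEq (Filter.Eventually.of_forall fun u => ?_)
      simp only [Function.comp, evalAt_linePoly, abscissa_shearPoint, shearPoint_one]
      rw [hP, eval_affineHom, ← shearPoint_decomp, show a * t + b + u - a * t - b = u by ring])
      r (by omega)
    simpa using h5
  apply Polynomial.eq_zero_of_infinite_isRoot
  exact infinite_of_mem_nhds (abscissa m z) hev

/-- The derivative of t₊^(n+2) is (n + 2) t₊^(n+1). At 0 this holds because the difference quotient
is t₊^(n+1), which is continuous and tends to 0. -/
theorem contDiff_truncPow (μ : ℕ) : ContDiff ℝ μ fun t : ℝ => if 0 < t then t ^ (μ + 1) else 0 := by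
  have h0 : ∀ n : ℕ, Continuous fun t : ℝ => if 0 < t then t ^ (n + 1) else 0 := fun n => by
    have : (fun t : ℝ => if 0 < t then t ^ (n + 1) else 0) = fun t => max t 0 ^ (n + 1) := by
      ext t
      split_ifs with h
      · rw [max_eq_left h.le]
      · simp [max_eq_right (not_lt.1 h)]
    rw [this]
    fun_prop
  have hd : ∀ n : ℕ, ∀ u : ℝ, HasDerivAt (fun t : ℝ => if 0 < t then t ^ (n + 2) else 0)
      ((n + 2) * if 0 < u then u ^ (n + 1) else 0) u := by
    intro n u
    rcases lt_trichotomy u 0 with hu | rfl | hu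
    · simp only [if_neg hu.not_gt, mul_zero]
      refine (hasDerivAt_const u (0 : ℝ)).congr_of_eventuallyEq ?_
      filter_upwards [Iio_mem_nhds hu] with y hy
      exact if_neg (not_lt.2 (le_of_lt hy))
    · simp only [lt_irrefl, if_false, mul_zero]
      rw [hasDerivAt_iff_tendsto_slope_zero]
      have := (h0 n).tendsto 0
      simp only [lt_irrefl, if_false] at this
      refine (this.mono_left nhdsWithin_le_nhds).congr' ?_
      filter_upwards [self_mem_nhdsWithin] with t ht
      have ht : t ≠ 0 := ht
      simp only [zero_add, lt_irrefl, if_false, sub_zero, smul_eq_mul]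
      split_ifs
      · field_simp
        ring
      · simp
    · simp only [if_pos hu]
      have := hasDerivAt_pow (n + 2) u
      push_cast at this
      refine this.congr_of_eventuallyEq ?_
      filter_upwards [Ioi_mem_nhds hu] with y hy
      exact if_pos hy
  induction μ with
  | zero => exact contDiff_zero.2 (h0 0)
  | succ μ ih =>
    push_cast
    rw [contDiff_succ_iff_deriv]
    refine ⟨fun u => (hd μ u).differentiableAt, by simp, ?_⟩
    have : deriv (fun t : ℝ => if 0 < t then t ^ (μ + 1 + 1) else 0) =
        fun u => ((μ : ℝ) + 2) * if 0 < u then u ^ (μ + 1) else 0 :=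
      funext fun u => (hd μ u).deriv
    rw [this]
    exact contDiff_const.mul ih

/-! ### Blow-up coordinates and syzygies at a point -/

/-- A polynomial in the coordinates `(t, s)` of `A + t • (1, s)` (in sheared coordinates), as a
polynomial in `t` over the polynomials in `s`. -/
def blowupHom (m : ℝ) (A : Plane) : MvPolynomial (Fin 2) ℝ →ₐ[ℝ] Polynomial (Polynomial ℝ) :=
  aeval fun i => Polynomial.C (Polynomial.C (A i)) +
    Polynomial.X * Polynomial.C (![1 - Polynomial.C m * Polynomial.X, Polynomial.X] i)

theorem eval_blowupHom (m : ℝ) (A : Plane) (p : MvPolynomial (Fin 2) ℝ) (t s : ℝ) :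
    ((blowupHom m A p).map (Polynomial.evalRingHom s)).eval t =
      evalAt p (A + t • shearPoint m 1 s) := by
  induction p using MvPolynomial.induction_on with
  | C c => simp [blowupHom, Polynomial.algebraMap_eq]
  | add p q hp hq => rw [map_add, Polynomial.map_add, Polynomial.eval_add, hp, hq, evalAt_add]
  | mul_X p i hp =>
    rw [map_mul, Polynomial.map_mul, Polynomial.eval_mul, hp, evalAt_mul]
    congr 1
    rw [blowupHom, aeval_X]
    fin_cases i <;> simp [shearPoint]
    exact mul_comm _ _

/-- The coefficient of t^j is the homogeneous part of degree j at A, dehomogenized by setting the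
abscissa to 1. Each factor t therefore brings at most one power of s. -/
theorem natDegree_coeff_blowupHom_le (m : ℝ) (A : Plane) (p : MvPolynomial (Fin 2) ℝ) (j : ℕ) :
    ((blowupHom m A p).coeff j).natDegree ≤ j := by
  induction p using MvPolynomial.induction_on generalizing j with
  | C c =>
    simp only [blowupHom, algHom_C, Polynomial.algebraMap_eq, Polynomial.algebraMap_apply,
      Polynomial.coeff_C]
    split_ifs <;> simp
  | add p q hp hq =>
    rw [map_add, Polynomial.coeff_add]
    exact Polynomial.natDegree_add_le_of_degree_le (hp j) (hq j)
  | mul_X p i hp =>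
    rw [map_mul]
    conv => enter [1, 1, 1, 2]; rw [blowupHom, aeval_X]
    rw [mul_add, Polynomial.coeff_add, Polynomial.coeff_mul_C, ← mul_assoc,
      Polynomial.coeff_mul_C]
    refine Polynomial.natDegree_add_le_of_degree_le ?_ ?_
    · exact (Polynomial.natDegree_mul_C_le _ _).trans (hp j)
    · rcases j with _ | j
      · simp
      · rw [Polynomial.coeff_mul_X]
        refine Polynomial.natDegree_mul_le.trans (add_le_add (hp j) ?_)
        fin_cases i
        · exact (Polynomial.natDegree_sub_le _ _).trans (max_le (by simp)
            ((Polynomial.natDegree_C_mul_le _ _).trans Polynomial.natDegree_X_le))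
        · simp

theorem coeff_blowupHom_eq_zero (m : ℝ) (A : Plane) {k j : ℕ} {p : MvPolynomial (Fin 2) ℝ}
    (hp : p ∈ polyLT k) (hj : k ≤ j) : (blowupHom m A p).coeff j = 0 := by
  have key : ∀ n : Fin 2 →₀ ℕ, (blowupHom m A (monomial n 1)).natDegree ≤ n.sum fun _ e => e := by
    intro n
    rw [blowupHom, aeval_monomial, map_one, one_mul, Finsupp.prod_fintype _ _ (by simp),
      Finsupp.sum_fintype _ _ (by simp), Fin.prod_univ_two, Fin.sum_univ_two]
    refine Polynomial.natDegree_mul_le.trans (add_le_add ?_ ?_) <;>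
    · refine Polynomial.natDegree_pow_le.trans ?_
      refine (Nat.mul_le_mul_left _ ?_).trans (mul_one _).le
      refine Polynomial.natDegree_add_le_of_degree_le (by simp) ?_
      exact (Polynomial.natDegree_mul_C_le _ _).trans Polynomial.natDegree_X_le
  have hle : polyLT k ≤ LinearMap.ker ((Polynomial.lcoeff (Polynomial ℝ) j).restrictScalars ℝ ∘ₗ
      (blowupHom m A).toLinearMap) := by
    rw [polyLT, restrictSupport_eq_span, Submodule.span_le]
    rintro _ ⟨n, hn, rfl⟩
    have hn : (n.sum fun _ e => e) < k := hn
    simp only [SetLike.mem_coe, LinearMap.mem_ker, LinearMap.coe_comp, Function.comp_apply,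
      AlgHom.toLinearMap_apply, LinearMap.coe_restrictScalars, Polynomial.lcoeff_apply]
    exact Polynomial.coeff_eq_zero_of_natDegree_lt ((key n).trans_lt (by omega))
  exact hle hp

/-- Every point off the vertical line through A has the form A + t(1, s), so a polynomial in the
kernel vanishes on a nonempty open set. -/
theorem blowupHom_injective (m : ℝ) (A : Plane) : Function.Injective (blowupHom m A) := by
  rw [injective_iff_map_eq_zero]
  intro p hp
  refine eq_zero_of_eventually (z := A + shearPoint m 1 0) ?_
  have h1 : ∀ᶠ y in 𝓝 (A + shearPoint m 1 0), abscissa m (y - A) ≠ 0 := by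
    have hc : Continuous fun y : Plane => abscissa m (y - A) :=
      (continuous_abscissa m).comp (by fun_prop)
    refine hc.continuousAt.eventually_ne ?_
    simp
  filter_upwards [h1] with y hy
  have h2 := eval_blowupHom m A p (abscissa m (y - A)) ((y - A) 1 / abscissa m (y - A))
  have h3 : A + abscissa m (y - A) • shearPoint m 1 ((y - A) 1 / abscissa m (y - A)) = y := by
    have h4 : abscissa m (y - A) • shearPoint m 1 ((y - A) 1 / abscissa m (y - A)) =
        shearPoint m (abscissa m (y - A)) ((y - A) 1) := by
      ext i; fin_cases i <;> simp [shearPoint] <;> field_simp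
    rw [h4, shearPoint_eta]
    simp
  rw [h3, hp] at h2
  simpa using h2.symm

theorem blowupHom_linePoly {m a b : ℝ} {A : Plane} (h : evalAt (linePoly m a b) A = 0) :
    blowupHom m A (linePoly m a b) =
      Polynomial.X * Polynomial.C (Polynomial.X - Polynomial.C a) := by
  rw [evalAt_linePoly, abscissa] at h
  have hb : b = A 1 - a * (A 0 + m * A 1) := by linarith
  rw [hb, linePoly]
  simp only [map_sub, map_mul, map_add, blowupHom, aeval_X]
  simp
  ring

/-- Homogeneous decomposition of polynomials of degree less than `k` around a point. -/
def homogeneousEquiv (m : ℝ) (A : Plane) (k : ℕ) :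
    polyLT k ≃ₗ[ℝ] (∀ j : Fin k, Polynomial.degreeLT ℝ ((j : ℕ) + 1)) :=
  let f : polyLT k →ₗ[ℝ] (∀ j : Fin k, Polynomial.degreeLT ℝ ((j : ℕ) + 1)) :=
    { toFun := fun p j => ⟨(blowupHom m A p).coeff j, Polynomial.mem_degreeLT.2
        ((Polynomial.degree_le_of_natDegree_le (natDegree_coeff_blowupHom_le m A p j)).trans_lt
          (by exact_mod_cast Nat.lt_succ_self _))⟩
      map_add' := fun p q => by ext j : 2; simp
      map_smul' := fun c p => by ext j : 2; simp }
  have hf : Function.Injective f := by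
    rw [injective_iff_map_eq_zero]
    intro p hp
    apply Subtype.ext
    refine (injective_iff_map_eq_zero (blowupHom m A)).1 (blowupHom_injective m A) _ ?_
    ext1 j
    rcases lt_or_ge j k with hj | hj
    · exact congrArg Subtype.val (congrFun hp ⟨j, hj⟩)
    · exact coeff_blowupHom_eq_zero m A p.2 hj
  -- Surjectivity is a dimension count: both sides have dimension ∑ (j + 1) over j < k.
  LinearEquiv.ofBijective f ⟨hf, (LinearMap.injective_iff_surjective_of_finrank_eq_finrank (by
    rw [finrank_polyLT_eq_sum, Module.finrank_pi_fintype]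
    simp [finrank_degreeLT_eq])).1 hf⟩

theorem homogeneousEquiv_apply (m : ℝ) (A : Plane) (k : ℕ) (p : polyLT k) (j : Fin k) :
    (homogeneousEquiv m A k p j : Polynomial ℝ) =
      (blowupHom m A p).coeff j := rfl

/-- The map `(δᵢ) ↦ ∑ᵢ ℓᵢ^(μ+1) δᵢ`. -/
def syzygyMap {ι : Type*} [Fintype ι] (m : ℝ) (a b : ι → ℝ) (μ k : ℕ) :
    (ι → polyLT k) →ₗ[ℝ] MvPolynomial (Fin 2) ℝ :=
  ∑ i, LinearMap.mulLeft ℝ (linePoly m (a i) (b i) ^ (μ + 1)) ∘ₗ (polyLT k).subtype ∘ₗ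
    LinearMap.proj i

theorem syzygyMap_apply {ι : Type*} [Fintype ι] (m : ℝ) (a b : ι → ℝ) (μ k : ℕ)
    (δ : ι → polyLT k) : syzygyMap m a b μ k δ =
      ∑ i, linePoly m (a i) (b i) ^ (μ + 1) * (δ i : MvPolynomial (Fin 2) ℝ) := by
  simp [syzygyMap]

/-- For a line through A the blow-up turns ℓᵢ into t(s - aᵢ). The factor t^(μ+1) is common to all
terms and cancels, and the remaining factors do not involve t, so the relation holds separately for
each power of t. -/
theorem mem_ker_syzygyMap_iff {ι : Type*} [Fintype ι] {m : ℝ} {a b : ι → ℝ} {A : Plane}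
    (hA : ∀ i, evalAt (linePoly m (a i) (b i)) A = 0) (μ k : ℕ) (δ : ι → polyLT k) :
    δ ∈ LinearMap.ker (syzygyMap m a b μ k) ↔ ∀ j : Fin k,
      (fun i => homogeneousEquiv m A k (δ i) j) ∈ LinearMap.ker (powerSum a (μ + 1) j) := by
  have hexp : blowupHom m A (syzygyMap m a b μ k δ) = Polynomial.X ^ (μ + 1) *
      ∑ i, Polynomial.C ((Polynomial.X - Polynomial.C (a i)) ^ (μ + 1)) *
        blowupHom m A (δ i) := by
    rw [syzygyMap_apply, map_sum, Finset.mul_sum]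
    refine Finset.sum_congr rfl fun i _ => ?_
    rw [map_mul, map_pow, blowupHom_linePoly (hA i), mul_pow, mul_assoc, Polynomial.C_pow]
  rw [LinearMap.mem_ker, ← (injective_iff_map_eq_zero' (blowupHom m A)).1 (blowupHom_injective m A),
    hexp, mul_eq_zero, or_iff_right (pow_ne_zero _ Polynomial.X_ne_zero)]
  have hco : ∀ j, (∑ i, Polynomial.C ((Polynomial.X - Polynomial.C (a i)) ^ (μ + 1)) *
      blowupHom m A (δ i)).coeff j =
        ∑ i, (Polynomial.X - Polynomial.C (a i)) ^ (μ + 1) * (blowupHom m A (δ i)).coeff j := by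
    intro j
    rw [Polynomial.finsetSum_coeff]
    exact Finset.sum_congr rfl fun i _ => Polynomial.coeff_C_mul _
  constructor
  · intro h j
    rw [LinearMap.mem_ker, powerSum_apply]
    simp only [homogeneousEquiv_apply]
    rw [← hco, h, Polynomial.coeff_zero]
  · intro h
    ext1 j
    rw [hco, Polynomial.coeff_zero]
    rcases lt_or_ge j k with hj | hj
    · have := h ⟨j, hj⟩
      rwa [LinearMap.mem_ker, powerSum_apply] at this
    · exact Finset.sum_eq_zero fun i _ => by
        rw [coeff_blowupHom_eq_zero m A (δ i).2 hj, mul_zero]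

/-- The homogeneous decomposition of the syzygies at a point. -/
def syzygyEquiv {ι : Type*} [Fintype ι] {m : ℝ} {a b : ι → ℝ} {A : Plane}
    (hA : ∀ i, evalAt (linePoly m (a i) (b i)) A = 0) (μ k : ℕ) :
    LinearMap.ker (syzygyMap m a b μ k) ≃ₗ[ℝ]
      (∀ j : Fin k, LinearMap.ker (powerSum a (μ + 1) j)) where
  toFun δ j := ⟨fun i => homogeneousEquiv m A k (δ.1 i) j,
    (mem_ker_syzygyMap_iff hA μ k δ.1).1 δ.2 j⟩
  map_add' δ δ' := by ext : 4; simp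
  map_smul' c δ := by ext : 4; simp
  invFun f := ⟨fun i => (homogeneousEquiv m A k).symm fun j => (f j).1 i,
    (mem_ker_syzygyMap_iff hA μ k _).2 fun j => by simp⟩
  left_inv δ := by
    apply Subtype.ext
    funext i
    exact (homogeneousEquiv m A k).symm_apply_apply _
  right_inv f := by
    funext j
    apply Subtype.ext
    simp

theorem finrank_ker_syzygyMap {ι : Type*} [Fintype ι] {m : ℝ} {a b : ι → ℝ} {A : Plane}
    (hA : ∀ i, evalAt (linePoly m (a i) (b i)) A = 0) (ha : Function.Injective a) {μ d : ℕ}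
    (hμ : μ ≤ d) : (Module.finrank ℝ (LinearMap.ker (syzygyMap m a b μ (d - μ))) : ℤ) =
      vertexDim d μ (Fintype.card ι) := by
  have hfree : ∀ j : Fin (d - μ), Module.Free ℝ (LinearMap.ker (powerSum a (μ + 1) j)) :=
    fun j => by exact Module.Free.of_divisionRing ℝ (LinearMap.ker (powerSum a (μ + 1) j))
  have hfin : ∀ j : Fin (d - μ), Module.Finite ℝ (LinearMap.ker (powerSum a (μ + 1) j)) :=
    fun j => inferInstance
  rw [(syzygyEquiv hA μ (d - μ)).finrank_eq, Module.finrank_pi_fintype, Nat.cast_sum]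
  simp only [finrank_ker_powerSum ha]
  rw [Finset.sum_fin_eq_sum_range, vertexDim]
  -- The homogeneous degree j corresponds to the summation index d - μ - j in `vertexDim`.
  refine Finset.sum_nbij' (fun j => d - μ - j) (fun j => d - μ - j) ?_ ?_ ?_ ?_ ?_
  · intro j hj; simp at hj ⊢; omega
  · intro j hj; simp at hj ⊢; omega
  · intro j hj; simp at hj ⊢; omega
  · intro j hj; simp at hj ⊢; omega
  · intro j hj
    rw [Finset.mem_range] at hj
    rw [dif_pos hj]
    have h1 : ((d - μ - j : ℕ) : ℤ) = d - μ - j := by omega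
    rw [h1]
    congr 2 <;> ring

/-! ### Local structure of splines -/

theorem eq_zero_of_mem_closure {p : MvPolynomial (Fin 2) ℝ} {z : Plane} {U : Set Plane}
    (hU : IsOpen U) (hz : z ∈ closure U) (h : ∀ᶠ y in 𝓝 z, y ∈ U → evalAt p y = 0) : p = 0 := by
  obtain ⟨y, hyU, hy⟩ := ((mem_closure_iff_frequently.1 hz).and_eventually
    h.eventually_nhds).exists
  refine eq_zero_of_eventually (z := y) ?_
  filter_upwards [hy, hU.mem_nhds hyU] with t h1 h2 using h1 h2

theorem frequently_of_path {z : Plane} {P : Plane → Prop} (v : Plane)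
    (h : ∀ u : ℝ, 0 < u → P (z + u • v)) : ∃ᶠ y in 𝓝 z, P y := by
  have hc : Filter.Tendsto (fun u : ℝ => z + u • v) (𝓝[>] 0) (𝓝 z) := by
    have : Continuous fun u : ℝ => z + u • v := by fun_prop
    simpa using (this.tendsto 0).mono_left nhdsWithin_le_nhds
  refine hc.frequently (Filter.Eventually.frequently ?_)
  filter_upwards [self_mem_nhdsWithin] with u hu using h u hu

theorem abscissa_add_smul (m : ℝ) (z v : Plane) (u : ℝ) :
    abscissa m (z + u • v) = abscissa m z + u * abscissa m v := by
  simp [abscissa]; ring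

theorem linePoly_add_smul (m a b : ℝ) (z v : Plane) (u : ℝ) :
    evalAt (linePoly m a b) (z + u • v) =
      evalAt (linePoly m a b) z + u * (v 1 - a * abscissa m v) := by
  simp [evalAt_linePoly, abscissa_add_smul]; ring

/-! ### Half-planes and rays determined by a line -/

section HalfPlanes

variable (m a b : ℝ) (z : Plane)

theorem isLinearMap_abscissa : IsLinearMap ℝ (abscissa m) :=
  ⟨fun x y => by simp [abscissa]; ring, fun c x => by simp [abscissa]; ring⟩

theorem isLinearMap_linePoly : IsLinearMap ℝ fun y : Plane => y 1 - a * abscissa m y :=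
  ⟨fun x y => by simp [abscissa]; ring, fun c x => by simp [abscissa]; ring⟩

theorem convex_linePoly_pos : Convex ℝ {y | 0 < evalAt (linePoly m a b) y} := by
  simpa only [evalAt_linePoly, sub_pos] using convex_halfSpace_gt (isLinearMap_linePoly m a) b

theorem convex_linePoly_neg : Convex ℝ {y | evalAt (linePoly m a b) y < 0} := by
  simpa only [evalAt_linePoly, sub_neg] using convex_halfSpace_lt (isLinearMap_linePoly m a) b

theorem convex_linePoly_zero : Convex ℝ {y | evalAt (linePoly m a b) y = 0} := by
  simpa only [evalAt_linePoly, sub_eq_zero] using convex_hyperplane (isLinearMap_linePoly m a) b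

theorem convex_abscissa_lt (c : ℝ) : Convex ℝ {y | abscissa m y < c} :=
  convex_halfSpace_lt (isLinearMap_abscissa m) c

theorem convex_abscissa_gt (c : ℝ) : Convex ℝ {y | c < abscissa m y} :=
  convex_halfSpace_gt (isLinearMap_abscissa m) c

theorem isOpen_linePoly_pos : IsOpen {y | 0 < evalAt (linePoly m a b) y} :=
  isOpen_lt continuous_const (continuous_evalAt _)

theorem isOpen_linePoly_neg : IsOpen {y | evalAt (linePoly m a b) y < 0} :=
  isOpen_lt (continuous_evalAt _) continuous_const

theorem isOpen_abscissa_lt (c : ℝ) : IsOpen {y | abscissa m y < c} :=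
  isOpen_lt (continuous_abscissa m) continuous_const

theorem isOpen_abscissa_gt (c : ℝ) : IsOpen {y | c < abscissa m y} :=
  isOpen_lt continuous_const (continuous_abscissa m)

variable {m a b z}

theorem frequently_linePoly_pos (hz : evalAt (linePoly m a b) z = 0) :
    ∃ᶠ y in 𝓝 z, 0 < evalAt (linePoly m a b) y :=
  frequently_of_path (shearPoint m 0 1) fun u hu => by simp [linePoly_add_smul, hz, hu]

theorem frequently_linePoly_neg (hz : evalAt (linePoly m a b) z = 0) :
    ∃ᶠ y in 𝓝 z, evalAt (linePoly m a b) y < 0 :=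
  frequently_of_path (-shearPoint m 0 1) fun u hu => by
    rw [linePoly_add_smul, hz]
    simp [hu, abscissa, shearPoint]

variable (m z) in
theorem frequently_abscissa_lt : ∃ᶠ y in 𝓝 z, abscissa m y < abscissa m z :=
  frequently_of_path (-shearPoint m 1 0) fun u hu => by
    simp [abscissa, shearPoint, hu]

variable (m z) in
theorem frequently_abscissa_gt : ∃ᶠ y in 𝓝 z, abscissa m z < abscissa m y :=
  frequently_of_path (shearPoint m 1 0) fun u hu => by
    simp [abscissa, shearPoint, hu]

theorem frequently_left_of_linePoly (hz : evalAt (linePoly m a b) z = 0) :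
    ∃ᶠ y in 𝓝 z, evalAt (linePoly m a b) y = 0 ∧ abscissa m y < abscissa m z :=
  frequently_of_path (-shearPoint m 1 a) fun u hu => by
    have : abscissa m (-shearPoint m 1 a) = -1 := by simp [abscissa, shearPoint]; ring
    rw [linePoly_add_smul, abscissa_add_smul, hz, this]
    simp [hu, shearPoint]

theorem frequently_right_of_linePoly (hz : evalAt (linePoly m a b) z = 0) :
    ∃ᶠ y in 𝓝 z, evalAt (linePoly m a b) y = 0 ∧ abscissa m z < abscissa m y :=
  frequently_of_path (shearPoint m 1 a) fun u hu => by
    simp [linePoly_add_smul, abscissa_add_smul, hz, hu]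

theorem slope_eq_of_linePoly {a' b' : ℝ} {x : Plane} (hx : evalAt (linePoly m a b) x = 0)
    (hx' : evalAt (linePoly m a' b') x = 0) (hz : evalAt (linePoly m a b) z = 0)
    (hz' : evalAt (linePoly m a' b') z = 0) (hne : z ≠ x) : a = a' := by
  rw [evalAt_linePoly] at *
  have hw : abscissa m z - abscissa m x ≠ 0 := by
    intro h
    apply hne
    rw [← shearPoint_eta m z, ← shearPoint_eta m x, sub_eq_zero.1 h]
    rw [sub_eq_zero.1 h] at hz
    congr 1
    linarith
  have : (a - a') * (abscissa m z - abscissa m x) = 0 := by linarith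
  exact sub_eq_zero.1 ((mul_eq_zero.1 this).resolve_right hw)

theorem abscissa_ne_of_linePoly {x : Plane} (hx : evalAt (linePoly m a b) x = 0)
    (hz : evalAt (linePoly m a b) z = 0) (hne : z ≠ x) : abscissa m z ≠ abscissa m x := by
  intro h
  apply hne
  rw [evalAt_linePoly] at hx hz
  rw [← shearPoint_eta m z, ← shearPoint_eta m x, h]
  rw [h] at hz
  congr 1
  linarith

end HalfPlanes

/-- The truncated power `ℓ₊^(μ+1) q`. -/
def cut (m a b : ℝ) (μ : ℕ) (q : MvPolynomial (Fin 2) ℝ) : Plane → ℝ := fun y =>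
  if 0 < evalAt (linePoly m a b) y then evalAt (linePoly m a b ^ (μ + 1) * q) y else 0

theorem cut_of_pos {m a b : ℝ} {μ : ℕ} {q : MvPolynomial (Fin 2) ℝ} {y : Plane}
    (h : 0 < evalAt (linePoly m a b) y) :
    cut m a b μ q y = evalAt (linePoly m a b ^ (μ + 1) * q) y := if_pos h

theorem cut_of_not_pos {m a b : ℝ} {μ : ℕ} {q : MvPolynomial (Fin 2) ℝ} {y : Plane}
    (h : ¬ 0 < evalAt (linePoly m a b) y) : cut m a b μ q y = 0 := if_neg h

theorem contDiff_cut (m a b : ℝ) (μ : ℕ) (q : MvPolynomial (Fin 2) ℝ) :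
    ContDiff ℝ μ (cut m a b μ q) := by
  have h : cut m a b μ q = fun y =>
      (fun t : ℝ => if 0 < t then t ^ (μ + 1) else 0) (evalAt (linePoly m a b) y) *
        evalAt q y := by
    ext y
    simp only [cut]
    split_ifs <;> simp
  rw [h]
  exact ((contDiff_truncPow μ).comp (contDiff_evalAt _)).mul (contDiff_evalAt _)

theorem cut_sub (m a b : ℝ) (μ : ℕ) (p q : MvPolynomial (Fin 2) ℝ) :
    cut m a b μ (p - q) = cut m a b μ p - cut m a b μ q := by
  ext y
  simp only [cut, Pi.sub_apply]
  split_ifs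
  · simp; ring
  · simp

theorem cut_zero (m a b : ℝ) (μ : ℕ) : cut m a b μ 0 = 0 := by
  ext y
  simp [cut]

theorem cut_mem_polyGerm {d μ : ℕ} (hμ : μ ≤ d) {m a b : ℝ} {q : MvPolynomial (Fin 2) ℝ}
    (hq : q ∈ polyLT (d - μ)) {z : Plane} (hz : evalAt (linePoly m a b) z ≠ 0) :
    cut m a b μ q ∈ polyGerm d z := by
  rcases hz.lt_or_gt with h | h
  · refine ⟨0, Submodule.zero_mem _, ?_⟩
    filter_upwards [(isOpen_linePoly_neg m a b).mem_nhds h] with y hy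
    rw [cut, if_neg (not_lt.2 (le_of_lt hy)), evalAt_zero]
  · refine ⟨_, (linePoly_pow_mul_mem hμ m a b).2 hq, ?_⟩
    filter_upwards [(isOpen_linePoly_pos m a b).mem_nhds h] with y hy
    exact if_pos hy

/-- A truncated power that is polynomial near a point of its line vanishes. -/
theorem eq_zero_of_cut_mem_polyGerm {d μ : ℕ} {m a b : ℝ} {q : MvPolynomial (Fin 2) ℝ} {z : Plane}
    (hz : evalAt (linePoly m a b) z = 0) (h : cut m a b μ q ∈ polyGerm d z) : q = 0 := by
  obtain ⟨p, -, hp⟩ := h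
  have hp0 : p = 0 := by
    refine eq_zero_of_mem_closure (isOpen_linePoly_neg m a b)
      (mem_closure_iff_frequently.2 (frequently_linePoly_neg hz)) ?_
    filter_upwards [hp] with y hy hneg
    rw [← hy]
    exact if_neg (not_lt.2 (le_of_lt hneg))
  have : linePoly m a b ^ (μ + 1) * q = 0 := by
    refine eq_zero_of_mem_closure (isOpen_linePoly_pos m a b)
      (mem_closure_iff_frequently.2 (frequently_linePoly_pos hz)) ?_
    filter_upwards [hp] with y hy hpos
    rw [hp0, evalAt_zero] at hy
    rw [← hy]
    exact (if_pos hpos).symm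
  exact (mul_eq_zero.1 this).resolve_left (pow_ne_zero _ (linePoly_ne_zero m a b))

/-- Uniqueness of the coefficient: the difference of two candidates is a truncated power that is
polynomial near a point of its line. -/
theorem eq_of_sub_cut_mem_polyGerm {d μ : ℕ} {m a b : ℝ} {s : Plane → ℝ}
    {p q : MvPolynomial (Fin 2) ℝ} {z : Plane} (hz : evalAt (linePoly m a b) z = 0)
    (hp : s - cut m a b μ p ∈ polyGerm d z) (hq : s - cut m a b μ q ∈ polyGerm d z) : p = q := by
  rw [← sub_eq_zero]
  refine eq_zero_of_cut_mem_polyGerm (d := d) (μ := μ) hz ?_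
  rw [cut_sub]
  simpa using Submodule.sub_mem _ hq hp

/-- Two functions continuous at a point of the closure of a set and equal on this set are equal
at the point. -/
theorem eq_of_frequently_eq {f g : Plane → ℝ} {z : Plane} {P : Plane → Prop}
    (hf : ContinuousAt f z) (hg : ContinuousAt g z) (hP : ∃ᶠ y in 𝓝 z, P y)
    (h : ∀ᶠ y in 𝓝 z, P y → f y = g y) : f z = g z := by
  by_contra hne
  obtain ⟨y, hy, h1, h2⟩ := (hP.and_eventually (h.and ((hf.sub hg).eventually_ne
    (sub_ne_zero.2 hne)))).exists
  exact h2 (sub_eq_zero.2 (h1 hy))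

/-- A `C^μ` function that is piecewise polynomial on the two sides of a line is, near a point of the
line, a polynomial plus a truncated power. -/
theorem exists_jump {d μ : ℕ} (hμ : μ ≤ d) {m a b : ℝ} {s : Plane → ℝ} {z : Plane}
    (hz : evalAt (linePoly m a b) z = 0) (hs : ContDiffAt ℝ μ s z)
    (h : ∀ᶠ y in 𝓝 z, evalAt (linePoly m a b) y ≠ 0 → s ∈ polyGerm d y) :
    ∃ q ∈ polyLT (d - μ), s - cut m a b μ q ∈ polyGerm d z := by
  obtain ⟨r, hr, hB⟩ := Metric.eventually_nhds_iff_ball.1 (h.and (hs.eventually (by simp)))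
  obtain ⟨p, hp, hps⟩ := exists_poly_of_isPreconnected
    (Metric.isOpen_ball.inter (isOpen_linePoly_pos m a b))
    (((convex_ball z r).inter (convex_linePoly_pos m a b)).isPreconnected)
    fun y hy => (hB y hy.1).1 (ne_of_gt hy.2)
  obtain ⟨p', hp', hps'⟩ := exists_poly_of_isPreconnected
    (Metric.isOpen_ball.inter (isOpen_linePoly_neg m a b))
    (((convex_ball z r).inter (convex_linePoly_neg m a b)).isPreconnected)
    fun y hy => (hB y hy.1).1 (ne_of_lt hy.2)
  have hBz := Metric.ball_mem_nhds z hr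
  have hform : ∀ y ∈ Metric.ball z r, s y - evalAt p' y =
      if 0 < evalAt (linePoly m a b) y then evalAt (p - p') y else 0 := by
    intro y hy
    split_ifs with hpos
    · rw [hps y ⟨hy, hpos⟩, evalAt_sub]
    · rw [sub_eq_zero]
      rcases (not_lt.1 hpos).lt_or_eq with hneg | hzero
      · exact hps' y ⟨hy, hneg⟩
      · refine eq_of_frequently_eq (hB y hy).2.continuousAt (continuous_evalAt p').continuousAt
          (frequently_linePoly_neg hzero) ?_
        filter_upwards [Metric.isOpen_ball.mem_nhds hy] with t ht hneg
        exact hps' t ⟨ht, hneg⟩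
  -- Subtracting the polynomial of the lower side leaves a polynomial cut off along the line that is
  -- still C^μ.
  have hdvd : linePoly m a b ^ (μ + 1) ∣ p - p' := by
    refine linePoly_pow_dvd_of_contDiffAt hz ?_
    refine (hs.sub (contDiff_evalAt p').contDiffAt).congr_of_eventuallyEq ?_
    filter_upwards [hBz] with y hy using (hform y hy).symm
  obtain ⟨q, hq⟩ := hdvd
  refine ⟨q, (linePoly_pow_mul_mem hμ m a b).1 (hq ▸ Submodule.sub_mem _ hp hp'), p', hp', ?_⟩
  filter_upwards [hBz] with y hy
  have := hform y hy
  rw [hq] at this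
  simp only [Pi.sub_apply, cut]
  linarith

/-- A coefficient valid near one point of the line is valid at all nearby points, where uniqueness
identifies it with theirs. The coefficient is thus locally constant on a preconnected set. -/
theorem exists_const_jump {d μ : ℕ} {m a b : ℝ} {s : Plane → ℝ} {U : Set Plane}
    (hc : IsPreconnected U) (hU : ∀ z ∈ U, evalAt (linePoly m a b) z = 0)
    (h : ∀ z ∈ U, ∃ q ∈ polyLT (d - μ), s - cut m a b μ q ∈ polyGerm d z) :
    ∃ q ∈ polyLT (d - μ), ∀ z ∈ U, s - cut m a b μ q ∈ polyGerm d z := by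
  rcases U.eq_empty_or_nonempty with rfl | ⟨z₀, hz₀⟩
  · exact ⟨0, Submodule.zero_mem _, by simp⟩
  choose! q hq hqs using h
  refine ⟨q z₀, hq z₀ hz₀, fun z hz => ?_⟩
  have hconst : q z₀ = q z := by
    refine hc.induction₂' (fun a b => q a = q b) ?_ ?_ hz₀ hz
    · intro x hx
      filter_upwards [nhdsWithin_le_nhds (eventually_mem_polyGerm (hqs x hx)),
        self_mem_nhdsWithin] with y hy hyU
      have := eq_of_sub_cut_mem_polyGerm (hU y hyU) hy (hqs y hyU)
      exact ⟨this, this.symm⟩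
    · intro a b c _ _ _ hab hbc
      exact hab.trans hbc
  exact hconst ▸ hqs z hz

/-- The indicator of a smooth function that vanishes near a dense part of the frontier is
smooth. -/
theorem contDiff_indicator {E : Type} [NormedAddCommGroup E] [NormedSpace ℝ E] (n : ℕ) {F : Type}
    [NormedAddCommGroup F] [NormedSpace ℝ F] {H : Set E} {G : E → F} (hG : ContDiff ℝ n G)
    (h : ∀ z ∈ frontier H, z ∈ closure {y | G =ᶠ[𝓝 y] 0}) :
    ContDiff ℝ n (H.indicator G) := by
  have hzero : ∀ {F : Type} [NormedAddCommGroup F] [NormedSpace ℝ F] {G : E → F},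
      Continuous G → (∀ z ∈ frontier H, z ∈ closure {y | G =ᶠ[𝓝 y] 0}) →
        ∀ z ∈ frontier H, G z = 0 := by
    intro F _ _ G hG h z hz
    have hcl : IsClosed {y | G y = 0} := isClosed_eq hG continuous_const
    exact closure_minimal (fun y (hy : G =ᶠ[𝓝 y] 0) => hy.eq_of_nhds) hcl (h z hz)
  induction n generalizing F with
  | zero =>
    exact contDiff_zero.2 (hG.continuous.indicator (hzero hG.continuous h))
  | succ n ih =>
    have hG' : ContDiff ℝ n (fderiv ℝ G) := hG.fderiv_right (by simp)
    have h' : ∀ z ∈ frontier H, z ∈ closure {y | fderiv ℝ G =ᶠ[𝓝 y] 0} := by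
      intro z hz
      refine closure_mono (fun y (hy : G =ᶠ[𝓝 y] 0) => ?_) (h z hz)
      have := hy.fderiv (𝕜 := ℝ)
      refine this.trans (Filter.Eventually.of_forall fun t => ?_)
      simp
    have hd : ∀ z, HasFDerivAt (H.indicator G) (H.indicator (fderiv ℝ G) z) z := by
      intro z
      have hGz : HasFDerivAt G (fderiv ℝ G z) z :=
        (hG.differentiable (by simp) z).hasFDerivAt
      by_cases hz : z ∈ frontier H
      · have h0 := hzero hG'.continuous h' z hz
        have h1 := hzero hG.continuous h z hz
        have h2 : H.indicator (fderiv ℝ G) z = 0 := by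
          by_cases hzH : z ∈ H <;> simp [hzH, h0]
        have h3 : H.indicator G z = 0 := by
          by_cases hzH : z ∈ H <;> simp [hzH, h1]
        rw [h2]
        rw [h0] at hGz
        -- At a frontier point both G and its derivative vanish, so G is o(y - z) there, and the
        -- indicator is dominated by G in norm.
        rw [hasFDerivAt_iff_isLittleO] at hGz ⊢
        refine Asymptotics.IsBigO.trans_isLittleO
          (Asymptotics.IsBigO.of_bound 1 (Filter.Eventually.of_forall fun y => ?_)) hGz
        simp only [h3, h1, sub_zero, zero_apply, one_mul]
        exact norm_indicator_le_norm_self _ _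
      · rw [frontier, Set.mem_sdiff, not_and_not_right] at hz
        by_cases hcl : z ∈ closure H
        · have hint := hz hcl
          rw [Set.indicator_of_mem (interior_subset hint)]
          refine hGz.congr_of_eventuallyEq ?_
          filter_upwards [mem_interior_iff_mem_nhds.1 hint] with y hy
          exact Set.indicator_of_mem hy _
        · rw [Set.indicator_of_notMem fun hh => hcl (subset_closure hh)]
          refine (hasFDerivAt_const (0 : F) z).congr_of_eventuallyEq ?_
          filter_upwards [isClosed_closure.isOpen_compl.mem_nhds hcl] with y hy
          exact Set.indicator_of_notMem (fun hh => hy (subset_closure hh)) _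
    push_cast
    rw [contDiff_succ_iff_fderiv]
    refine ⟨fun z => (hd z).differentiableAt, by simp, ?_⟩
    rw [show fderiv ℝ (H.indicator G) = H.indicator (fderiv ℝ G) from
      funext fun z => (hd z).fderiv]
    exact ih hG' h'

/-- The local model of a spline at the point `x`: on each line through `x` the coefficient of the
truncated power is `L i` before `x` and `R i` behind `x`. -/
def coneModel {ι : Type*} (m : ℝ) (a b : ι → ℝ) (μ k : ℕ) (S : Finset ι) (x : Plane)
    (L R : ι → polyLT k) : Plane → ℝ := fun y =>
  ∑ i ∈ S, cut m (a i) (b i) μ (if abscissa m y ≤ abscissa m x then L i else R i) y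

/-! ### The local model at a point: smoothness, uniqueness, existence -/

section ConeModel

variable {ι : Type*} {m : ℝ} {a b : ι → ℝ} {d μ : ℕ} {S : Finset ι} {x : Plane}
  {L R : ι → polyLT (d - μ)}

theorem coneModel_of_le {y : Plane} (hy : abscissa m y ≤ abscissa m x) :
    coneModel m a b μ (d - μ) S x L R y = ∑ i ∈ S, cut m (a i) (b i) μ (L i) y := by
  simp only [coneModel, if_pos hy]

theorem coneModel_of_gt {y : Plane} (hy : abscissa m x < abscissa m y) :
    coneModel m a b μ (d - μ) S x L R y = ∑ i ∈ S, cut m (a i) (b i) μ (R i) y := by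
  simp only [coneModel, if_neg (not_le.2 hy)]

theorem coneModel_eventuallyEq_left {z : Plane} (hz : abscissa m z < abscissa m x) :
    coneModel m a b μ (d - μ) S x L R =ᶠ[𝓝 z] ∑ i ∈ S, cut m (a i) (b i) μ (L i) := by
  filter_upwards [(isOpen_abscissa_lt m _).mem_nhds hz] with y hy
  rw [coneModel_of_le (le_of_lt hy), Finset.sum_apply]

theorem coneModel_eventuallyEq_right {z : Plane} (hz : abscissa m x < abscissa m z) :
    coneModel m a b μ (d - μ) S x L R =ᶠ[𝓝 z] ∑ i ∈ S, cut m (a i) (b i) μ (R i) := by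
  filter_upwards [(isOpen_abscissa_gt m _).mem_nhds hz] with y hy
  rw [coneModel_of_gt hy, Finset.sum_apply]

theorem sum_cut_mem_polyGerm (hμ : μ ≤ d) {z : Plane}
    (hz : ∀ i ∈ S, evalAt (linePoly m (a i) (b i)) z ≠ 0) :
    ∑ i ∈ S, cut m (a i) (b i) μ (L i) ∈ polyGerm d z :=
  Submodule.sum_mem _ fun i hi => cut_mem_polyGerm hμ (L i).2 (hz i hi)

theorem sum_cut_sub_mem_polyGerm (hμ : μ ≤ d)
    (hx : ∀ i ∈ S, evalAt (linePoly m (a i) (b i)) x = 0) (ha : Set.InjOn a S) {z : Plane}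
    (hzx : z ≠ x) {i : ι} (hi : i ∈ S) (hz : evalAt (linePoly m (a i) (b i)) z = 0) :
    ∑ i ∈ S, cut m (a i) (b i) μ (L i) - cut m (a i) (b i) μ (L i) ∈ polyGerm d z := by
  classical
  rw [← Finset.add_sum_erase _ _ hi, add_sub_cancel_left]
  refine sum_cut_mem_polyGerm hμ fun j hj hzj => ?_
  rw [Finset.mem_erase] at hj
  exact hj.1 (ha hj.2 hi (slope_eq_of_linePoly (hx j hj.2) (hx i hi) hzj hz hzx))

theorem coneModel_sub_cut_left (hμ : μ ≤ d)
    (hx : ∀ i ∈ S, evalAt (linePoly m (a i) (b i)) x = 0) (ha : Set.InjOn a S) {z : Plane}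
    (hzx : abscissa m z < abscissa m x) {i : ι} (hi : i ∈ S)
    (hz : evalAt (linePoly m (a i) (b i)) z = 0) :
    coneModel m a b μ (d - μ) S x L R - cut m (a i) (b i) μ (L i) ∈ polyGerm d z :=
  (polyGerm_congr ((coneModel_eventuallyEq_left hzx).sub Filter.EventuallyEq.rfl)).2
    (sum_cut_sub_mem_polyGerm hμ hx ha (fun h => hzx.ne (h ▸ rfl)) hi hz)

theorem coneModel_sub_cut_right (hμ : μ ≤ d)
    (hx : ∀ i ∈ S, evalAt (linePoly m (a i) (b i)) x = 0) (ha : Set.InjOn a S) {z : Plane}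
    (hzx : abscissa m x < abscissa m z) {i : ι} (hi : i ∈ S)
    (hz : evalAt (linePoly m (a i) (b i)) z = 0) :
    coneModel m a b μ (d - μ) S x L R - cut m (a i) (b i) μ (R i) ∈ polyGerm d z :=
  (polyGerm_congr ((coneModel_eventuallyEq_right hzx).sub Filter.EventuallyEq.rfl)).2
    (sum_cut_sub_mem_polyGerm hμ hx ha (fun h => hzx.ne (h ▸ rfl)) hi hz)

/-- The sum of the upper truncated powers vanishes near the points below or above `x`. -/
theorem sum_cut_vertical (hx : ∀ i ∈ S, evalAt (linePoly m (a i) (b i)) x = 0) {z : Plane}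
    (hzx : z ≠ x) (hz : abscissa m z = abscissa m x) :
    (∀ᶠ y in 𝓝 z, ∀ L : ι → polyLT (d - μ), ∑ i ∈ S, cut m (a i) (b i) μ (L i) y = 0) ∨
    (∀ᶠ y in 𝓝 z, ∀ L : ι → polyLT (d - μ), ∑ i ∈ S, cut m (a i) (b i) μ (L i) y =
      evalAt (∑ i ∈ S, linePoly m (a i) (b i) ^ (μ + 1) * (L i : MvPolynomial (Fin 2) ℝ)) y) := by
  have h1 : z 1 ≠ x 1 := by
    intro h
    apply hzx
    rw [← shearPoint_eta m z, ← shearPoint_eta m x, h, hz]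
  have hval : ∀ i ∈ S, evalAt (linePoly m (a i) (b i)) z = z 1 - x 1 := by
    intro i hi
    have := hx i hi
    rw [evalAt_linePoly] at this ⊢
    rw [hz]
    linarith
  rcases h1.lt_or_gt with h | h
  · left
    have : ∀ᶠ y in 𝓝 z, ∀ i ∈ S, evalAt (linePoly m (a i) (b i)) y < 0 :=
      (Finset.eventually_all S).2 fun i hi => (isOpen_linePoly_neg _ _ _).mem_nhds (by
        simp only [Set.mem_ofPred_eq, hval i hi]; linarith)
    filter_upwards [this] with y hy L
    exact Finset.sum_eq_zero fun i hi => if_neg (hy i hi).not_gt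
  · right
    have : ∀ᶠ y in 𝓝 z, ∀ i ∈ S, 0 < evalAt (linePoly m (a i) (b i)) y :=
      (Finset.eventually_all S).2 fun i hi => (isOpen_linePoly_pos _ _ _).mem_nhds (by
        simp only [Set.mem_ofPred_eq, hval i hi]; linarith)
    filter_upwards [this] with y hy L
    rw [evalAt_sum]
    exact Finset.sum_congr rfl fun i hi => if_pos (hy i hi)

/-- The only danger is the vertical line through x, where the coefficients switch from L to R. Below
x no truncated power is active, and above x all are, so that the syzygy makes the two sums equal. -/
theorem coneModel_mem_polyGerm (hμ : μ ≤ d)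
    (hx : ∀ i ∈ S, evalAt (linePoly m (a i) (b i)) x = 0)
    (hsyz : ∑ i ∈ S, linePoly m (a i) (b i) ^ (μ + 1) * (R i : MvPolynomial (Fin 2) ℝ) =
      ∑ i ∈ S, linePoly m (a i) (b i) ^ (μ + 1) * (L i : MvPolynomial (Fin 2) ℝ)) {z : Plane}
    (hzx : z ≠ x) (hz : ∀ i ∈ S, evalAt (linePoly m (a i) (b i)) z ≠ 0) :
    coneModel m a b μ (d - μ) S x L R ∈ polyGerm d z := by
  rcases lt_trichotomy (abscissa m z) (abscissa m x) with h | h | h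
  · exact (polyGerm_congr (coneModel_eventuallyEq_left h)).2 (sum_cut_mem_polyGerm hμ hz)
  · have key : coneModel m a b μ (d - μ) S x L R =ᶠ[𝓝 z]
        ∑ i ∈ S, cut m (a i) (b i) μ (L i) := by
      rcases sum_cut_vertical (d := d) (μ := μ) hx hzx h with hv | hv
      · filter_upwards [hv] with y hy
        rw [Finset.sum_apply, hy L]
        rcases le_or_gt (abscissa m y) (abscissa m x) with hw | hw
        · rw [coneModel_of_le hw, hy L]
        · rw [coneModel_of_gt hw, hy R]
      · filter_upwards [hv] with y hy
        rw [Finset.sum_apply, hy L]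
        rcases le_or_gt (abscissa m y) (abscissa m x) with hw | hw
        · rw [coneModel_of_le hw, hy L]
        · rw [coneModel_of_gt hw, hy R, hsyz]
    exact (polyGerm_congr key).2 (sum_cut_mem_polyGerm hμ hz)
  · exact (polyGerm_congr (coneModel_eventuallyEq_right h)).2 (sum_cut_mem_polyGerm hμ hz)

/-- The model is the smooth sum with coefficients L plus the sum with coefficients R - L cut off
along the vertical line through x. By the syzygy the latter sum vanishes near every point of that
line except x, and these points are dense in it, so `contDiff_indicator` applies. -/
theorem contDiff_coneModel
    (hx : ∀ i ∈ S, evalAt (linePoly m (a i) (b i)) x = 0)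
    (hsyz : ∑ i ∈ S, linePoly m (a i) (b i) ^ (μ + 1) * (R i : MvPolynomial (Fin 2) ℝ) =
      ∑ i ∈ S, linePoly m (a i) (b i) ^ (μ + 1) * (L i : MvPolynomial (Fin 2) ℝ)) :
    ContDiff ℝ μ (coneModel m a b μ (d - μ) S x L R) := by
  let G : Plane → ℝ := fun y => ∑ i ∈ S, cut m (a i) (b i) μ ((R - L) i : polyLT (d - μ)) y
  let F : Plane → ℝ := fun y => ∑ i ∈ S, cut m (a i) (b i) μ (L i) y
  have hG : ContDiff ℝ μ G := ContDiff.sum fun i _ => contDiff_cut _ _ _ _ _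
  have hF : ContDiff ℝ μ F := ContDiff.sum fun i _ => contDiff_cut _ _ _ _ _
  have hdecomp : coneModel m a b μ (d - μ) S x L R =
      F + {y | abscissa m x < abscissa m y}.indicator G := by
    ext y
    rcases le_or_gt (abscissa m y) (abscissa m x) with hw | hw
    · rw [coneModel_of_le hw, Pi.add_apply, Set.indicator_of_notMem (by simpa using hw), add_zero]
    · rw [coneModel_of_gt hw, Pi.add_apply, Set.indicator_of_mem (by exact hw)]
      simp only [F, G, ← Finset.sum_add_distrib]
      refine Finset.sum_congr rfl fun i _ => ?_
      rw [Pi.sub_apply, Submodule.coe_sub, cut_sub, Pi.sub_apply]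
      ring
  have hGz : ∀ z : Plane, z ≠ x → abscissa m z = abscissa m x → G =ᶠ[𝓝 z] 0 := by
    intro z hzx hz
    rcases sum_cut_vertical (d := d) (μ := μ) hx hzx hz with hv | hv
    · filter_upwards [hv] with y hy using hy _
    · filter_upwards [hv] with y hy
      refine (hy _).trans ?_
      simp only [Pi.sub_apply, Submodule.coe_sub, mul_sub, Finset.sum_sub_distrib, hsyz, sub_self,
        evalAt_zero, Pi.zero_apply]
  rw [hdecomp]
  refine hF.add (contDiff_indicator μ hG fun z hz => ?_)
  have hz' : abscissa m z = abscissa m x :=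
    (frontier_lt_subset_eq continuous_const (continuous_abscissa m) hz).symm
  have hfr : ∃ᶠ y in 𝓝 z, y ≠ z ∧ abscissa m y = abscissa m x := by
    refine frequently_of_path (shearPoint m 0 1) fun u hu => ⟨fun h => ?_, ?_⟩
    · have := congrArg (fun y : Plane => y 1) h
      simp at this
      linarith
    · simp [abscissa_add_smul, hz']
  rw [mem_closure_iff_frequently]
  by_cases hzx : z = x
  · exact hfr.mono fun y hy => hGz y (hzx ▸ hy.1) hy.2
  · exact (hfr.and_eventually (isOpen_ne.mem_nhds hzx)).mono fun y hy => hGz y hy.2 hy.1.2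

/-- At a point of the i-th line just before x the model is a polynomial plus the truncated power
with coefficient L i, which must then vanish. Just behind x the same holds for R i. -/
theorem eq_zero_of_coneModel_mem_polyGerm (hμ : μ ≤ d)
    (hx : ∀ i ∈ S, evalAt (linePoly m (a i) (b i)) x = 0) (ha : Set.InjOn a S)
    (h : coneModel m a b μ (d - μ) S x L R ∈ polyGerm d x) {i : ι} (hi : i ∈ S) :
    L i = 0 ∧ R i = 0 := by
  constructor
  · obtain ⟨z, ⟨hz, hzx⟩, hg⟩ := ((frequently_left_of_linePoly (hx i hi)).and_eventually
      (eventually_mem_polyGerm h)).exists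
    have := Submodule.sub_mem _ hg (coneModel_sub_cut_left (R := R) (L := L) hμ hx ha hzx hi hz)
    exact Subtype.ext (eq_zero_of_cut_mem_polyGerm hz (by simpa using this))
  · obtain ⟨z, ⟨hz, hzx⟩, hg⟩ := ((frequently_right_of_linePoly (hx i hi)).and_eventually
      (eventually_mem_polyGerm h)).exists
    have := Submodule.sub_mem _ hg (coneModel_sub_cut_right (R := R) (L := L) hμ hx ha hzx hi hz)
    exact Subtype.ext (eq_zero_of_cut_mem_polyGerm hz (by simpa using this))

/-- Every spline is, near each point, a polynomial plus a local model. -/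
theorem exists_coneModel (hμ : μ ≤ d)
    (hx : ∀ i ∈ S, evalAt (linePoly m (a i) (b i)) x = 0) (ha : Set.InjOn a S) {s : Plane → ℝ}
    {r : ℝ} (hr : 0 < r) (hs : ∀ z ∈ Metric.ball x r, ContDiffAt ℝ μ s z)
    (hoff : ∀ z ∈ Metric.ball x r, (∀ i ∈ S, evalAt (linePoly m (a i) (b i)) z ≠ 0) →
      s ∈ polyGerm d z) :
    ∃ L R : ι → polyLT (d - μ),
      (∑ i ∈ S, linePoly m (a i) (b i) ^ (μ + 1) * (R i : MvPolynomial (Fin 2) ℝ) =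
        ∑ i ∈ S, linePoly m (a i) (b i) ^ (μ + 1) * (L i : MvPolynomial (Fin 2) ℝ)) ∧
      s - coneModel m a b μ (d - μ) S x L R ∈ polyGerm d x := by
  classical
  have hjump : ∀ i ∈ S, ∀ z ∈ Metric.ball x r, z ≠ x → evalAt (linePoly m (a i) (b i)) z = 0 →
      ∃ q ∈ polyLT (d - μ), s - cut m (a i) (b i) μ q ∈ polyGerm d z := by
    intro i hi z hz hzx hzi
    refine exists_jump hμ hzi (hs z hz) ?_
    have hne : ∀ᶠ y in 𝓝 z, ∀ j ∈ S.erase i, evalAt (linePoly m (a j) (b j)) y ≠ 0 := by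
      refine (Finset.eventually_all _).2 fun j hj => ?_
      refine (continuous_evalAt _).continuousAt.eventually_ne fun hzj => ?_
      rw [Finset.mem_erase] at hj
      exact hj.1 (ha hj.2 hi (slope_eq_of_linePoly (hx j hj.2) (hx i hi) hzj hzi hzx))
    filter_upwards [hne, Metric.isOpen_ball.mem_nhds hz] with y hy hyB hyi
    refine hoff y hyB fun j hj => ?_
    by_cases hji : j = i
    · exact hji ▸ hyi
    · exact hy j (Finset.mem_erase.2 ⟨hji, hj⟩)
  -- the coefficients on the two rays of each line
  have hL : ∀ i : ι, ∃ q : polyLT (d - μ), i ∈ S → ∀ z ∈ Metric.ball x r,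
      abscissa m z < abscissa m x → evalAt (linePoly m (a i) (b i)) z = 0 →
        s - cut m (a i) (b i) μ q ∈ polyGerm d z := by
    intro i
    by_cases hi : i ∈ S
    · obtain ⟨q, hq, h⟩ := exists_const_jump (d := d) (μ := μ) (s := s)
        (U := (Metric.ball x r ∩ {y | abscissa m y < abscissa m x}) ∩
          {y | evalAt (linePoly m (a i) (b i)) y = 0})
        (((convex_ball x r).inter (convex_abscissa_lt m _)).inter
          (convex_linePoly_zero m (a i) (b i))).isPreconnected (fun z hz => hz.2)
        (fun z hz => hjump i hi z hz.1.1
          (fun h => lt_irrefl _ (h ▸ hz.1.2 : abscissa m x < abscissa m x)) hz.2)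
      exact ⟨⟨q, hq⟩, fun _ z hz hw hz0 => h z ⟨⟨hz, hw⟩, hz0⟩⟩
    · exact ⟨0, fun h => absurd h hi⟩
  have hR : ∀ i : ι, ∃ q : polyLT (d - μ), i ∈ S → ∀ z ∈ Metric.ball x r,
      abscissa m x < abscissa m z → evalAt (linePoly m (a i) (b i)) z = 0 →
        s - cut m (a i) (b i) μ q ∈ polyGerm d z := by
    intro i
    by_cases hi : i ∈ S
    · obtain ⟨q, hq, h⟩ := exists_const_jump (d := d) (μ := μ) (s := s)
        (U := (Metric.ball x r ∩ {y | abscissa m x < abscissa m y}) ∩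
          {y | evalAt (linePoly m (a i) (b i)) y = 0})
        (((convex_ball x r).inter (convex_abscissa_gt m _)).inter
          (convex_linePoly_zero m (a i) (b i))).isPreconnected (fun z hz => hz.2)
        (fun z hz => hjump i hi z hz.1.1
          (fun h => lt_irrefl _ (h ▸ hz.1.2 : abscissa m x < abscissa m x)) hz.2)
      exact ⟨⟨q, hq⟩, fun _ z hz hw hz0 => h z ⟨⟨hz, hw⟩, hz0⟩⟩
    · exact ⟨0, fun h => absurd h hi⟩
  choose L hL using hL
  choose R hR using hR
  -- on each half-disc the spline minus the truncated powers is a polynomial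
  have half : ∀ (T : ι → polyLT (d - μ)) (H : Set Plane), IsOpen H → Convex ℝ H → x ∉ H →
      (∀ i ∈ S, ∀ z ∈ Metric.ball x r, z ∈ H → evalAt (linePoly m (a i) (b i)) z = 0 →
        s - cut m (a i) (b i) μ (T i) ∈ polyGerm d z) →
      ∃ p ∈ polyLT (d + 1), ∀ y ∈ Metric.ball x r ∩ H,
        (s - ∑ i ∈ S, cut m (a i) (b i) μ (T i)) y = evalAt p y := by
    intro T H hH hHc hxH hT
    refine exists_poly_of_isPreconnected (Metric.isOpen_ball.inter hH)
      ((convex_ball x r).inter hHc).isPreconnected fun z hz => ?_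
    by_cases hzi : ∃ i ∈ S, evalAt (linePoly m (a i) (b i)) z = 0
    · obtain ⟨i, hi, hz0⟩ := hzi
      have h1 := hT i hi z hz.1 hz.2 hz0
      have h2 := sum_cut_sub_mem_polyGerm (L := T) hμ hx ha (fun h => hxH (h ▸ hz.2)) hi hz0
      simpa using Submodule.sub_mem _ h1 h2
    · push Not at hzi
      exact Submodule.sub_mem _ (hoff z hz.1 hzi) (sum_cut_mem_polyGerm hμ hzi)
  obtain ⟨pL, hpL, hsL⟩ := half L _ (isOpen_abscissa_lt m (abscissa m x))
    (convex_abscissa_lt m _) (fun h => lt_irrefl (abscissa m x) h) fun i hi z hz hw => hL i hi z hz hw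
  obtain ⟨pR, hpR, hsR⟩ := half R _ (isOpen_abscissa_gt m (abscissa m x))
    (convex_abscissa_gt m _) (fun h => lt_irrefl (abscissa m x) h) fun i hi z hz hw => hR i hi z hz hw
  -- comparison on the vertical line through `x`
  have hvert : ∀ u : ℝ, u ≠ 0 → x + u • shearPoint m 0 1 ∈ Metric.ball x r →
      ∃ P, (∀ᶠ y in 𝓝 (x + u • shearPoint m 0 1), s y = evalAt P y) := by
    intro u hu hB
    obtain ⟨P, -, hP⟩ := hoff _ hB fun i hi => by
      rw [linePoly_add_smul, hx i hi]
      simpa using hu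
    exact ⟨P, hP⟩
  obtain ⟨ε, hε, hεB⟩ : ∃ ε : ℝ, 0 < ε ∧ ∀ u : ℝ, |u| = ε →
      x + u • shearPoint m 0 1 ∈ Metric.ball x r := by
    have hpos : 0 < ‖shearPoint m 0 1‖ + 1 := by positivity
    refine ⟨r / 2 / (‖shearPoint m 0 1‖ + 1), by positivity, fun u hu => ?_⟩
    rw [mem_ball_iff_norm, add_sub_cancel_left, norm_smul, Real.norm_eq_abs, hu]
    rw [div_mul_eq_mul_div, div_lt_iff₀ hpos]
    nlinarith [norm_nonneg (shearPoint m 0 1)]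
  -- The point x + u(0, 1) lies on none of the lines, so s is one polynomial P near it. Equating P
  -- with the left and right expressions gives the syzygy up to pL - pR above x, where all truncated
  -- powers are active, and pL = pR below x, where none is.
  have hcomp : ∀ u : ℝ, |u| = ε →
      (0 < u → ∑ i ∈ S, linePoly m (a i) (b i) ^ (μ + 1) * (L i : MvPolynomial (Fin 2) ℝ) + pL =
        ∑ i ∈ S, linePoly m (a i) (b i) ^ (μ + 1) * (R i : MvPolynomial (Fin 2) ℝ) + pR) ∧
      (u < 0 → pL = pR) := by
    intro u hu
    have hu0 : u ≠ 0 := by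
      rintro rfl
      rw [abs_zero] at hu
      exact hε.ne hu
    obtain ⟨P, hP⟩ := hvert u hu0 (hεB u hu)
    set z := x + u • shearPoint m 0 1 with hz
    have hzB := Metric.isOpen_ball.mem_nhds (hεB u hu)
    have hzw : abscissa m z = abscissa m x := by simp [hz, abscissa_add_smul]
    have hval : ∀ i ∈ S, evalAt (linePoly m (a i) (b i)) z = u := fun i hi => by
      rw [hz, linePoly_add_smul, hx i hi]
      simp
    have hfl : z ∈ closure {y | abscissa m y < abscissa m x} :=
      mem_closure_iff_frequently.2 (hzw ▸ frequently_abscissa_lt m z)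
    have hfr : z ∈ closure {y | abscissa m x < abscissa m y} :=
      mem_closure_iff_frequently.2 (hzw ▸ frequently_abscissa_gt m z)
    constructor
    · intro hpos
      have hsign : ∀ᶠ y in 𝓝 z, ∀ i ∈ S, 0 < evalAt (linePoly m (a i) (b i)) y :=
        (Finset.eventually_all S).2 fun i hi => (isOpen_linePoly_pos _ _ _).mem_nhds (by
          simp only [Set.mem_ofPred_eq, hval i hi]; exact hpos)
      have e1 : P - (∑ i ∈ S, linePoly m (a i) (b i) ^ (μ + 1) *
          (L i : MvPolynomial (Fin 2) ℝ) + pL) = 0 := by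
        refine eq_zero_of_mem_closure (isOpen_abscissa_lt m _) hfl ?_
        filter_upwards [hP, hsign, hzB] with y h1 h2 h3 h4
        have h5 := hsL y ⟨h3, h4⟩
        rw [Pi.sub_apply, Finset.sum_apply, h1, Finset.sum_congr rfl fun i hi => cut_of_pos (h2 i hi),
          ← evalAt_sum] at h5
        rw [evalAt_sub, evalAt_add, ← h5]
        ring
      have e2 : P - (∑ i ∈ S, linePoly m (a i) (b i) ^ (μ + 1) *
          (R i : MvPolynomial (Fin 2) ℝ) + pR) = 0 := by
        refine eq_zero_of_mem_closure (isOpen_abscissa_gt m _) hfr ?_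
        filter_upwards [hP, hsign, hzB] with y h1 h2 h3 h4
        have h5 := hsR y ⟨h3, h4⟩
        rw [Pi.sub_apply, Finset.sum_apply, h1, Finset.sum_congr rfl fun i hi => cut_of_pos (h2 i hi),
          ← evalAt_sum] at h5
        rw [evalAt_sub, evalAt_add, ← h5]
        ring
      exact (sub_eq_zero.1 e1).symm.trans (sub_eq_zero.1 e2)
    · intro hneg
      have hsign : ∀ᶠ y in 𝓝 z, ∀ i ∈ S, ¬ 0 < evalAt (linePoly m (a i) (b i)) y :=
        (Finset.eventually_all S).2 fun i hi => by
          filter_upwards [(isOpen_linePoly_neg m (a i) (b i)).mem_nhds (x := z) (by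
            simp only [Set.mem_ofPred_eq, hval i hi]; exact hneg)] with y hy
          exact not_lt.2 (le_of_lt hy)
      have e1 : P - pL = 0 := by
        refine eq_zero_of_mem_closure (isOpen_abscissa_lt m _) hfl ?_
        filter_upwards [hP, hsign, hzB] with y h1 h2 h3 h4
        have h5 := hsL y ⟨h3, h4⟩
        rw [Pi.sub_apply, Finset.sum_apply, h1, Finset.sum_eq_zero fun i hi => cut_of_not_pos (h2 i hi)]
          at h5
        rw [evalAt_sub, ← h5]
        ring
      have e2 : P - pR = 0 := by
        refine eq_zero_of_mem_closure (isOpen_abscissa_gt m _) hfr ?_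
        filter_upwards [hP, hsign, hzB] with y h1 h2 h3 h4
        have h5 := hsR y ⟨h3, h4⟩
        rw [Pi.sub_apply, Finset.sum_apply, h1, Finset.sum_eq_zero fun i hi => cut_of_not_pos (h2 i hi)]
          at h5
        rw [evalAt_sub, ← h5]
        ring
      exact (sub_eq_zero.1 e1).symm.trans (sub_eq_zero.1 e2)
  have hpLR : pL = pR := (hcomp (-ε) (by rw [abs_neg, abs_of_pos hε])).2 (by linarith)
  have hsyz := (hcomp ε (abs_of_pos hε)).1 hε
  rw [hpLR, add_left_inj] at hsyz
  refine ⟨L, R, hsyz.symm, pR, hpR, ?_⟩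
  have hcont : Continuous (coneModel m a b μ (d - μ) S x L R) :=
    (contDiff_coneModel hx hsyz.symm).continuous
  have hlt : ∀ y ∈ Metric.ball x r, abscissa m y < abscissa m x →
      (s - coneModel m a b μ (d - μ) S x L R) y = evalAt pR y := by
    intro y hy hw
    have := hsL y ⟨hy, hw⟩
    rw [Pi.sub_apply, Finset.sum_apply] at this
    rw [Pi.sub_apply, coneModel_of_le hw.le, this, hpLR]
  filter_upwards [Metric.ball_mem_nhds x hr] with y hy
  rcases lt_trichotomy (abscissa m y) (abscissa m x) with hw | hw | hw
  · exact hlt y hy hw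
  · refine eq_of_frequently_eq ((hs y hy).continuousAt.sub hcont.continuousAt)
      (continuous_evalAt pR).continuousAt (frequently_abscissa_lt m y) ?_
    filter_upwards [Metric.isOpen_ball.mem_nhds hy] with t ht htw
    exact hlt t ht (hw ▸ htw)
  · have := hsR y ⟨hy, hw⟩
    rw [Pi.sub_apply, Finset.sum_apply] at this
    rw [Pi.sub_apply, coneModel_of_gt hw, this]

end ConeModel

/-! ### Spline spaces through germs, and the geometry of cross-cuts -/

theorem isOpen_of_mem_cells {Ω Γ : Set Plane} (h : IsOpen (Ω \ Γ)) {φ : Set Plane}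
    (hφ : φ ∈ cells Ω Γ) : IsOpen φ := by
  obtain ⟨x, -, rfl⟩ := hφ
  exact h.connectedComponentIn

theorem isPreconnected_of_mem_cells {Ω Γ : Set Plane} {φ : Set Plane}
    (hφ : φ ∈ cells Ω Γ) : IsPreconnected φ := by
  obtain ⟨x, -, rfl⟩ := hφ
  exact isPreconnected_connectedComponentIn

theorem subset_of_mem_cells {Ω Γ : Set Plane} {φ : Set Plane}
    (hφ : φ ∈ cells Ω Γ) : φ ⊆ Ω \ Γ := by
  obtain ⟨x, -, rfl⟩ := hφ
  exact connectedComponentIn_subset _ _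

theorem nonempty_of_mem_cells {Ω Γ : Set Plane} {φ : Set Plane}
    (hφ : φ ∈ cells Ω Γ) : φ.Nonempty := by
  obtain ⟨x, hx, rfl⟩ := hφ
  exact ⟨x, mem_connectedComponentIn hx⟩

/-- Cells are open and connected, so being polynomial on every cell is a condition on germs. All
later arguments use this form, and never the shape of the cells. -/
theorem mem_splineSpace_iff {Ω Γ : Set Plane} (h : IsOpen (Ω \ Γ)) {d μ : ℕ} {s : Plane → ℝ} :
    s ∈ splineSpace Ω Γ d μ ↔ (∀ x, x ∉ Ω → s x = 0) ∧ ContDiffOn ℝ μ s Ω ∧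
      ∀ z ∈ Ω \ Γ, s ∈ polyGerm d z := by
  constructor
  · rintro ⟨h0, h1, h2⟩
    refine ⟨h0, h1, fun z hz => ?_⟩
    have hc : connectedComponentIn (Ω \ Γ) z ∈ cells Ω Γ := ⟨z, hz, rfl⟩
    obtain ⟨p, hp, hps⟩ := h2 _ hc
    rw [restrictTotalDegree_eq_polyLT] at hp
    exact ⟨p, hp, Filter.eventually_of_mem ((isOpen_of_mem_cells h hc).mem_nhds
      (mem_connectedComponentIn hz)) hps⟩
  · rintro ⟨h0, h1, h2⟩
    refine ⟨h0, h1, fun φ hφ => ?_⟩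
    rw [restrictTotalDegree_eq_polyLT]
    exact exists_poly_of_isPreconnected (isOpen_of_mem_cells h hφ)
      (isPreconnected_of_mem_cells hφ) fun z hz => h2 z (subset_of_mem_cells hφ hz)

/-! ### Sheared coordinates and the geometry of cross-cuts -/

theorem exists_shear (E : Finset (Plane × Plane)) (hE : ∀ e ∈ E, e.1 ≠ e.2) :
    ∃ m : ℝ, ∀ e ∈ E, abscissa m e.1 ≠ abscissa m e.2 := by
  have hfin : (⋃ e ∈ E, {m : ℝ | abscissa m e.1 = abscissa m e.2}).Finite := by
    refine Set.Finite.biUnion (Finset.finite_toSet E) fun e he => ?_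
    -- A nondegenerate edge is vertical for at most one shear m, so all but finitely many m make
    -- every edge a graph over the abscissa.
    refine Set.Subsingleton.finite fun m hm m' hm' => ?_
    simp only [Set.mem_ofPred_eq, abscissa] at hm hm'
    by_contra hne
    have h1 : (m - m') * (e.1 1 - e.2 1) = 0 := by linarith
    have h2 : e.1 1 = e.2 1 :=
      sub_eq_zero.1 ((mul_eq_zero.1 h1).resolve_left (sub_ne_zero.2 hne))
    rw [h2] at hm
    have h3 : e.1 0 = e.2 0 := by linarith
    refine hE e he ?_
    ext i
    fin_cases i
    · exact h3
    · exact h2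
  obtain ⟨m, hm⟩ := hfin.infinite_compl.nonempty
  refine ⟨m, fun e he h => hm ?_⟩
  exact Set.mem_biUnion he h

theorem line_eq_linePoly {m : ℝ} {p q : Plane} (h : abscissa m p ≠ abscissa m q) :
    ∃ a b : ℝ, (line[ℝ, p, q] : Set Plane) = {y | evalAt (linePoly m a b) y = 0} := by
  have hd : abscissa m q - abscissa m p ≠ 0 := sub_ne_zero.2 h.symm
  refine ⟨(q 1 - p 1) / (abscissa m q - abscissa m p),
    p 1 - (q 1 - p 1) / (abscissa m q - abscissa m p) * abscissa m p, ?_⟩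
  ext y
  rw [SetLike.mem_coe, mem_affineSpan_pair_iff_exists_lineMap_eq, Set.mem_ofPred_eq, evalAt_linePoly]
  constructor
  · rintro ⟨t, rfl⟩
    rw [AffineMap.lineMap_apply_module', add_comm, abscissa_add_smul]
    have : abscissa m (q - p) = abscissa m q - abscissa m p := by simp [abscissa]; ring
    rw [this]
    simp
    field_simp
    ring
  · intro hy
    refine ⟨(abscissa m y - abscissa m p) / (abscissa m q - abscissa m p), ?_⟩
    have h1 : y 1 = p 1 + (abscissa m y - abscissa m p) / (abscissa m q - abscissa m p) *
        (q 1 - p 1) := by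
      field_simp
      field_simp at hy
      linarith
    rw [AffineMap.lineMap_apply_module', ← shearPoint_eta m y]
    have h2 : y 0 = p 0 + (abscissa m y - abscissa m p) / (abscissa m q - abscissa m p) *
        (q 0 - p 0) := by
      have h3 : q 0 - p 0 = (abscissa m q - abscissa m p) - m * (q 1 - p 1) := by
        simp [abscissa]; ring
      have h4 : y 0 = abscissa m y - m * y 1 := by simp [abscissa]
      have h5 : p 0 = abscissa m p - m * p 1 := by simp [abscissa]
      rw [h3, h4, h5, h1]
      field_simp
      ring
    rw [shearPoint_eta]
    ext i
    fin_cases i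
    · simp only [Fin.zero_eta, PiLp.add_apply, PiLp.smul_apply, PiLp.sub_apply, smul_eq_mul]
      linarith
    · simp only [Fin.mk_one, PiLp.add_apply, PiLp.smul_apply, PiLp.sub_apply, smul_eq_mul]
      linarith

variable {Ω : Set Plane} {Δ : PolygonalPartition Ω}

theorem PolygonalPartition.crossCuts_finite (Δ : PolygonalPartition Ω) : Δ.crossCuts.Finite :=
  (Finset.finite_toSet _).image _

instance : Finite Δ.crossCuts := Δ.crossCuts_finite

instance : Fintype Δ.crossCuts := Fintype.ofFinite _

/-- The part of a closed edge inside Ω lies between the open edge and its closure, so it is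
connected and stays in the component of the midpoint. -/
theorem mem_crossCut_of_mem_segment {e : Plane × Plane} (he : e ∈ Δ.edges) {x : Plane}
    (hx : x ∈ segment ℝ e.1 e.2) (hxΩ : x ∈ Ω) : x ∈ crossCut Ω e := by
  have h1 : openSegment ℝ e.1 e.2 ⊆ segment ℝ e.1 e.2 ∩ Ω :=
    Set.subset_inter (openSegment_subset_segment _ _ _) (Δ.inside e he)
  have hpre : IsPreconnected (segment ℝ e.1 e.2 ∩ Ω) := by
    refine (convex_openSegment e.1 e.2).isPreconnected.subset_closure h1 ?_
    rw [closure_openSegment]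
    exact Set.inter_subset_left
  refine hpre.subset_connectedComponentIn (h1 (midpoint_mem_openSegment e.1 e.2)) ?_ ⟨hx, hxΩ⟩
  refine Set.inter_subset_inter_left _ ?_
  rw [segment_eq_image_lineMap]
  rintro _ ⟨t, -, rfl⟩
  exact AffineMap.lineMap_mem_affineSpan_pair _ _ _

theorem grid_inter_subset_extGrid : Δ.grid ∩ Ω ⊆ Δ.extGrid := by
  rintro x ⟨hx, hxΩ⟩
  obtain ⟨e, he, hxe⟩ := Set.mem_iUnion₂.1 hx
  exact ⟨crossCut Ω e, ⟨e, he, rfl⟩, mem_crossCut_of_mem_segment he hxe hxΩ⟩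

theorem isClosed_grid (Δ : PolygonalPartition Ω) : IsClosed Δ.grid := by
  refine Set.Finite.isClosed_biUnion (Finset.finite_toSet _) fun e _ => ?_
  rw [← closure_openSegment]
  exact isClosed_closure

/-- Sheared coordinates in which every cross-cut is a graph. -/
structure CutFrame (Δ : PolygonalPartition Ω) where
  m : ℝ
  a : Δ.crossCuts → ℝ
  b : Δ.crossCuts → ℝ
  nonempty : ∀ C : Δ.crossCuts, C.1.Nonempty
  eq_component : ∀ C : Δ.crossCuts, ∀ x ∈ C.1,
    C.1 = connectedComponentIn ({y | evalAt (linePoly m (a C) (b C)) y = 0} ∩ Ω) x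

theorem nonempty_cutFrame (Δ : PolygonalPartition Ω) : Nonempty (CutFrame Δ) := by
  obtain ⟨m, hm⟩ := exists_shear Δ.edges Δ.nondegenerate
  have key : ∀ C : Δ.crossCuts, ∃ a b : ℝ, C.1.Nonempty ∧ ∀ x ∈ C.1,
      C.1 = connectedComponentIn ({y | evalAt (linePoly m a b) y = 0} ∩ Ω) x := by
    rintro ⟨_, e, he, rfl⟩
    obtain ⟨a, b, hab⟩ := line_eq_linePoly (hm e he)
    refine ⟨a, b, ⟨midpoint ℝ e.1 e.2, ?_⟩, fun x hx => ?_⟩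
    · have hmem := midpoint_mem_openSegment (𝕜 := ℝ) e.1 e.2
      exact mem_crossCut_of_mem_segment he (openSegment_subset_segment _ _ _ hmem)
        (Δ.inside e he hmem)
    · rw [← hab]
      exact connectedComponentIn_eq hx
  choose a b h1 h2 using key
  exact ⟨⟨m, a, b, h1, h2⟩⟩

namespace CutFrame

variable (F : CutFrame Δ)

theorem subset (C : Δ.crossCuts) {x : Plane} (hx : x ∈ C.1) :
    evalAt (linePoly F.m (F.a C) (F.b C)) x = 0 ∧ x ∈ Ω := by
  have h := F.eq_component C x hx
  exact connectedComponentIn_subset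
    ({y | evalAt (linePoly F.m (F.a C) (F.b C)) y = 0} ∩ Ω) x (h ▸ hx)

theorem isPreconnected (F : CutFrame Δ) (C : Δ.crossCuts) : IsPreconnected C.1 := by
  obtain ⟨x, hx⟩ := F.nonempty C
  rw [F.eq_component C x hx]
  exact isPreconnected_connectedComponentIn

theorem eq_of_mem {C C' : Δ.crossCuts} {x : Plane} (hx : x ∈ C.1) (hx' : x ∈ C'.1)
    (h : F.a C = F.a C') : C = C' := by
  have h1 := (F.subset C hx).1
  have h2 := (F.subset C' hx').1
  rw [evalAt_linePoly] at h1 h2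
  have hb : F.b C = F.b C' := by rw [h] at h1; linarith
  apply Subtype.ext
  rw [F.eq_component C x hx, F.eq_component C' x hx', h, hb]

theorem mem_of_ball {C : Δ.crossCuts} {x y : Plane} {r : ℝ} (hr : Metric.ball x r ⊆ Ω)
    (hx : x ∈ C.1) (hy : y ∈ Metric.ball x r)
    (hy0 : evalAt (linePoly F.m (F.a C) (F.b C)) y = 0) : y ∈ C.1 := by
  have hr0 : 0 < r := dist_nonneg.trans_lt (Metric.mem_ball.1 hy)
  rw [F.eq_component C x hx]
  exact ((convex_linePoly_zero F.m (F.a C) (F.b C)).inter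
    (convex_ball x r)).isPreconnected.subset_connectedComponentIn
    ⟨(F.subset C hx).1, Metric.mem_ball_self hr0⟩ (Set.inter_subset_inter_right _ hr) ⟨hy0, hy⟩

/-- A cross-cut is relatively closed in Ω, although not closed in the plane: the chord of its line
in a disc inside Ω belongs to it entirely as soon as one point does. -/
theorem eventually_notMem (F : CutFrame Δ) (hΩ : IsOpen Ω) (C : Δ.crossCuts) {x : Plane} (hx : x ∈ Ω)
    (hxC : x ∉ C.1) : ∀ᶠ y in 𝓝 x, y ∉ C.1 := by
  obtain ⟨r, hr, hB⟩ := Metric.isOpen_iff.1 hΩ x hx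
  by_cases h0 : evalAt (linePoly F.m (F.a C) (F.b C)) x = 0
  · filter_upwards [Metric.ball_mem_nhds x hr] with y hy hyC
    refine hxC ?_
    rw [F.eq_component C y hyC]
    exact ((convex_linePoly_zero F.m (F.a C) (F.b C)).inter
      (convex_ball x r)).isPreconnected.subset_connectedComponentIn
      ⟨(F.subset C hyC).1, hy⟩ (Set.inter_subset_inter_right _ hB) ⟨h0, Metric.mem_ball_self hr⟩
  · filter_upwards [(continuous_evalAt _).continuousAt.eventually_ne h0] with y hy hyC
    exact hy (F.subset C hyC).1

theorem eventually_mem (hΩ : IsOpen Ω) (C : Δ.crossCuts) {x : Plane} (hx : x ∈ C.1) :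
    ∀ᶠ y in 𝓝 x, evalAt (linePoly F.m (F.a C) (F.b C)) y = 0 → y ∈ C.1 := by
  obtain ⟨r, hr, hB⟩ := Metric.isOpen_iff.1 hΩ x (F.subset C hx).2
  filter_upwards [Metric.ball_mem_nhds x hr] with y hy hy0
  exact F.mem_of_ball hB hx hy hy0

/-- Near `x`, the cross-cuts through a point are the cross-cuts through `x` whose line contains
the point. -/
theorem eventually_mem_iff (hΩ : IsOpen Ω) {x : Plane} (hx : x ∈ Ω) :
    ∀ᶠ y in 𝓝 x, ∀ C : Δ.crossCuts,
      y ∈ C.1 ↔ x ∈ C.1 ∧ evalAt (linePoly F.m (F.a C) (F.b C)) y = 0 := by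
  rw [Filter.eventually_all]
  intro C
  by_cases hxC : x ∈ C.1
  · filter_upwards [F.eventually_mem hΩ C hxC] with y hy
    exact ⟨fun h => ⟨hxC, (F.subset C h).1⟩, fun h => hy h.2⟩
  · filter_upwards [F.eventually_notMem hΩ C hx hxC] with y hy
    exact ⟨fun h => absurd h hy, fun h => absurd h.1 hxC⟩

theorem isOpen_diff_extGrid (F : CutFrame Δ) (hΩ : IsOpen Ω) : IsOpen (Ω \ Δ.extGrid) := by
  rw [isOpen_iff_mem_nhds]
  rintro x ⟨hx, hxg⟩
  have h : ∀ᶠ y in 𝓝 x, ∀ C : Δ.crossCuts, y ∉ C.1 :=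
    Filter.eventually_all.2 fun C => F.eventually_notMem hΩ C hx fun hxC => hxg ⟨C.1, C.2, hxC⟩
  filter_upwards [h, hΩ.mem_nhds hx] with y hy hyΩ
  exact ⟨hyΩ, fun ⟨C, hC, hyC⟩ => hy ⟨C, hC⟩ hyC⟩

end CutFrame

/-! ### Jump data along the cross-cuts -/

open Classical in
/-- The cross-cuts through a point. -/
def through (Δ : PolygonalPartition Ω) (x : Plane) : Finset Δ.crossCuts :=
  Finset.univ.filter fun C => x ∈ C.1

@[simp] theorem mem_through {x : Plane} {C : Δ.crossCuts} : C ∈ through Δ x ↔ x ∈ C.1 := by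
  simp [through]

theorem through_eq_singleton {x : Plane} (hx : x ∉ Δ.vertices) {C : Δ.crossCuts}
    (hC : x ∈ C.1) : through Δ x = {C} := by
  ext C'
  rw [mem_through, Finset.mem_singleton]
  constructor
  · intro hC'
    by_contra hne
    exact hx ⟨C'.1, C'.2, C.1, C.2, fun h => hne (Subtype.ext h), hC', hC⟩
  · rintro rfl
    exact hC

theorem coneModel_add {ι : Type*} {m : ℝ} {a b : ι → ℝ} {μ k : ℕ} {S : Finset ι} {x : Plane}
    (L R L' R' : ι → polyLT k) : coneModel m a b μ k S x (L + L') (R + R') =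
      coneModel m a b μ k S x L R + coneModel m a b μ k S x L' R' := by
  ext y
  simp only [coneModel, Pi.add_apply, ← Finset.sum_add_distrib]
  refine Finset.sum_congr rfl fun i _ => ?_
  simp only [cut]
  split_ifs <;> simp <;> ring

theorem coneModel_smul {ι : Type*} {m : ℝ} {a b : ι → ℝ} {μ k : ℕ} {S : Finset ι} {x : Plane}
    (c : ℝ) (L R : ι → polyLT k) : coneModel m a b μ k S x (c • L) (c • R) =
      c • coneModel m a b μ k S x L R := by
  ext y
  simp only [coneModel, Pi.smul_apply, Finset.smul_sum]
  refine Finset.sum_congr rfl fun i _ => ?_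
  simp only [cut]
  split_ifs <;> simp

namespace CutFrame

variable (F : CutFrame Δ) {d μ : ℕ}

theorem injOn_slope (x : Plane) : Set.InjOn F.a (through Δ x) := by
  intro C hC C' hC' h
  exact F.eq_of_mem (mem_through.1 hC) (mem_through.1 hC') h

theorem linePoly_eq_zero {x : Plane} : ∀ C ∈ through Δ x,
    evalAt (linePoly F.m (F.a C) (F.b C)) x = 0 :=
  fun C hC => (F.subset C (mem_through.1 hC)).1

instance (A : Plane) : Fintype {C : Δ.crossCuts // A ∈ C.1} := Fintype.ofFinite _

variable (d μ) in
/-- The syzygies of the powers of the linear forms of the cross-cuts through a point. -/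
def syzygies (A : Plane) : Submodule ℝ ({C : Δ.crossCuts // A ∈ C.1} → polyLT (d - μ)) :=
  LinearMap.ker (syzygyMap F.m (fun C => F.a C.1) (fun C => F.b C.1) μ (d - μ))

variable (d μ) in
/-- An initial coefficient for each cross-cut, and the jumps of the coefficients at the vertices. -/
abbrev JumpData : Type :=
  (Δ.crossCuts → polyLT (d - μ)) × (∀ A : Δ.vertices, F.syzygies d μ A)

open Classical in
/-- The jump of the coefficient along the cross-cut `C` at the point `A`. -/
def jumpAt (A : Plane) (C : Δ.crossCuts) : F.JumpData d μ →ₗ[ℝ] polyLT (d - μ) :=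
  if h : A ∈ Δ.vertices ∧ A ∈ C.1 then
    LinearMap.proj (⟨C, h.2⟩ : {C : Δ.crossCuts // A ∈ C.1}) ∘ₗ (F.syzygies d μ A).subtype ∘ₗ
      LinearMap.proj (⟨A, h.1⟩ : Δ.vertices) ∘ₗ LinearMap.snd ℝ _ _
  else 0

theorem jumpAt_apply {A : Plane} {C : Δ.crossCuts} (hA : A ∈ Δ.vertices) (hC : A ∈ C.1)
    (j : F.JumpData d μ) : F.jumpAt A C j = (j.2 ⟨A, hA⟩).1 ⟨C, hC⟩ := by
  rw [jumpAt, dif_pos ⟨hA, hC⟩]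
  rfl

theorem jumpAt_of_notMem_vertices {A : Plane} (C : Δ.crossCuts) (hA : A ∉ Δ.vertices) :
    F.jumpAt A C = (0 : F.JumpData d μ →ₗ[ℝ] polyLT (d - μ)) :=
  dif_neg fun h => hA h.1

theorem jumpAt_of_notMem {A : Plane} {C : Δ.crossCuts} (hA : A ∉ C.1) :
    F.jumpAt A C = (0 : F.JumpData d μ →ₗ[ℝ] polyLT (d - μ)) :=
  dif_neg fun h => hA h.2

theorem sum_jumpAt (x : Plane) (j : F.JumpData d μ) :
    ∑ C ∈ through Δ x, linePoly F.m (F.a C) (F.b C) ^ (μ + 1) *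
      (F.jumpAt x C j : MvPolynomial (Fin 2) ℝ) = 0 := by
  by_cases hx : x ∈ Δ.vertices
  · have h : syzygyMap F.m (fun C : {C : Δ.crossCuts // x ∈ C.1} => F.a C.1)
        (fun C => F.b C.1) μ (d - μ) (j.2 ⟨x, hx⟩).1 = 0 := (j.2 ⟨x, hx⟩).2
    rw [syzygyMap_apply] at h
    rw [← h, Finset.sum_subtype (p := fun C : Δ.crossCuts => x ∈ C.1) (through Δ x)
      (fun C => mem_through)]
    exact Finset.sum_congr rfl fun C _ => by rw [F.jumpAt_apply hx C.2]
  · exact Finset.sum_eq_zero fun C _ => by simp [F.jumpAt_of_notMem_vertices C hx]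

open Classical in
/-- The coefficient along the cross-cut `C` before the points with abscissa `t`. -/
def coef (C : Δ.crossCuts) (t : ℝ) : F.JumpData d μ →ₗ[ℝ] polyLT (d - μ) :=
  LinearMap.proj C ∘ₗ LinearMap.fst ℝ _ _ +
    ∑ A ∈ Δ.vertices_finite.toFinset, if abscissa F.m A < t then F.jumpAt A C else 0

theorem eventually_coef_left (x : Plane) : ∀ᶠ z in 𝓝 x, abscissa F.m z ≤ abscissa F.m x →
    ∀ C, F.coef C (abscissa F.m z) =
      (F.coef C (abscissa F.m x) : F.JumpData d μ →ₗ[ℝ] polyLT (d - μ)) := by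
  have h : ∀ᶠ z in 𝓝 x, ∀ A ∈ Δ.vertices_finite.toFinset,
      abscissa F.m A < abscissa F.m x → abscissa F.m A < abscissa F.m z := by
    refine (Finset.eventually_all _).2 fun A _ => ?_
    by_cases hA : abscissa F.m A < abscissa F.m x
    · filter_upwards [(isOpen_abscissa_gt F.m _).mem_nhds hA] with z hz _ using hz
    · exact Filter.Eventually.of_forall fun _ h => absurd h hA
  filter_upwards [h] with z hz hzx C
  rw [coef, coef]
  congr 1
  refine Finset.sum_congr rfl fun A hA => ?_
  refine if_congr ⟨fun h => h.trans_le hzx, hz A hA⟩ rfl rfl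

/-- Passing x adds the jumps at all vertices with the abscissa of x. Since `C` is a graph through x,
any such vertex other than x is off `C` and contributes no jump. -/
theorem eventually_coef_right (x : Plane) : ∀ᶠ z in 𝓝 x, abscissa F.m x < abscissa F.m z →
    ∀ C : Δ.crossCuts, x ∈ C.1 → F.coef C (abscissa F.m z) =
      (F.coef C (abscissa F.m x) + F.jumpAt x C : F.JumpData d μ →ₗ[ℝ] polyLT (d - μ)) := by
  have h : ∀ᶠ z in 𝓝 x, ∀ A ∈ Δ.vertices_finite.toFinset,
      abscissa F.m x < abscissa F.m A → abscissa F.m z < abscissa F.m A := by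
    refine (Finset.eventually_all _).2 fun A _ => ?_
    by_cases hA : abscissa F.m x < abscissa F.m A
    · filter_upwards [(isOpen_abscissa_lt F.m _).mem_nhds hA] with z hz _ using hz
    · exact Filter.Eventually.of_forall fun _ h => absurd h hA
  filter_upwards [h] with z hz hzx C hxC
  rw [coef, coef, add_assoc]
  congr 1
  classical
  have hsingle : F.jumpAt x C = ∑ A ∈ Δ.vertices_finite.toFinset,
      if A = x then (F.jumpAt A C : F.JumpData d μ →ₗ[ℝ] polyLT (d - μ)) else 0 := by
    rw [Finset.sum_ite_eq']
    split_ifs with hx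
    · rfl
    · exact F.jumpAt_of_notMem_vertices C fun h => hx (by simpa using h)
  rw [hsingle, ← Finset.sum_add_distrib]
  refine Finset.sum_congr rfl fun A hA => ?_
  by_cases hAC : A ∈ C.1
  · by_cases hAx : A = x
    · subst hAx
      rw [if_pos hzx, if_neg (lt_irrefl _), if_pos rfl, zero_add]
    · have hne := abscissa_ne_of_linePoly (F.subset C hxC).1 (F.subset C hAC).1 hAx
      rw [if_neg hAx, add_zero]
      refine if_congr ⟨fun h => ?_, fun h => h.trans hzx⟩ rfl rfl
      refine lt_of_le_of_ne (not_lt.1 fun hlt => ?_) hne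
      exact lt_asymm h (hz A hA hlt)
  · rw [F.jumpAt_of_notMem hAC]
    simp

/-- The local model of a spline with given jump data. -/
def germ (j : F.JumpData d μ) (x : Plane) : Plane → ℝ :=
  coneModel F.m F.a F.b μ (d - μ) (through Δ x) x (fun C => F.coef C (abscissa F.m x) j)
    (fun C => F.coef C (abscissa F.m x) j + F.jumpAt x C j)

theorem germ_add (j j' : F.JumpData d μ) (x : Plane) :
    F.germ (j + j') x = F.germ j x + F.germ j' x := by
  rw [germ, germ, germ, ← coneModel_add]
  congr 1
  · funext C
    exact map_add _ _ _
  · funext C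
    simp only [map_add, Pi.add_apply]
    abel

theorem germ_smul (c : ℝ) (j : F.JumpData d μ) (x : Plane) :
    F.germ (c • j) x = c • F.germ j x := by
  rw [germ, germ, ← coneModel_smul]
  congr 1
  · funext C
    exact map_smul _ _ _
  · funext C
    simp only [map_smul, Pi.smul_apply, smul_add]

theorem germ_syzygy (j : F.JumpData d μ) (x : Plane) :
    ∑ C ∈ through Δ x, linePoly F.m (F.a C) (F.b C) ^ (μ + 1) *
      ((F.coef C (abscissa F.m x) j + F.jumpAt x C j : polyLT (d - μ)) :
        MvPolynomial (Fin 2) ℝ) =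
    ∑ C ∈ through Δ x, linePoly F.m (F.a C) (F.b C) ^ (μ + 1) *
      (F.coef C (abscissa F.m x) j : MvPolynomial (Fin 2) ℝ) := by
  simp only [Submodule.coe_add, mul_add, Finset.sum_add_distrib, F.sum_jumpAt, add_zero]

theorem germ_eq_zero (j : F.JumpData d μ) {x : Plane} (hx : x ∉ Δ.extGrid) :
    F.germ j x = 0 := by
  ext y
  refine Finset.sum_eq_zero fun C hC => ?_
  exact absurd ⟨C.1, C.2, mem_through.1 hC⟩ hx

theorem germ_eq_cut (j : F.JumpData d μ) {x : Plane} (hx : x ∉ Δ.vertices) {C : Δ.crossCuts}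
    (hC : x ∈ C.1) : F.germ j x =
      cut F.m (F.a C) (F.b C) μ (F.coef C (abscissa F.m x) j) := by
  ext y
  rw [germ, coneModel, through_eq_singleton hx hC, Finset.sum_singleton,
    F.jumpAt_of_notMem_vertices C hx, LinearMap.zero_apply, add_zero, ite_self]

/-- A point z ≠ x close to x is not a vertex. If it lies on a cross-cut, that cross-cut passes
through x, and its coefficient at z is the one that the model at x has before or behind x. Otherwise
the model at z is 0 and the model at x is polynomial there. -/
theorem germ_compatible (hΩ : IsOpen Ω) (hμ : μ ≤ d) (j : F.JumpData d μ) {x : Plane}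
    (hx : x ∈ Ω) : ∀ᶠ z in 𝓝 x, F.germ j x - F.germ j z ∈ polyGerm d z := by
  have hv : ∀ᶠ z in 𝓝 x, z ∈ Δ.vertices → z = x := by
    have : (Δ.vertices \ {x})ᶜ ∈ 𝓝 x :=
      (Δ.vertices_finite.subset Set.sdiff_subset).isClosed.isOpen_compl.mem_nhds (by simp)
    filter_upwards [this] with z hz hzv
    by_contra hne
    exact hz ⟨hzv, hne⟩
  filter_upwards [hv, F.eventually_mem_iff hΩ hx, F.eventually_coef_left (d := d) (μ := μ) x,
    F.eventually_coef_right (d := d) (μ := μ) x, hΩ.mem_nhds hx] with z hzv hmem hl hr hzΩ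
  by_cases hzx : z = x
  · subst hzx
    rw [sub_self]
    exact Submodule.zero_mem _
  have hzV : z ∉ Δ.vertices := fun h => hzx (hzv h)
  by_cases hg : ∃ C : Δ.crossCuts, z ∈ C.1
  · obtain ⟨C, hC⟩ := hg
    obtain ⟨hxC, hz0⟩ := (hmem C).1 hC
    have hne := abscissa_ne_of_linePoly (F.subset C hxC).1 hz0 hzx
    rw [F.germ_eq_cut j hzV hC]
    rcases hne.lt_or_gt with h | h
    · rw [hl h.le C]
      exact coneModel_sub_cut_left hμ F.linePoly_eq_zero (F.injOn_slope x) h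
        (mem_through.2 hxC) hz0
    · rw [hr h C hxC]
      exact coneModel_sub_cut_right (R := fun C => F.coef C (abscissa F.m x) j + F.jumpAt x C j)
        hμ F.linePoly_eq_zero (F.injOn_slope x) h (mem_through.2 hxC) hz0
  · push Not at hg
    rw [F.germ_eq_zero (x := z) j fun ⟨C, hC, hzC⟩ => hg ⟨C, hC⟩ hzC, sub_zero]
    exact coneModel_mem_polyGerm hμ F.linePoly_eq_zero (F.germ_syzygy j x) hzx
      fun C hC h0 => hg C ((hmem C).2 ⟨mem_through.1 hC, h0⟩)

/-- Every family of jump data is realized by a spline. -/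
theorem exists_spline (hΩ : IsOpen Ω) (hsc : IsSimplyConnected Ω) (hμ : μ ≤ d)
    (j : F.JumpData d μ) :
    ∃ s ∈ Δ.extSplines d μ, ∀ x ∈ Ω, s - F.germ j x ∈ polyGerm d x := by
  obtain ⟨s, hs0, hs⟩ := exists_glued hΩ hsc (F.germ j)
    fun x hx => F.germ_compatible hΩ hμ j hx
  refine ⟨s, (mem_splineSpace_iff (F.isOpen_diff_extGrid hΩ)).2 ⟨hs0, fun x hx => ?_, ?_⟩, hs⟩
  · obtain ⟨p, -, hp⟩ := hs x hx
    have h1 : ContDiffAt ℝ μ (evalAt p + F.germ j x) x :=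
      (contDiff_evalAt p).contDiffAt.add
        (contDiff_coneModel F.linePoly_eq_zero (F.germ_syzygy j x)).contDiffAt
    refine (h1.congr_of_eventuallyEq ?_).contDiffWithinAt
    filter_upwards [hp] with y hy
    rw [Pi.add_apply, ← hy, Pi.sub_apply, sub_add_cancel]
  · rintro z ⟨hz, hzg⟩
    have := hs z hz
    rwa [F.germ_eq_zero j hzg, sub_zero] at this

/-- Every spline is, near each point, a polynomial plus a local model. -/
theorem exists_local (hΩ : IsOpen Ω) (hμ : μ ≤ d) {s : Plane → ℝ}
    (hs : s ∈ Δ.extSplines d μ) {x : Plane} (hx : x ∈ Ω) :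
    ∃ L R : Δ.crossCuts → polyLT (d - μ),
      (∑ C ∈ through Δ x, linePoly F.m (F.a C) (F.b C) ^ (μ + 1) *
          (R C : MvPolynomial (Fin 2) ℝ) =
        ∑ C ∈ through Δ x, linePoly F.m (F.a C) (F.b C) ^ (μ + 1) *
          (L C : MvPolynomial (Fin 2) ℝ)) ∧
      s - coneModel F.m F.a F.b μ (d - μ) (through Δ x) x L R ∈ polyGerm d x := by
  obtain ⟨-, hcd, hoff⟩ := (mem_splineSpace_iff (F.isOpen_diff_extGrid hΩ)).1 hs
  obtain ⟨r, hr, hB⟩ := Metric.eventually_nhds_iff_ball.1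
    ((hΩ.eventually_mem hx).and (F.eventually_mem_iff hΩ hx))
  refine exists_coneModel hμ F.linePoly_eq_zero (F.injOn_slope x) hr
    (fun z hz => hcd.contDiffAt (hΩ.mem_nhds (hB z hz).1)) fun z hz h0 => ?_
  refine hoff z ⟨(hB z hz).1, ?_⟩
  rintro ⟨C, hC, hzC⟩
  obtain ⟨h1, h2⟩ := ((hB z hz).2 ⟨C, hC⟩).1 hzC
  exact h0 ⟨C, hC⟩ (mem_through.2 h1) h2

/-- This identifies both coefficients of the model at x with the coefficient transported along `C`
from a neighbouring point. -/
theorem eq_of_cut {s : Plane → ℝ} (hμ : μ ≤ d) {x : Plane} {C : Δ.crossCuts} (hC : x ∈ C.1)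
    {L R : Δ.crossCuts → polyLT (d - μ)} {q : polyLT (d - μ)}
    (h : s - coneModel F.m F.a F.b μ (d - μ) (through Δ x) x L R ∈ polyGerm d x)
    (hq : s - cut F.m (F.a C) (F.b C) μ q ∈ polyGerm d x) : L C = q ∧ R C = q := by
  have hx0 := (F.subset C hC).1
  constructor
  · obtain ⟨z, ⟨hz0, hzx⟩, h1, h2⟩ := ((frequently_left_of_linePoly hx0).and_eventually
      ((eventually_mem_polyGerm h).and (eventually_mem_polyGerm hq))).exists
    have h3 := coneModel_sub_cut_left (R := R) (L := L) hμ F.linePoly_eq_zero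
      (F.injOn_slope x) hzx (mem_through.2 hC) hz0
    have h4 := Submodule.add_mem _ h1 h3
    rw [sub_add_sub_cancel] at h4
    exact Subtype.ext (eq_of_sub_cut_mem_polyGerm hz0 h4 h2)
  · obtain ⟨z, ⟨hz0, hzx⟩, h1, h2⟩ := ((frequently_right_of_linePoly hx0).and_eventually
      ((eventually_mem_polyGerm h).and (eventually_mem_polyGerm hq))).exists
    have h3 := coneModel_sub_cut_right (R := R) (L := L) hμ F.linePoly_eq_zero
      (F.injOn_slope x) hzx (mem_through.2 hC) hz0
    have h4 := Submodule.add_mem _ h1 h3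
    rw [sub_add_sub_cancel] at h4
    exact Subtype.ext (eq_of_sub_cut_mem_polyGerm hz0 h4 h2)

/-- Every spline has jump data. -/
theorem exists_jumpData (hΩ : IsOpen Ω) (hμ : μ ≤ d) {s : Plane → ℝ}
    (hs : s ∈ Δ.extSplines d μ) :
    ∃ j : F.JumpData d μ, ∀ x ∈ Ω, s - F.germ j x ∈ polyGerm d x := by
  have hloc := fun x (hx : x ∈ Ω) => F.exists_local hΩ hμ hs hx
  choose! L R hsyz hs' using hloc
  choose base hbase using F.nonempty
  have hvΩ : ∀ A ∈ Δ.vertices, A ∈ Ω := by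
    rintro A ⟨C, hC, -, -, -, hA, -⟩
    exact (F.subset ⟨C, hC⟩ hA).2
  -- The jumps are forced: the relation between L and R at a vertex says that their difference is a
  -- syzygy.
  let D : ∀ A : Δ.vertices, F.syzygies d μ A := fun A =>
    ⟨fun C => R A C.1 - L A C.1, by
      rw [syzygies, LinearMap.mem_ker, syzygyMap_apply]
      have h := hsyz A (hvΩ A A.2)
      rw [← sub_eq_zero, ← Finset.sum_sub_distrib, Finset.sum_subtype
        (p := fun C : Δ.crossCuts => (A : Plane) ∈ C.1) (through Δ A) (fun C => mem_through)] at h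
      rw [← h]
      exact Finset.sum_congr rfl fun C _ => by rw [Submodule.coe_sub, mul_sub]⟩
  -- The initial coefficient on `C` is normalized at an arbitrary base point, by subtracting the
  -- jumps accumulated up to it.
  let j : F.JumpData d μ := ⟨fun C => L (base C) C -
    F.coef C (abscissa F.m (base C)) ((0, D) : F.JumpData d μ), D⟩
  have hj : ∀ C t, F.coef C t j = j.1 C + F.coef C t ((0, D) : F.JumpData d μ) := by
    intro C t
    have : j = (j.1, 0) + ((0, D) : F.JumpData d μ) := by simp [j]
    conv_lhs => rw [this, map_add]
    congr 1
    rw [coef, LinearMap.add_apply, LinearMap.sum_apply]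
    rw [Finset.sum_eq_zero, add_zero]
    · rfl
    · intro A hA
      split_ifs
      · by_cases hAC : A ∈ C.1
        · rw [F.jumpAt_apply (by simpa using hA) hAC]
          rfl
        · rw [F.jumpAt_of_notMem hAC]
          rfl
      · rfl
  -- Away from the vertices only one line passes through x, and the relation reduces to R = L after
  -- cancelling the power of its linear form.
  have hjump : ∀ x, ∀ C : Δ.crossCuts, x ∈ C.1 → R x C = L x C + F.jumpAt x C j := by
    intro x C hxC
    by_cases hx : x ∈ Δ.vertices
    · rw [F.jumpAt_apply hx hxC]
      exact (add_sub_cancel _ _).symm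
    · have h := hsyz x (F.subset C hxC).2
      rw [through_eq_singleton hx hxC, Finset.sum_singleton, Finset.sum_singleton] at h
      rw [F.jumpAt_of_notMem_vertices C hx, LinearMap.zero_apply, add_zero]
      exact Subtype.ext (mul_left_cancel₀ (pow_ne_zero _ (linePoly_ne_zero _ _ _)) h)
  have hcoef : ∀ C : Δ.crossCuts, ∀ x ∈ C.1, L x C = F.coef C (abscissa F.m x) j := by
    intro C x hx
    -- Along the cross-cut the actual and the prescribed coefficient change by the same jumps, so
    -- their difference is locally constant. It vanishes at the base point.
    have hconst : L x C - F.coef C (abscissa F.m x) j =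
        L (base C) C - F.coef C (abscissa F.m (base C)) j := by
      refine (F.isPreconnected C).induction₂' (fun y z => L y C - F.coef C (abscissa F.m y) j =
        L z C - F.coef C (abscissa F.m z) j) ?_ ?_ hx (hbase C)
      · intro y hy
        have hyΩ := (F.subset C hy).2
        filter_upwards [nhdsWithin_le_nhds (F.eventually_coef_left (d := d) (μ := μ) y),
          nhdsWithin_le_nhds (F.eventually_coef_right (d := d) (μ := μ) y),
          nhdsWithin_le_nhds (eventually_mem_polyGerm (hs' y hyΩ)),
          self_mem_nhdsWithin] with z hl hr hg hz
        suffices h : L y C - F.coef C (abscissa F.m y) j =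
          L z C - F.coef C (abscissa F.m z) j from ⟨h, h.symm⟩
        have hz0 := (F.subset C hz).1
        have hzΩ := (F.subset C hz).2
        rcases lt_trichotomy (abscissa F.m z) (abscissa F.m y) with h | h | h
        · have h1 := Submodule.add_mem _ hg (coneModel_sub_cut_left (R := R y) (L := L y) hμ
            F.linePoly_eq_zero (F.injOn_slope y) h (mem_through.2 hy) hz0)
          rw [sub_add_sub_cancel] at h1
          rw [hl h.le C, (F.eq_of_cut hμ hz (hs' z hzΩ) h1).1]
        · have : z = y := by
            by_contra hne
            exact abscissa_ne_of_linePoly (F.subset C hy).1 hz0 hne h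
          rw [this]
        · have h1 := Submodule.add_mem _ hg (coneModel_sub_cut_right (R := R y) (L := L y) hμ
            F.linePoly_eq_zero (F.injOn_slope y) h (mem_through.2 hy) hz0)
          rw [sub_add_sub_cancel] at h1
          rw [hr h C hy, (F.eq_of_cut hμ hz (hs' z hzΩ) h1).1, hjump y C hy,
            LinearMap.add_apply, add_sub_add_right_eq_sub]
      · intro _ _ _ _ _ _ h1 h2
        exact h1.trans h2
    have h0 : L (base C) C - F.coef C (abscissa F.m (base C)) j = 0 := by
      rw [hj]
      simp [j]
    rw [h0] at hconst
    exact sub_eq_zero.1 hconst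
  refine ⟨j, fun x hx => ?_⟩
  have heq : F.germ j x = coneModel F.m F.a F.b μ (d - μ) (through Δ x) x (L x) (R x) := by
    ext y
    refine Finset.sum_congr rfl fun C hC => ?_
    have hC := mem_through.1 hC
    simp only [hjump x C hC, hcoef C x hC]
  rw [heq]
  exact hs' x hx

/-- All coefficients and all jumps along the cross-cuts vanish by
`eq_zero_of_coneModel_mem_polyGerm`, and the initial coefficients are recovered by subtracting
jumps. -/
theorem jumpData_eq_zero (hμ : μ ≤ d) {j : F.JumpData d μ}
    (h : ∀ x ∈ Ω, F.germ j x ∈ polyGerm d x) : j = 0 := by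
  have key : ∀ C : Δ.crossCuts, ∀ x ∈ C.1, F.coef C (abscissa F.m x) j = 0 ∧
      F.jumpAt x C j = 0 := by
    intro C x hx
    obtain ⟨h1, h2⟩ := eq_zero_of_coneModel_mem_polyGerm hμ F.linePoly_eq_zero (F.injOn_slope x)
      (h x (F.subset C hx).2) (mem_through.2 hx)
    rw [h1, zero_add] at h2
    exact ⟨h1, h2⟩
  refine Prod.ext ?_ ?_
  · funext C
    obtain ⟨x, hx⟩ := F.nonempty C
    have h1 := (key C x hx).1
    rw [coef, LinearMap.add_apply, LinearMap.sum_apply, Finset.sum_eq_zero, add_zero] at h1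
    · exact h1
    · intro A _
      split_ifs
      · by_cases hAC : A ∈ C.1
        · exact (key C A hAC).2
        · rw [F.jumpAt_of_notMem hAC]
          rfl
      · rfl
  · funext A
    apply Subtype.ext
    funext C
    have := (key C.1 A C.2).2
    rwa [F.jumpAt_apply A.2 C.2] at this

end CutFrame

/-! ### The dimension of the splines over the extended cross-cut partition -/

/-- Polynomials as splines. -/
def polySpline (Ω Γ : Set Plane) (d μ : ℕ) :
    polyLT (d + 1) →ₗ[ℝ] splineSpace Ω Γ d μ where
  toFun p := ⟨Ω.indicator (evalAt p), fun x hx => Set.indicator_of_notMem hx _,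
    (contDiff_evalAt (p : MvPolynomial (Fin 2) ℝ)).contDiffOn.congr
      fun x hx => Set.indicator_of_mem hx _,
    fun φ hφ => ⟨p, by rw [restrictTotalDegree_eq_polyLT]; exact p.2,
      fun x hx => Set.indicator_of_mem (subset_of_mem_cells hφ hx).1 _⟩⟩
  map_add' p q := by
    ext x
    by_cases hx : x ∈ Ω <;> simp [hx]
  map_smul' c p := by
    ext x
    by_cases hx : x ∈ Ω <;> simp [hx]

theorem polySpline_apply {Γ : Set Plane} {d μ : ℕ} (p : polyLT (d + 1)) {x : Plane}
    (hx : x ∈ Ω) : (polySpline Ω Γ d μ p).1 x = evalAt p x := Set.indicator_of_mem hx _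

theorem finite_of_surjective_of_range_eq_ker {U V W : Type*} [AddCommGroup U] [AddCommGroup V]
    [AddCommGroup W] [Module ℝ U] [Module ℝ V] [Module ℝ W] [FiniteDimensional ℝ U]
    [FiniteDimensional ℝ W] (f : V →ₗ[ℝ] W) (g : U →ₗ[ℝ] V) (hf : Function.Surjective f)
    (h : LinearMap.ker f = LinearMap.range g) : FiniteDimensional ℝ V := by
  have : FiniteDimensional ℝ (LinearMap.ker f) := by
    rw [h]
    infer_instance
  have : FiniteDimensional ℝ (V ⧸ LinearMap.ker f) :=
    Module.Finite.equiv (f.quotKerEquivOfSurjective hf).symm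
  exact Module.Finite.of_submodule_quotient (LinearMap.ker f)

theorem finrank_of_surjective_of_range_eq_ker {U V W : Type*} [AddCommGroup U] [AddCommGroup V]
    [AddCommGroup W] [Module ℝ U] [Module ℝ V] [Module ℝ W] [FiniteDimensional ℝ V]
    (f : V →ₗ[ℝ] W) (g : U →ₗ[ℝ] V) (hf : Function.Surjective f) (hg : Function.Injective g)
    (h : LinearMap.ker f = LinearMap.range g) :
    Module.finrank ℝ V = Module.finrank ℝ W + Module.finrank ℝ U := by
  rw [← f.finrank_range_add_finrank_ker, h, LinearMap.range_eq_top.2 hf, finrank_top,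
    LinearMap.finrank_range_of_inj hg]

/-! ### The exact sequence of polynomials, splines and jump data -/

namespace CutFrame

variable (F : CutFrame Δ) {d μ : ℕ}

theorem jumpData_unique (hμ : μ ≤ d) {s : Plane → ℝ} {j j' : F.JumpData d μ}
    (h : ∀ x ∈ Ω, s - F.germ j x ∈ polyGerm d x) (h' : ∀ x ∈ Ω, s - F.germ j' x ∈ polyGerm d x) :
    j = j' := by
  rw [← sub_eq_zero]
  refine F.jumpData_eq_zero hμ fun x hx => ?_
  have h1 := Submodule.sub_mem _ (h' x hx) (h x hx)
  have h2 : F.germ (j - j') x = F.germ j x - F.germ j' x := by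
    rw [sub_eq_add_neg j, ← neg_one_smul ℝ j', germ_add, germ_smul, neg_one_smul, ← sub_eq_add_neg]
  rw [sub_sub_sub_cancel_left] at h1
  rwa [h2]

/-- The jump data of a spline. -/
def jumpMap (hΩ : IsOpen Ω) (hμ : μ ≤ d) : Δ.extSplines d μ →ₗ[ℝ] F.JumpData d μ where
  toFun s := (F.exists_jumpData hΩ hμ s.2).choose
  map_add' s t := by
    refine F.jumpData_unique hμ (F.exists_jumpData hΩ hμ (s + t).2).choose_spec fun x hx => ?_
    have h := Submodule.add_mem _ ((F.exists_jumpData hΩ hμ s.2).choose_spec x hx)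
      ((F.exists_jumpData hΩ hμ t.2).choose_spec x hx)
    rw [germ_add]
    convert h using 1
    push_cast
    abel
  map_smul' c s := by
    refine F.jumpData_unique hμ (F.exists_jumpData hΩ hμ (c • s).2).choose_spec fun x hx => ?_
    have h := Submodule.smul_mem _ c ((F.exists_jumpData hΩ hμ s.2).choose_spec x hx)
    rw [RingHom.id_apply, germ_smul]
    convert h using 1
    push_cast
    rw [smul_sub]

theorem jumpMap_spec (hΩ : IsOpen Ω) (hμ : μ ≤ d) (s : Δ.extSplines d μ) :
    ∀ x ∈ Ω, s.1 - F.germ (F.jumpMap hΩ hμ s) x ∈ polyGerm d x :=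
  (F.exists_jumpData hΩ hμ s.2).choose_spec

theorem germ_zero (x : Plane) : F.germ (0 : F.JumpData d μ) x = 0 := by
  rw [← zero_smul ℝ (0 : F.JumpData d μ), germ_smul, zero_smul]

theorem jumpMap_surjective (hΩ : IsOpen Ω) (hsc : IsSimplyConnected Ω) (hμ : μ ≤ d) :
    Function.Surjective (F.jumpMap (Δ := Δ) hΩ hμ) := by
  intro j
  obtain ⟨s, hs, hsj⟩ := F.exists_spline hΩ hsc hμ j
  exact ⟨⟨s, hs⟩, F.jumpData_unique hμ (F.jumpMap_spec hΩ hμ ⟨s, hs⟩) hsj⟩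

/-- Without jumps a spline is polynomial near every point of Ω, and Ω is connected, so one
polynomial serves everywhere. -/
theorem ker_jumpMap (hΩ : IsOpen Ω) (hsc : IsSimplyConnected Ω) (hμ : μ ≤ d) :
    LinearMap.ker (F.jumpMap hΩ hμ) = LinearMap.range (polySpline Ω Δ.extGrid d μ) := by
  ext s
  rw [LinearMap.mem_ker, LinearMap.mem_range]
  constructor
  · intro hs
    have h := F.jumpMap_spec hΩ hμ s
    simp only [hs, germ_zero, sub_zero] at h
    obtain ⟨p, hp, hps⟩ := exists_poly_of_isPreconnected hΩ
      hsc.isPathConnected.isConnected.isPreconnected h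
    refine ⟨⟨p, hp⟩, ?_⟩
    ext x
    by_cases hx : x ∈ Ω
    · rw [polySpline_apply _ hx, hps x hx]
    · rw [s.2.1 x hx, (polySpline Ω Δ.extGrid d μ _).2.1 x hx]
  · rintro ⟨p, rfl⟩
    refine F.jumpData_unique hμ (F.jumpMap_spec hΩ hμ _) fun x hx => ?_
    rw [germ_zero, sub_zero]
    refine ⟨p, p.2, ?_⟩
    filter_upwards [hΩ.mem_nhds hx] with y hy using polySpline_apply p hy

theorem polySpline_injective (hΩ : IsOpen Ω) (hne : Ω.Nonempty) {Γ : Set Plane} :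
    Function.Injective (polySpline Ω Γ d μ) := by
  intro p q h
  apply Subtype.ext
  refine eq_of_eqOn_open hΩ hne fun x hx => ?_
  rw [← polySpline_apply (Γ := Γ) (μ := μ) p hx, h, polySpline_apply q hx]

instance (A : Plane) : FiniteDimensional ℝ (F.syzygies d μ A) := by
  unfold syzygies
  exact FiniteDimensional.finiteDimensional_submodule _

theorem finite_jumpData (F : CutFrame Δ) : FiniteDimensional ℝ (F.JumpData d μ) := by
  have : Finite Δ.vertices := Δ.vertices_finite
  have h1 : FiniteDimensional ℝ (Δ.crossCuts → polyLT (d - μ)) := inferInstance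
  have h2 : FiniteDimensional ℝ (∀ A : Δ.vertices, F.syzygies d μ A) := Module.Finite.pi
  exact Module.Finite.prod

theorem finite_extSplines (F : CutFrame Δ) (hΩ : IsOpen Ω) (hsc : IsSimplyConnected Ω)
    (hμ : μ ≤ d) : FiniteDimensional ℝ (Δ.extSplines d μ) := by
  have := F.finite_jumpData (d := d) (μ := μ)
  refine finite_of_surjective_of_range_eq_ker (W := F.JumpData d μ)
    (F.jumpMap hΩ hμ) (polySpline Ω Δ.extGrid d μ) (F.jumpMap_surjective hΩ hsc hμ)
    (F.ker_jumpMap hΩ hsc hμ)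

theorem card_through (A : Plane) :
    Fintype.card {C : Δ.crossCuts // A ∈ C.1} = Δ.cutsThrough A := by
  rw [← Nat.card_eq_fintype_card, PolygonalPartition.cutsThrough, ← Nat.card_coe_set_eq]
  exact Nat.card_congr (Equiv.subtypeSubtypeEquivSubtypeInter (· ∈ Δ.crossCuts) (A ∈ ·))

theorem injective_slope (A : Plane) :
    Function.Injective fun C : {C : Δ.crossCuts // A ∈ C.1} => F.a C.1 :=
  fun C C' h => Subtype.ext (F.eq_of_mem C.2 C'.2 h)

theorem finrank_syzygies (hμ : μ ≤ d) (A : Plane) :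
    (Module.finrank ℝ (F.syzygies d μ A) : ℤ) = vertexDim d μ (Δ.cutsThrough A) := by
  have h := finrank_ker_syzygyMap (A := A) (m := F.m)
    (a := fun C : {C : Δ.crossCuts // A ∈ C.1} => F.a C.1) (b := fun C => F.b C.1)
    (fun C => (F.subset C.1 C.2).1) (F.injective_slope A) hμ
  rw [← card_through]
  exact h

/-- The three terms count the global polynomials, the initial coefficients on the cross-cuts, and
the syzygies at the vertices. -/
theorem finrank_extSplines (F : CutFrame Δ) (hΩ : IsOpen Ω) (hsc : IsSimplyConnected Ω)
    (hμ : μ ≤ d) : (Module.finrank ℝ (Δ.extSplines d μ) : ℤ) =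
      ((d + 2).choose 2 : ℤ) + (Δ.crossCuts.ncard : ℤ) * ((d - μ + 1).choose 2 : ℤ) +
        ∑ A ∈ Δ.vertices_finite.toFinset, vertexDim d μ (Δ.cutsThrough A) := by
  have := F.finite_extSplines (d := d) (μ := μ) hΩ hsc hμ
  have : Fintype Δ.vertices := Δ.vertices_finite.fintype
  have hrank := finrank_of_surjective_of_range_eq_ker (W := F.JumpData d μ)
    (F.jumpMap hΩ hμ) (polySpline Ω Δ.extGrid d μ) (F.jumpMap_surjective hΩ hsc hμ)
    (polySpline_injective hΩ hsc.isPathConnected.nonempty) (F.ker_jumpMap hΩ hsc hμ)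
  rw [finrank_polyLT] at hrank
  have hfree : ∀ A : Δ.vertices, Module.Free ℝ (F.syzygies d μ A) :=
    fun A => by exact Module.Free.of_divisionRing ℝ (F.syzygies d μ A)
  have hJ : Module.finrank ℝ (F.JumpData d μ) = Δ.crossCuts.ncard * (d - μ + 1).choose 2 +
      ∑ A : Δ.vertices, Module.finrank ℝ (F.syzygies d μ A) := by
    rw [Module.finrank_prod, Module.finrank_pi_fintype, Module.finrank_pi_fintype]
    simp only [finrank_polyLT, Finset.sum_const, Finset.card_univ, smul_eq_mul]
    rw [← Nat.card_eq_fintype_card, Nat.card_coe_set_eq]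
  rw [hrank, hJ]
  push_cast
  simp only [F.finrank_syzygies hμ]
  rw [Finset.sum_subtype (p := (· ∈ Δ.vertices)) Δ.vertices_finite.toFinset (fun A => by simp)
    (fun A => vertexDim d μ (Δ.cutsThrough A))]
  ring

end CutFrame

/-! ### Derivatives along a line determine a polynomial -/

theorem pderiv_mem_polyLT {k : ℕ} {p : MvPolynomial (Fin 2) ℝ} (hp : p ∈ polyLT k) (i : Fin 2) :
    pderiv i p ∈ polyLT k := by
  rw [p.as_sum, map_sum]
  refine Submodule.sum_mem _ fun n hn => ?_
  rw [pderiv_monomial]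
  have hn : n.degree < k := hp hn
  refine mem_polyLT.2 (or_iff_not_imp_left.2 fun h0 => ?_)
  refine (totalDegree_monomial_le _ _).trans_lt (lt_of_le_of_lt ?_ hn)
  exact Finsupp.degree_mono tsub_le_self

theorem dirDeriv_mem_polyLT {k : ℕ} {p : MvPolynomial (Fin 2) ℝ} (hp : p ∈ polyLT k) (n : Plane) :
    dirDeriv n p ∈ polyLT k := by
  refine Submodule.sum_mem _ fun i _ => ?_
  rw [← smul_eq_C_mul]
  exact Submodule.smul_mem _ _ (pderiv_mem_polyLT hp i)

theorem dirDeriv_iterate_mem_polyLT {k : ℕ} {p : MvPolynomial (Fin 2) ℝ} (hp : p ∈ polyLT k)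
    (n : Plane) (r : ℕ) : (dirDeriv n)^[r] p ∈ polyLT k := by
  induction r with
  | zero => exact hp
  | succ r ih =>
    rw [Function.iterate_succ_apply']
    exact dirDeriv_mem_polyLT ih n

theorem natDegree_restrictLine_le {d : ℕ} {p : MvPolynomial (Fin 2) ℝ} (hp : p ∈ polyLT (d + 1))
    (a v : Plane) : (restrictLine a v p).natDegree ≤ d := by
  have hd : p.totalDegree ≤ d := by
    rcases mem_polyLT.1 hp with rfl | h
    · simp
    · omega
  have h := aeval_natDegree_le (n := 1) p hd
    (fun i => Polynomial.C (a i) + Polynomial.X * Polynomial.C (v i)) fun i => by compute_degree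
  rwa [mul_one] at h

theorem bivariate_ext {P Q : Polynomial (Polynomial ℝ)}
    (h : ∀ t u : ℝ, (P.map (Polynomial.evalRingHom t)).eval u =
      (Q.map (Polynomial.evalRingHom t)).eval u) : P = Q := by
  ext1 r
  refine Polynomial.funext fun t => ?_
  have ht := congrArg (Polynomial.coeff · r) (Polynomial.funext (h t))
  simpa only [Polynomial.coeff_map, Polynomial.coe_evalRingHom] using ht

/-- Orthonormality of the columns of an orthogonal matrix. -/
theorem orthonormal_columns {v n : Plane} (hv : ‖v‖ = 1) (hn : ‖n‖ = 1) (ho : inner ℝ v n = 0) :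
    v 0 * v 0 + n 0 * n 0 = 1 ∧ v 0 * v 1 + n 0 * n 1 = 0 ∧ v 1 * v 1 + n 1 * n 1 = 1 := by
  have h1 := EuclideanSpace.real_norm_sq_eq v
  have h2 := EuclideanSpace.real_norm_sq_eq n
  rw [hv, Fin.sum_univ_two] at h1
  rw [hn, Fin.sum_univ_two] at h2
  rw [PiLp.inner_apply, Fin.sum_univ_two] at ho
  simp only [RCLike.inner_apply, conj_trivial] at ho
  have h : !![v 0, v 1; n 0, n 1] * !![v 0, n 0; v 1, n 1] = (1 : Matrix (Fin 2) (Fin 2) ℝ) := by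
    ext i j
    fin_cases i <;> fin_cases j <;> simp [Matrix.mul_apply, Fin.sum_univ_two] <;> nlinarith
  have h' := mul_eq_one_comm.1 h
  have h00 := congrFun (congrFun h' 0) 0
  have h01 := congrFun (congrFun h' 0) 1
  have h11 := congrFun (congrFun h' 1) 1
  simp [Matrix.mul_apply, Fin.sum_univ_two] at h00 h01 h11
  exact ⟨h00, h01, h11⟩

theorem affineHom_injective (a : Plane) {v n : Plane} (hv : ‖v‖ = 1) (hn : ‖n‖ = 1)
    (ho : inner ℝ v n = 0) {p : MvPolynomial (Fin 2) ℝ} (h : affineHom a v n p = 0) : p = 0 := by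
  obtain ⟨h1, h2, h3⟩ := orthonormal_columns hv hn ho
  refine eq_zero_of_eventually (z := a) (Filter.Eventually.of_forall fun y => ?_)
  have h4 := eval_affineHom a v n p ((y 0 - a 0) * v 0 + (y 1 - a 1) * v 1)
    ((y 0 - a 0) * n 0 + (y 1 - a 1) * n 1)
  rw [h, Polynomial.map_zero, Polynomial.eval_zero] at h4
  rw [h4]
  congr 1
  ext i
  fin_cases i
  · simp
    linear_combination (-(y 0 - a 0)) * h1 - (y 1 - a 1) * h2
  · simp
    linear_combination (-(y 0 - a 0)) * h2 - (y 1 - a 1) * h3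

/-- Fixing t turns the image of p into its restriction to a line in direction n, whose degree is at
most d. -/
theorem affineHom_coeff_eq_zero {d : ℕ} {p : MvPolynomial (Fin 2) ℝ} (hp : p ∈ polyLT (d + 1))
    (a v n : Plane) {r : ℕ} (hr : d < r) : (affineHom a v n p).coeff r = 0 := by
  refine Polynomial.funext fun t => ?_
  have h : (affineHom a v n p).map (Polynomial.evalRingHom t) = restrictLine (a + t • v) n p :=
    Polynomial.funext fun u => by rw [eval_affineHom, eval_restrictLine]
  have h1 := congrArg (Polynomial.coeff · r) h
  simp only [Polynomial.coeff_map, Polynomial.coe_evalRingHom] at h1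
  rw [h1, Polynomial.eval_zero]
  exact Polynomial.coeff_eq_zero_of_natDegree_lt ((natDegree_restrictLine_le hp _ _).trans_lt hr)

/-- A polynomial vanishing to order `μ` along a line is zero once the higher normal derivatives
vanish on the line. -/
theorem eq_zero_of_restrictLine {d μ : ℕ} {a v n : Plane} (hv : ‖v‖ = 1) (hn : ‖n‖ = 1)
    (ho : inner ℝ v n = 0) {p : MvPolynomial (Fin 2) ℝ} (hp : p ∈ polyLT (d + 1))
    (hdvd : Polynomial.X ^ (μ + 1) ∣ affineHom a v n p)
    (h : ∀ r, μ + 1 + r ≤ d → ∀ j ≤ d,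
      (restrictLine a v ((dirDeriv n)^[μ + 1 + r] p)).coeff j = 0) : p = 0 := by
  refine affineHom_injective a hv hn ho ?_
  ext1 r
  rw [Polynomial.coeff_zero]
  rcases lt_or_ge r (μ + 1) with h1 | h1
  · exact Polynomial.X_pow_dvd_iff.1 hdvd r h1
  rcases lt_or_ge d r with h2 | h2
  · exact affineHom_coeff_eq_zero hp a v n h2
  obtain ⟨r, rfl⟩ := Nat.exists_eq_add_of_le h1
  have h3 : restrictLine a v ((dirDeriv n)^[μ + 1 + r] p) = 0 := by
    ext j
    rw [Polynomial.coeff_zero]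
    rcases le_or_gt j d with h3 | h3
    · exact h r h2 j h3
    · exact Polynomial.coeff_eq_zero_of_natDegree_lt ((natDegree_restrictLine_le
        (dirDeriv_iterate_mem_polyLT hp n _) _ _).trans_lt h3)
  rw [restrictLine_dirDeriv_iterate] at h3
  exact (smul_eq_zero.1 h3).resolve_left (Nat.factorial_ne_zero _)

theorem X_dvd_affineHom_linePoly {m a b : ℝ} {x v n : Plane}
    (hx : evalAt (linePoly m a b) x = 0) (hv : v 1 - a * abscissa m v = 0) :
    Polynomial.X ∣ affineHom x v n (linePoly m a b) := by
  have h : affineHom x v n (linePoly m a b) =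
      Polynomial.X * Polynomial.C (Polynomial.C (n 1 - a * abscissa m n)) := by
    refine bivariate_ext fun t u => ?_
    rw [eval_affineHom, linePoly_add_smul, linePoly_add_smul, hx, hv]
    simp
  exact ⟨_, h⟩

/-! ### Extended edges and their adjacent cells -/

theorem cells_eq_of_mem {Γ φ ψ : Set Plane} (hφ : φ ∈ cells Ω Γ) (hψ : ψ ∈ cells Ω Γ) {y : Plane}
    (h : y ∈ φ) (h' : y ∈ ψ) : φ = ψ := by
  obtain ⟨x, -, rfl⟩ := hφ
  obtain ⟨z, -, rfl⟩ := hψ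
  exact (connectedComponentIn_eq h).trans (connectedComponentIn_eq h').symm

namespace CutFrame

variable (F : CutFrame Δ)

theorem eventually_mem_iff_eq (hΩ : IsOpen Ω) {C : Δ.crossCuts} {x : Plane} (hx : x ∈ C.1)
    (hv : x ∉ Δ.vertices) : ∀ᶠ y in 𝓝 x, ∀ C' : Δ.crossCuts,
      y ∈ C'.1 ↔ C' = C ∧ evalAt (linePoly F.m (F.a C) (F.b C)) y = 0 := by
  filter_upwards [F.eventually_mem_iff hΩ (F.subset C hx).2] with y hy C'
  have h : x ∈ C'.1 ↔ C' = C := by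
    rw [← mem_through, through_eq_singleton hv hx, Finset.mem_singleton]
  rw [hy C', h]
  refine and_congr_right fun h' => ?_
  rw [h']

theorem eventually_notMem_extGrid (hΩ : IsOpen Ω) {C : Δ.crossCuts} {x : Plane} (hx : x ∈ C.1)
    (hv : x ∉ Δ.vertices) : ∀ᶠ y in 𝓝 x,
      evalAt (linePoly F.m (F.a C) (F.b C)) y ≠ 0 → y ∈ Ω \ Δ.extGrid := by
  filter_upwards [F.eventually_mem_iff_eq hΩ hx hv, hΩ.mem_nhds (F.subset C hx).2] with y hy hyΩ h0
  refine ⟨hyΩ, ?_⟩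
  rintro ⟨C', hC', hyC'⟩
  exact h0 ((hy ⟨C', hC'⟩).1 hyC').2

/-- An extended edge lies on a single cross-cut, of which it is a relatively open part. -/
theorem extendedEdge_spec (hΩ : IsOpen Ω) {l : Set Plane} (hl : l ∈ Δ.extendedEdges) :
    ∃ C : Δ.crossCuts, l.Nonempty ∧ IsPreconnected l ∧
      (∀ x ∈ l, x ∈ C.1 ∧ x ∉ Δ.vertices ∧ x ∉ Δ.grid) ∧
      ∀ x ∈ l, ∀ᶠ y in 𝓝 x, evalAt (linePoly F.m (F.a C) (F.b C)) y = 0 → y ∈ l := by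
  obtain ⟨C, hC, x, hx, rfl⟩ := hl
  set T := C \ (Δ.grid ∪ ⋃₀ (Δ.crossCuts \ {C})) with hT
  have hspec : ∀ y ∈ T, y ∈ C ∧ y ∉ Δ.vertices ∧ y ∉ Δ.grid := by
    rintro y ⟨hyC, hy⟩
    refine ⟨hyC, ?_, fun h => hy (Or.inl h)⟩
    rintro ⟨C₁, h₁, C₂, h₂, hne, hy₁, hy₂⟩
    by_cases h : C₁ = C
    · exact hy (Or.inr ⟨C₂, ⟨h₂, fun h' => hne (h.trans h'.symm)⟩, hy₂⟩)
    · exact hy (Or.inr ⟨C₁, ⟨h₁, h⟩, hy₁⟩)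
  refine ⟨⟨C, hC⟩, ⟨x, mem_connectedComponentIn hx⟩, isPreconnected_connectedComponentIn,
    fun y hy => hspec y (connectedComponentIn_subset _ _ hy), fun y hy => ?_⟩
  have hyT := connectedComponentIn_subset _ _ hy
  obtain ⟨hyC, hyv, hyg⟩ := hspec y hyT
  obtain ⟨r, hr, hB⟩ := Metric.eventually_nhds_iff_ball.1
    ((F.eventually_mem_iff_eq (C := ⟨C, hC⟩) hΩ hyC hyv).and
      ((isClosed_grid Δ).isOpen_compl.eventually_mem hyg))
  filter_upwards [Metric.ball_mem_nhds y hr] with z hz hz0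
  rw [connectedComponentIn_eq hy]
  refine ((convex_linePoly_zero F.m (F.a ⟨C, hC⟩) (F.b ⟨C, hC⟩)).inter
    (convex_ball y r)).isPreconnected.subset_connectedComponentIn
    ⟨(F.subset ⟨C, hC⟩ hyC).1, Metric.mem_ball_self hr⟩ ?_ ⟨hz0, hz⟩
  rintro w ⟨hw0, hw⟩
  obtain ⟨h1, h2⟩ := hB w hw
  refine ⟨(h1 ⟨C, hC⟩).2 ⟨rfl, hw0⟩, ?_⟩
  rintro (h | ⟨C', ⟨hC', hne⟩, hwC'⟩)
  · exact h2 h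
  · exact hne (congrArg Subtype.val ((h1 ⟨C', hC'⟩).1 hwC').1)

/-- A single cell is adjacent to an extended edge on each side. -/
theorem exists_adjacent_cell (hΩ : IsOpen Ω) {C : Δ.crossCuts} {l : Set Plane}
    (hne : l.Nonempty) (hc : IsPreconnected l) (hl : ∀ x ∈ l, x ∈ C.1 ∧ x ∉ Δ.vertices)
    {H : Set Plane} (hH : Convex ℝ H)
    (hH0 : ∀ y ∈ H, evalAt (linePoly F.m (F.a C) (F.b C)) y ≠ 0)
    (hf : ∀ x ∈ l, ∃ᶠ y in 𝓝 x, y ∈ H) :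
    ∃ φ ∈ cells Ω Δ.extGrid, ∀ x ∈ l, ∀ᶠ y in 𝓝 x, y ∈ H → y ∈ φ := by
  -- The intersection of `H` with a small disc is convex and avoids the grid, so it lies in a single
  -- cell. Cells found at neighbouring points of l share points of `H` and hence coincide.
  have hloc : ∀ x ∈ l, ∃ φ ∈ cells Ω Δ.extGrid, ∀ᶠ y in 𝓝 x, y ∈ H → y ∈ φ := by
    intro x hx
    obtain ⟨r, hr, hB⟩ := Metric.eventually_nhds_iff_ball.1
      (F.eventually_notMem_extGrid hΩ (hl x hx).1 (hl x hx).2)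
    obtain ⟨y, hyH, hy⟩ := ((hf x hx).and_eventually (Metric.ball_mem_nhds x hr)).exists
    have hsub : H ∩ Metric.ball x r ⊆ Ω \ Δ.extGrid := fun z hz => hB z hz.2 (hH0 z hz.1)
    refine ⟨_, ⟨y, hsub ⟨hyH, hy⟩, rfl⟩, ?_⟩
    filter_upwards [Metric.ball_mem_nhds x hr] with z hz hzH
    exact (hH.inter (convex_ball x r)).isPreconnected.subset_connectedComponentIn ⟨hyH, hy⟩ hsub
      ⟨hzH, hz⟩
  choose! φ hφ hφH using hloc
  obtain ⟨x₀, hx₀⟩ := hne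
  refine ⟨φ x₀, hφ x₀ hx₀, fun x hx => ?_⟩
  have : φ x₀ = φ x := by
    refine hc.induction₂' (fun y z => φ y = φ z) ?_ (fun _ _ _ _ _ _ => Eq.trans) hx₀ hx
    intro y hy
    filter_upwards [nhdsWithin_le_nhds (hφH y hy).eventually_nhds, self_mem_nhdsWithin]
      with z hz hzl
    obtain ⟨w, hw, hw1, hw2⟩ := ((hf z hzl).and_eventually (hz.and (hφH z hzl))).exists
    have := cells_eq_of_mem (hφ y hy) (hφ z hzl) (hw1 hw) (hw2 hw)
    exact ⟨this, this.symm⟩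
  rw [this]
  exact hφH x hx

theorem tendsto_add_smul (x v : Plane) :
    Filter.Tendsto (fun t : ℝ => x + t • v) (𝓝[>] 0) (𝓝 x) := by
  have hc : Continuous fun t : ℝ => x + t • v := by fun_prop
  have h := hc.tendsto 0
  rw [zero_smul, add_zero] at h
  exact h.mono_left nhdsWithin_le_nhds

theorem nonempty_edgeFrame (F : CutFrame Δ) (hΩ : IsOpen Ω) {l : Set Plane}
    (hl : l ∈ Δ.extendedEdges) : Nonempty (Δ.EdgeFrame l) := by
  obtain ⟨C, hne, hc, hlC, -⟩ := F.extendedEdge_spec hΩ hl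
  have h0 : ∀ x ∈ l, evalAt (linePoly F.m (F.a C) (F.b C)) x = 0 :=
    fun x hx => (F.subset C (hlC x hx).1).1
  have hlC' : ∀ x ∈ l, x ∈ C.1 ∧ x ∉ Δ.vertices := fun x hx => ⟨(hlC x hx).1, (hlC x hx).2.1⟩
  obtain ⟨φ, hφ, hφH⟩ := F.exists_adjacent_cell hΩ hne hc hlC'
    (convex_linePoly_pos F.m (F.a C) (F.b C)) (fun y hy => ne_of_gt hy)
    fun x hx => frequently_linePoly_pos (h0 x hx)
  obtain ⟨ψ, hψ, hψH⟩ := F.exists_adjacent_cell hΩ hne hc hlC'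
    (convex_linePoly_neg F.m (F.a C) (F.b C)) (fun y hy => ne_of_lt hy)
    fun x hx => frequently_linePoly_neg (h0 x hx)
  obtain ⟨x₀, hx₀⟩ := hne
  set w : Plane := shearPoint F.m 1 (F.a C) with hw
  set g : Plane := !₂[-w 1, w 0] with hg
  have hg0 : g 0 = -w 1 := rfl
  have hg1 : g 1 = w 0 := rfl
  have hwa : abscissa F.m w = 1 := abscissa_shearPoint _ _ _
  have hw1 : w 1 = F.a C := rfl
  have hw0 : w 0 = 1 - F.m * F.a C := rfl
  have hwne : w ≠ 0 := by
    intro h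
    rw [h] at hwa
    simp [abscissa] at hwa
  have hwpos : 0 < ‖w‖ := norm_pos_iff.2 hwne
  have hgw : ‖g‖ = ‖w‖ := by
    rw [EuclideanSpace.norm_eq, EuclideanSpace.norm_eq, Fin.sum_univ_two, Fin.sum_univ_two, hg0,
      hg1, norm_neg, add_comm]
  -- With w = (1 - ma, a) along the line and g its quarter turn, the linear part of ℓ takes the
  -- value |w|² on g, so the normal g/|w| points to the side where ℓ is positive.
  have hslope : 0 < (‖w‖⁻¹ • g) 1 - F.a C * abscissa F.m (‖w‖⁻¹ • g) := by
    have h1 : (‖w‖⁻¹ • g) 1 - F.a C * abscissa F.m (‖w‖⁻¹ • g) =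
        ‖w‖⁻¹ * (w 0 ^ 2 + w 1 ^ 2) := by
      simp only [abscissa, PiLp.smul_apply, smul_eq_mul, hg0, hg1, hw0, hw1]
      ring
    have h2 := EuclideanSpace.real_norm_sq_eq w
    rw [Fin.sum_univ_two] at h2
    rw [h1, ← h2]
    positivity
  refine ⟨⟨x₀, ‖w‖⁻¹ • w, ‖w‖⁻¹ • g, φ, ψ, hx₀, ?_, fun x hx => ?_, ?_, ?_, hφ, hψ,
    fun x hx => ?_, fun x hx => ?_⟩⟩
  · rw [norm_smul, norm_inv, norm_norm, inv_mul_cancel₀ hwpos.ne']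
  -- The vector w has abscissa 1, so abscissa differences are coordinates along w. The factor ‖w‖
  -- accounts for the normalization.
  · refine ⟨(abscissa F.m x - abscissa F.m x₀) * ‖w‖, ?_⟩
    have key : ∀ y ∈ l, y = shearPoint F.m 0 (F.b C) + abscissa F.m y • w := by
      intro y hy
      have h1 := shearPoint_decomp F.m (F.a C) (F.b C) (abscissa F.m y) 0
      have h2 := h0 y hy
      rw [evalAt_linePoly] at h2
      have h3 : F.a C * abscissa F.m y + F.b C + 0 = y 1 := by linarith
      rw [h3, shearPoint_eta, zero_smul, add_zero] at h1
      exact h1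
    rw [smul_smul, mul_assoc, mul_inv_cancel₀ hwpos.ne', mul_one, sub_smul]
    nth_rewrite 1 [key x hx]
    nth_rewrite 1 [key x₀ hx₀]
    abel
  · rw [norm_smul, norm_inv, norm_norm, hgw, inv_mul_cancel₀ hwpos.ne']
  · rw [inner_smul_left, inner_smul_right, PiLp.inner_apply, Fin.sum_univ_two, hg0, hg1]
    simp only [RCLike.inner_apply, conj_trivial]
    ring
  · filter_upwards [(tendsto_add_smul x _).eventually (hφH x hx), self_mem_nhdsWithin] with t ht h
    refine ht ?_
    rw [linePoly_add_smul, h0 x hx, zero_add]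
    exact mul_pos h hslope
  · have := (tendsto_add_smul x (-(‖w‖⁻¹ • g))).eventually (hψH x hx)
    filter_upwards [this, self_mem_nhdsWithin] with t ht h
    rw [smul_neg, ← sub_eq_add_neg] at ht
    refine ht ?_
    rw [sub_eq_add_neg, ← neg_smul, linePoly_add_smul, h0 x hx, zero_add]
    exact mul_neg_of_neg_of_pos (neg_neg_of_pos h) hslope

end CutFrame

variable {d μ : ℕ}

/-! ### The extended edge elimination conditions -/

theorem cellPoly_spec {Γ : Set Plane} {s : Plane → ℝ} (hs : s ∈ splineSpace Ω Γ d μ)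
    {φ : Set Plane} (hφ : φ ∈ cells Ω Γ) :
    cellPoly d s φ ∈ polyLT (d + 1) ∧ ∀ x ∈ φ, s x = evalAt (cellPoly d s φ) x := by
  have h := hs.2.2 φ hφ
  rw [cellPoly, dif_pos h, ← restrictTotalDegree_eq_polyLT]
  exact h.choose_spec

theorem cellPoly_eq {Γ : Set Plane} (hΓ : IsOpen (Ω \ Γ)) {s : Plane → ℝ}
    (hs : s ∈ splineSpace Ω Γ d μ) {φ : Set Plane} (hφ : φ ∈ cells Ω Γ)
    {p : MvPolynomial (Fin 2) ℝ} (h : ∀ x ∈ φ, s x = evalAt p x) : cellPoly d s φ = p :=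
  eq_of_eqOn_open (isOpen_of_mem_cells hΓ hφ) (nonempty_of_mem_cells hφ) fun y hy =>
    ((cellPoly_spec hs hφ).2 y hy).symm.trans (h y hy)

/-- It suffices to compare polynomials near one point of φ ∩ U close to z. This identifies the piece
on an adjacent cell from the local form of the spline at the edge. -/
theorem cellPoly_eq_of_frequently {Γ : Set Plane} (hΓ : IsOpen (Ω \ Γ)) {s : Plane → ℝ}
    (hs : s ∈ splineSpace Ω Γ d μ) {φ : Set Plane} (hφ : φ ∈ cells Ω Γ)
    {p : MvPolynomial (Fin 2) ℝ} {U : Set Plane} (hU : IsOpen U) {z : Plane}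
    (hf : ∃ᶠ y in 𝓝 z, y ∈ φ ∧ y ∈ U) (h : ∀ᶠ y in 𝓝 z, y ∈ U → s y = evalAt p y) :
    cellPoly d s φ = p := by
  obtain ⟨y, ⟨hyφ, hyU⟩, hy⟩ := (hf.and_eventually h.eventually_nhds).exists
  refine eq_of_eventuallyEq (z := y) ?_
  filter_upwards [hy, hU.mem_nhds hyU, (isOpen_of_mem_cells hΓ hφ).mem_nhds hyφ] with w h1 h2 h3
  rw [← h1 h2, (cellPoly_spec hs hφ).2 w h3]

/-- The polynomial on a cell, as a linear function of the spline. -/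
def cellPolyHom {Γ : Set Plane} (hΓ : IsOpen (Ω \ Γ)) (d μ : ℕ) {φ : Set Plane}
    (hφ : φ ∈ cells Ω Γ) : splineSpace Ω Γ d μ →ₗ[ℝ] MvPolynomial (Fin 2) ℝ where
  toFun s := cellPoly d s φ
  map_add' s t := cellPoly_eq hΓ (s + t).2 hφ fun x hx => by
    rw [evalAt_add, ← (cellPoly_spec s.2 hφ).2 x hx, ← (cellPoly_spec t.2 hφ).2 x hx]
    rfl
  map_smul' c s := cellPoly_eq hΓ (c • s).2 hφ fun x hx => by
    rw [RingHom.id_apply, evalAt_smul, ← (cellPoly_spec s.2 hφ).2 x hx]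
    rfl

/-- The directional derivative as a linear map. -/
def dirDerivHom (v : Plane) : MvPolynomial (Fin 2) ℝ →ₗ[ℝ] MvPolynomial (Fin 2) ℝ where
  toFun := dirDeriv v
  map_add' := dirDeriv_add v
  map_smul' := dirDeriv_smul v

/-- The restriction to a line as a linear map. -/
def restrictLineHom (a u : Plane) : MvPolynomial (Fin 2) ℝ →ₗ[ℝ] Polynomial ℝ :=
  (aeval fun i => Polynomial.C (a i) + Polynomial.X * Polynomial.C (u i)).toLinearMap

/-- The left hand side of one extended edge elimination condition. -/
def eeeRow (hΓ : IsOpen (Ω \ Δ.extGrid)) (d μ : ℕ) {l : Set Plane} (E : Δ.EdgeFrame l)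
    (r j : ℕ) : Δ.extSplines d μ →ₗ[ℝ] ℝ :=
  Polynomial.lcoeff ℝ j ∘ₗ restrictLineHom E.base E.dir ∘ₗ (dirDerivHom E.normal ^ r) ∘ₗ
    (cellPolyHom hΓ d μ E.pos_mem - cellPolyHom hΓ d μ E.neg_mem)

theorem eeeRow_apply (hΓ : IsOpen (Ω \ Δ.extGrid)) {l : Set Plane} (E : Δ.EdgeFrame l)
    (r j : ℕ) (s : Δ.extSplines d μ) : eeeRow hΓ d μ E r j s =
      (restrictLine E.base E.dir ((dirDeriv E.normal)^[r]
        (cellPoly d s E.pos - cellPoly d s E.neg))).coeff j := by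
  simp only [eeeRow, LinearMap.comp_apply, Module.End.pow_apply]
  rfl

/-- All the left hand sides together. -/
def eeeHom (hΓ : IsOpen (Ω \ Δ.extGrid)) (d μ : ℕ) (F : ∀ l : Δ.extendedEdges, Δ.EdgeFrame l) :
    Δ.extSplines d μ →ₗ[ℝ] (Δ.extendedEdges × Fin (d - μ) × Fin (d + 1) → ℝ) :=
  LinearMap.pi fun q => eeeRow hΓ d μ (F q.1) (μ + 1 + q.2.1) q.2.2

/-- The matrix represents the basis-free map `eeeHom` in the coordinates of the chosen basis, and a
change of coordinates in the source does not alter the range. -/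
theorem rank_eeeMatrix (hΓ : IsOpen (Ω \ Δ.extGrid)) {n : ℕ}
    (N : Module.Basis (Fin n) ℝ (Δ.extSplines d μ)) (F : ∀ l : Δ.extendedEdges, Δ.EdgeFrame l) :
    (eeeMatrix Δ d μ N F).rank = Module.finrank ℝ (LinearMap.range (eeeHom hΓ d μ F)) := by
  have h : (eeeMatrix Δ d μ N F).mulVecLin =
      eeeHom hΓ d μ F ∘ₗ N.equivFun.symm.toLinearMap := by
    refine LinearMap.pi_ext' fun i => LinearMap.ext_ring ?_
    ext q
    have h1 : N.equivFun.symm (Pi.single i 1) = N i := by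
      rw [N.equivFun_symm_apply]
      simp [Pi.single_apply]
    simp only [LinearMap.comp_apply, LinearMap.single_apply, Matrix.mulVecLin_apply,
      Matrix.mulVec_single_one, LinearEquiv.coe_coe, h1]
    exact (eeeRow_apply hΓ (F q.1) _ _ (N i)).symm
  rw [Matrix.rank, h, LinearMap.range_comp_of_range_eq_top _ N.equivFun.symm.range]

namespace CutFrame

variable (F : CutFrame Δ)

theorem frequently_pos {l : Set Plane} (E : Δ.EdgeFrame l) {z : Plane} (hz : z ∈ l) {P : Plane → Prop}
    (hP : ∀ t : ℝ, 0 < t → P (z + t • E.normal)) : ∃ᶠ y in 𝓝 z, y ∈ E.pos ∧ P y := by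
  refine (tendsto_add_smul z E.normal).frequently (Filter.Eventually.frequently ?_)
  filter_upwards [E.pos_side z hz, self_mem_nhdsWithin] with t h1 h2 using ⟨h1, hP t h2⟩

theorem frequently_neg {l : Set Plane} (E : Δ.EdgeFrame l) {z : Plane} (hz : z ∈ l) {P : Plane → Prop}
    (hP : ∀ t : ℝ, 0 < t → P (z + t • -E.normal)) : ∃ᶠ y in 𝓝 z, y ∈ E.neg ∧ P y := by
  refine (tendsto_add_smul z (-E.normal)).frequently (Filter.Eventually.frequently ?_)
  filter_upwards [E.neg_side z hz, self_mem_nhdsWithin] with t h1 h2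
  refine ⟨?_, hP t h2⟩
  rwa [smul_neg, ← sub_eq_add_neg]

/-- An extended edge is relatively open in its line, so it contains a second point base + t dir with
t ≠ 0, and the linear part of ℓ vanishes on t dir. -/
theorem slope_dir {l : Set Plane} (E : Δ.EdgeFrame l) {m a b : ℝ}
    (h0 : ∀ x ∈ l, evalAt (linePoly m a b) x = 0)
    (hl : ∀ x ∈ l, ∀ᶠ y in 𝓝 x, evalAt (linePoly m a b) y = 0 → y ∈ l) :
    E.dir 1 - a * abscissa m E.dir = 0 := by
  have hx0 := h0 _ E.base_mem
  obtain ⟨y, ⟨hy0, hy⟩, hyl⟩ :=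
    ((frequently_right_of_linePoly hx0).and_eventually (hl _ E.base_mem)).exists
  obtain ⟨t, rfl⟩ := E.on_line y (hyl hy0)
  rw [linePoly_add_smul, hx0, zero_add] at hy0
  refine (mul_eq_zero.1 hy0).resolve_left ?_
  rintro rfl
  simp at hy

/-- The linear part of ℓ has coefficients (-a, 1 - am), which are not both zero, so it cannot vanish
on both vectors of an orthonormal basis. -/
theorem slope_normal_ne {v n : Plane} (hv : ‖v‖ = 1) (hn : ‖n‖ = 1) (ho : inner ℝ v n = 0)
    {m a : ℝ} (hv0 : v 1 - a * abscissa m v = 0) : n 1 - a * abscissa m n ≠ 0 := by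
  intro hn0
  obtain ⟨h1, h2, h3⟩ := orthonormal_columns hv hn ho
  rw [abscissa] at hv0 hn0
  have ha : a = 0 := by
    linear_combination (-a) * h1 + (1 - a * m) * h2 - v 0 * hv0 - n 0 * hn0
  subst ha
  have h4 : v 1 = 0 := by linarith
  have h5 : n 1 = 0 := by linarith
  rw [h4, h5] at h3
  norm_num at h3

/-- Across an extended edge a spline jumps by a multiple of a power of the linear form. -/
theorem exists_edge_jump (F : CutFrame Δ) (hΩ : IsOpen Ω) (hμ : μ ≤ d) {l : Set Plane}
    (hl : l ∈ Δ.extendedEdges) (E : Δ.EdgeFrame l) {s : Plane → ℝ} (hs : s ∈ Δ.extSplines d μ) :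
    ∃ C : Δ.crossCuts, ∃ q ∈ polyLT (d - μ), l ⊆ C.1 ∧
      (∀ z ∈ l, s - cut F.m (F.a C) (F.b C) μ q ∈ polyGerm d z) ∧
      (cellPoly d s E.pos - cellPoly d s E.neg = linePoly F.m (F.a C) (F.b C) ^ (μ + 1) * q ∨
        cellPoly d s E.neg - cellPoly d s E.pos = linePoly F.m (F.a C) (F.b C) ^ (μ + 1) * q) ∧
      E.dir 1 - F.a C * abscissa F.m E.dir = 0 := by
  obtain ⟨C, -, hc, hlC, hloc⟩ := F.extendedEdge_spec hΩ hl
  have h0 : ∀ x ∈ l, evalAt (linePoly F.m (F.a C) (F.b C)) x = 0 :=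
    fun x hx => (F.subset C (hlC x hx).1).1
  have hΓ := F.isOpen_diff_extGrid hΩ
  obtain ⟨-, hcd, hoff⟩ := (mem_splineSpace_iff hΓ).1 hs
  obtain ⟨q, hq, hqs⟩ := exists_const_jump (s := s) (d := d) (μ := μ) hc h0 fun z hz => by
    refine exists_jump hμ (h0 z hz)
      (hcd.contDiffAt (hΩ.mem_nhds (F.subset C (hlC z hz).1).2)) ?_
    filter_upwards [F.eventually_notMem_extGrid hΩ (hlC z hz).1 (hlC z hz).2.1] with y hy hy0
    exact hoff y (hy hy0)
  have hdir := slope_dir E h0 hloc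
  have hnormal := slope_normal_ne E.norm_dir E.norm_normal E.orthogonal hdir
  refine ⟨C, q, hq, fun x hx => (hlC x hx).1, hqs, ?_, hdir⟩
  obtain ⟨p, -, hp⟩ := hqs _ E.base_mem
  set ℓ := linePoly F.m (F.a C) (F.b C) with hℓ
  have hP : ∀ᶠ y in 𝓝 E.base, y ∈ {y | 0 < evalAt ℓ y} →
      s y = evalAt (p + ℓ ^ (μ + 1) * q) y := by
    filter_upwards [hp] with y hy hpos
    rw [evalAt_add, ← hy, Pi.sub_apply, cut_of_pos hpos, sub_add_cancel]
  have hN : ∀ᶠ y in 𝓝 E.base, y ∈ {y | evalAt ℓ y < 0} → s y = evalAt p y := by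
    filter_upwards [hp] with y hy hneg
    rw [← hy, Pi.sub_apply, cut_of_not_pos (not_lt.2 (le_of_lt hneg)), sub_zero]
  have hb := h0 _ E.base_mem
  have hnegslope : (-E.normal) 1 - F.a C * abscissa F.m (-E.normal) =
      -(E.normal 1 - F.a C * abscissa F.m E.normal) := by
    simp [abscissa]; ring
  -- The frame may orient its normal to either side of the line, which exchanges the two cells and
  -- the sign of the jump.
  rcases hnormal.lt_or_gt with h | h
  · right
    rw [cellPoly_eq_of_frequently hΓ hs E.neg_mem (isOpen_linePoly_pos _ _ _)
      (frequently_neg E E.base_mem fun t ht => ?_) hP,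
      cellPoly_eq_of_frequently hΓ hs E.pos_mem (isOpen_linePoly_neg _ _ _)
      (frequently_pos E E.base_mem fun t ht => ?_) hN, add_sub_cancel_left]
    · change evalAt (linePoly _ _ _) _ < 0
      rw [linePoly_add_smul, hb, zero_add]
      exact mul_neg_of_pos_of_neg ht h
    · change 0 < evalAt (linePoly _ _ _) _
      rw [linePoly_add_smul, hb, zero_add, hnegslope]
      exact mul_pos ht (neg_pos.2 h)
  · left
    rw [cellPoly_eq_of_frequently hΓ hs E.pos_mem (isOpen_linePoly_pos _ _ _)
      (frequently_pos E E.base_mem fun t ht => ?_) hP,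
      cellPoly_eq_of_frequently hΓ hs E.neg_mem (isOpen_linePoly_neg _ _ _)
      (frequently_neg E E.base_mem fun t ht => ?_) hN, add_sub_cancel_left]
    · change evalAt (linePoly _ _ _) _ < 0
      rw [linePoly_add_smul, hb, zero_add, hnegslope]
      exact mul_neg_of_pos_of_neg ht (neg_neg_of_pos h)
    · change 0 < evalAt (linePoly _ _ _) _
      rw [linePoly_add_smul, hb, zero_add]
      exact mul_pos ht h

/-- The conditions at an extended edge say that the spline is polynomial near the edge. -/
theorem eeeRow_eq_zero_iff (F : CutFrame Δ) (hΩ : IsOpen Ω) (hμ : μ ≤ d) {l : Set Plane}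
    (hl : l ∈ Δ.extendedEdges) (E : Δ.EdgeFrame l) (s : Δ.extSplines d μ) :
    (∀ (r : Fin (d - μ)) (j : Fin (d + 1)),
      eeeRow (F.isOpen_diff_extGrid hΩ) d μ E (μ + 1 + r) j s = 0) ↔
      ∀ z ∈ l, s.1 ∈ polyGerm d z := by
  obtain ⟨C, q, hq, hlC, hqs, hjump, hdir⟩ := F.exists_edge_jump hΩ hμ hl E s.2
  have h0 : ∀ x ∈ l, evalAt (linePoly F.m (F.a C) (F.b C)) x = 0 :=
    fun x hx => (F.subset C (hlC hx)).1
  simp only [eeeRow_apply]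
  set g := cellPoly d s E.pos - cellPoly d s E.neg with hg
  have hdvd : linePoly F.m (F.a C) (F.b C) ^ (μ + 1) ∣ g := by
    rcases hjump with h | h
    · exact ⟨q, h⟩
    · exact ⟨-q, by rw [mul_neg, ← h, hg, neg_sub]⟩
  have hgq : g = 0 ↔ q = 0 := by
    have hne := pow_ne_zero (μ + 1) (linePoly_ne_zero F.m (F.a C) (F.b C))
    rcases hjump with h | h
    · rw [h, mul_eq_zero, or_iff_right hne]
    · rw [hg, ← neg_sub, neg_eq_zero, h, mul_eq_zero, or_iff_right hne]
  have hqz : q = 0 ↔ ∀ z ∈ l, s.1 ∈ polyGerm d z := by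
    constructor
    · rintro rfl z hz
      have := hqs z hz
      rwa [cut_zero, sub_zero] at this
    · intro h
      have hb := Submodule.sub_mem _ (h _ E.base_mem) (hqs _ E.base_mem)
      rw [sub_sub_cancel] at hb
      exact eq_zero_of_cut_mem_polyGerm (h0 _ E.base_mem) hb
  rw [← hqz, ← hgq]
  constructor
  · intro h
    -- The jump is divisible by ℓ^(μ+1), so its transversal coefficients of order at most μ vanish.
    -- The conditions remove orders μ+1 to d, and the degree bound the rest.
    refine eq_zero_of_restrictLine (d := d) (μ := μ) E.norm_dir E.norm_normal E.orthogonal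
      (Submodule.sub_mem _ (cellPoly_spec s.2 E.pos_mem).1 (cellPoly_spec s.2 E.neg_mem).1) ?_
      fun r hr j hj => h ⟨r, by omega⟩ ⟨j, by omega⟩
    have h1 := pow_dvd_pow_of_dvd (X_dvd_affineHom_linePoly (n := E.normal)
      (h0 _ E.base_mem) hdir) (μ + 1)
    rw [← map_pow] at h1
    exact h1.trans (map_dvd _ hdvd)
  · intro h r j
    have h1 : (dirDeriv E.normal)^[μ + 1 + r] (0 : MvPolynomial (Fin 2) ℝ) = 0 :=
      Function.iterate_fixed (map_zero (dirDerivHom E.normal)) _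
    rw [h, h1]
    simp [restrictLine]

theorem splines_le_extSplines (F : CutFrame Δ) (hΩ : IsOpen Ω) :
    Δ.splines d μ ≤ Δ.extSplines d μ := by
  intro s hs
  obtain ⟨h1, h2, h3⟩ := (mem_splineSpace_iff (hΩ.sdiff (isClosed_grid Δ))).1 hs
  exact (mem_splineSpace_iff (F.isOpen_diff_extGrid hΩ)).2
    ⟨h1, h2, fun z hz => h3 z ⟨hz.1, fun h => hz.2 (grid_inter_subset_extGrid ⟨h, hz.1⟩)⟩⟩

/-- The extended edges do not contain the vertices of Δ_c. Near such a vertex off the edges of Δ,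
all rays of the cross-cuts through it belong to extended edges, so all coefficients of the local
model vanish and the spline is polynomial at the vertex too. -/
theorem mem_splines_iff (F : CutFrame Δ) (hΩ : IsOpen Ω) (hμ : μ ≤ d) {s : Plane → ℝ}
    (hs : s ∈ Δ.extSplines d μ) :
    s ∈ Δ.splines d μ ↔ ∀ l ∈ Δ.extendedEdges, ∀ z ∈ l, s ∈ polyGerm d z := by
  obtain ⟨hs0, hcd, hoff⟩ := (mem_splineSpace_iff (F.isOpen_diff_extGrid hΩ)).1 hs
  rw [mem_splineSpace_iff (hΩ.sdiff (isClosed_grid Δ))]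
  constructor
  · rintro ⟨-, -, h⟩ l hl z hz
    obtain ⟨C, -, -, hlC, -⟩ := F.extendedEdge_spec hΩ hl
    exact h z ⟨(F.subset C (hlC z hz).1).2, (hlC z hz).2.2⟩
  · intro h
    have hedge : ∀ (C : Δ.crossCuts) (z : Plane), z ∈ C.1 → z ∉ Δ.vertices → z ∉ Δ.grid →
        s ∈ polyGerm d z := by
      intro C z hzC hzv hzg
      have hz : z ∈ C.1 \ (Δ.grid ∪ ⋃₀ (Δ.crossCuts \ {C.1})) := by
        refine ⟨hzC, ?_⟩
        rintro (h | ⟨C', ⟨hC', hne⟩, hzC'⟩)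
        · exact hzg h
        · exact hzv ⟨C', hC', C.1, C.2, hne, hzC', hzC⟩
      exact h _ ⟨C.1, C.2, z, hz, rfl⟩ z (mem_connectedComponentIn hz)
    refine ⟨hs0, hcd, ?_⟩
    rintro x ⟨hx, hxg⟩
    obtain ⟨L, R, -, hLR⟩ := F.exists_local hΩ hμ hs hx
    have hv : ∀ᶠ z in 𝓝 x, z ∈ Δ.vertices → z = x := by
      have : (Δ.vertices \ {x})ᶜ ∈ 𝓝 x :=
        (Δ.vertices_finite.subset Set.sdiff_subset).isClosed.isOpen_compl.mem_nhds (by simp)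
      filter_upwards [this] with z hz hzv
      by_contra hne
      exact hz ⟨hzv, hne⟩
    have hnear : ∀ C : Δ.crossCuts, x ∈ C.1 → ∀ᶠ z in 𝓝 x,
        evalAt (linePoly F.m (F.a C) (F.b C)) z = 0 → z ≠ x → s ∈ polyGerm d z := by
      intro C hC
      filter_upwards [hv, F.eventually_mem hΩ C hC,
        (isClosed_grid Δ).isOpen_compl.eventually_mem hxg] with z h1 h2 h3 h4 h5
      exact hedge C z (h2 h4) (fun h => h5 (h1 h)) h3
    have hzero : ∀ C ∈ through Δ x, L C = 0 ∧ R C = 0 := by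
      intro C hC
      have hC' := mem_through.1 hC
      have hx0 := (F.subset C hC').1
      constructor
      · obtain ⟨z, ⟨hz0, hzx⟩, h1, h2⟩ := ((frequently_left_of_linePoly hx0).and_eventually
          ((eventually_mem_polyGerm hLR).and (hnear C hC'))).exists
        have h3 := coneModel_sub_cut_left (R := R) (L := L) hμ F.linePoly_eq_zero
          (F.injOn_slope x) hzx hC hz0
        have h4 := Submodule.add_mem _ h1 h3
        rw [sub_add_sub_cancel] at h4
        have h5 := Submodule.sub_mem _ (h2 hz0 fun h => hzx.ne (h ▸ rfl)) h4
        rw [sub_sub_cancel] at h5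
        exact Subtype.ext (eq_zero_of_cut_mem_polyGerm hz0 h5)
      · obtain ⟨z, ⟨hz0, hzx⟩, h1, h2⟩ := ((frequently_right_of_linePoly hx0).and_eventually
          ((eventually_mem_polyGerm hLR).and (hnear C hC'))).exists
        have h3 := coneModel_sub_cut_right (R := R) (L := L) hμ F.linePoly_eq_zero
          (F.injOn_slope x) hzx hC hz0
        have h4 := Submodule.add_mem _ h1 h3
        rw [sub_add_sub_cancel] at h4
        have h5 := Submodule.sub_mem _ (h2 hz0 fun h => hzx.ne (h ▸ rfl)) h4
        rw [sub_sub_cancel] at h5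
        exact Subtype.ext (eq_zero_of_cut_mem_polyGerm hz0 h5)
    have hcone : coneModel F.m F.a F.b μ (d - μ) (through Δ x) x L R = 0 := by
      ext y
      refine Finset.sum_eq_zero fun C hC => ?_
      rw [(hzero C hC).1, (hzero C hC).2, ite_self, Submodule.coe_zero, cut_zero, Pi.zero_apply]
    rwa [hcone, sub_zero] at hLR

theorem ker_eeeHom (F : CutFrame Δ) (hΩ : IsOpen Ω) (hμ : μ ≤ d)
    (E : ∀ l : Δ.extendedEdges, Δ.EdgeFrame l) :
    LinearMap.ker (eeeHom (F.isOpen_diff_extGrid hΩ) d μ E) =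
      (Δ.splines d μ).comap (Δ.extSplines d μ).subtype := by
  ext s
  rw [LinearMap.mem_ker, Submodule.mem_comap, Submodule.subtype_apply,
    F.mem_splines_iff hΩ hμ s.2]
  constructor
  · intro h l hl
    refine (F.eeeRow_eq_zero_iff hΩ hμ hl (E ⟨l, hl⟩) s).1 fun r j => ?_
    exact congrFun h (⟨l, hl⟩, r, j)
  · intro h
    ext q
    exact (F.eeeRow_eq_zero_iff hΩ hμ q.1.2 (E q.1) s).2 (h _ q.1.2) q.2.1 q.2.2

end CutFrame

end SplineDim

end

/-! ### The dimension formula by rank-nullity -/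

theorem mainTheorem2 (Ω : Set SplineDim.Plane) (hΩ : SplineDim.IsPolygonalDomain Ω)
    (Δ : SplineDim.PolygonalPartition Ω) (d μ : ℕ) (hμ : μ ≤ d) :
    FiniteDimensional ℝ (Δ.splines d μ) ∧
    FiniteDimensional ℝ (Δ.extSplines d μ) ∧
    (∀ l ∈ Δ.extendedEdges, Nonempty (Δ.EdgeFrame l)) ∧
    ∀ (n : ℕ) (N : Module.Basis (Fin n) ℝ (Δ.extSplines d μ))
      (F : ∀ l : Δ.extendedEdges, Δ.EdgeFrame l),
      (Module.finrank ℝ (Δ.splines d μ) : ℤ) =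
        ((d + 2).choose 2 : ℤ) + (Δ.crossCuts.ncard : ℤ) * ((d - μ + 1).choose 2 : ℤ)
          + ∑ A ∈ Δ.vertices_finite.toFinset, SplineDim.vertexDim d μ (Δ.cutsThrough A)
          - ((SplineDim.eeeMatrix Δ d μ N F).rank : ℤ) := by
  obtain ⟨G⟩ := SplineDim.nonempty_cutFrame Δ
  have hfin := G.finite_extSplines hΩ.isOpen hΩ.simplyConnected hμ
  have hle := G.splines_le_extSplines (d := d) (μ := μ) hΩ.isOpen
  refine ⟨Submodule.finiteDimensional_of_le hle, hfin,
    fun l hl => G.nonempty_edgeFrame hΩ.isOpen hl, fun n N F => ?_⟩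
  have hrank := LinearMap.finrank_range_add_finrank_ker
    (SplineDim.eeeHom (G.isOpen_diff_extGrid hΩ.isOpen) d μ F)
  rw [G.ker_eeeHom hΩ.isOpen hμ F, (Submodule.comapSubtypeEquivOfLe hle).finrank_eq,
    ← SplineDim.rank_eeeMatrix _ N F] at hrank
  rw [← G.finrank_extSplines hΩ.isOpen hΩ.simplyConnected hμ, ← hrank]
  push_cast
  ring
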